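/- Let $\mathcal B$ be an additive category and let $\mathcal A$ be a monoidal homotopy category over $\mathcal B$: a full subcategory of the category of cochain complexes over $\mathcal B$ closed under shifts and mapping cones, with a monoidal structure defined on graded maps of all degrees (a dg monoidal structure, with the Koszul sign rule). Write $\simeq$ for chain homotopy. Let $\mathcal K$ be a category of scalars: a symmetric monoidal category with a braided monoidal functor to the Drinfeld center of $\mathcal A$, whose half-braidings are natural for graded maps of all degrees. Scalars and their images in $\mathcal A$ are denoted alike, and the tensor sign and the braidings $\tau$ of scalars with other objects are suppressed. A scalar $\lambda$ is small if $\mathbb 1[u]=\bigoplus_{k\ge 0}\lambda^{k}$ exists, is also the product of the $\lambda^k$, and $X\otimes\mathbb 1[u]\otimes Y$ is both the sum and the product of the $X\lambda^kY$ for all $X,Y\in\mathcal A$ (all for graded maps). Let $F\in\mathcal A$, let $I$ be a finite totally ordered set, let $\lambda_i$ ($i\in I$) be invertible scalars whose self-braidings $\tau_{\lambda_i,\lambda_i}$ are the identity, such that $\lambda_i\lambda_j^{-1}$ is small whenever $i>j$, and let $\alpha_i:\lambda_i\to F$ be chain maps. Assume that $\{\alpha_i\}$ is a *saturated collection of eigenmaps*: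 (PD1) $\bigotimes_{i\in I}\mathrm{Cone}(\alpha_i)\simeq 0$ for all orderings of the factors; (PD2) $I$ is minimal with property (PD1), i.e. no proper subset of $I$ has it; (PD3) $\bigotimes_{a=1}^s\mathrm{Cone}(\alpha_{\pi(a)})\simeq 0$ for every surjection $\pi:\{1,\dots,s\}\to I$. Assume also that it is *obstruction-free*: there are $h_i\in\mathrm{Hom}^{-1}(\lambda_iF,FF)$ with $d h_i+h_i d=\alpha_iF-F\alpha_i$ such that $z_{ij}=h_i\circ\alpha_j+h_j\circ\alpha_i\in \mathrm{Hom}^{-1}(\lambda_i\lambda_j,FF)$ for $i\ne j$ and $w_i=h_i\circ\alpha_i\in\mathrm{Hom}^{-1}(\lambda_i\lambda_i,FF)$ are all null-homotopic. For $i>j$ put $\lambda=\lambda_i$, $\mu=\lambda_j$, $\alpha=\alpha_i$, $\beta=\alpha_j$. Let $C_{i,j}$ be the mapping cone of the map $\bigoplus_{k\ge1}\frac{\lambda^k}{\mu^k}\to\bigoplus_{k\ge0}\frac{\lambda^k}{\mu^{k+1}}F$ which is $\alpha$ from the $k$-th to the $(k-1)$-st summand and $-\beta$ from the $k$-th to the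 $k$-th summand, and let $C_{j,i}$ be the mapping cone, shifted by $[-1]$, of the map $\bigoplus_{k\ge0}\frac{\lambda^k}{\mu^k}\to\bigoplus_{k\ge0}\frac{\lambda^k}{\mu^{k+1}}F$ given by the same formula. The periodicity map $u_i/u_j:\frac{\lambda}{\mu}C_{i,j}\to C_{i,j}$ sends each copy of $\mathbb 1$ and of $F$ identically to the next one; the periodicity map $u_j/u_i:\frac{\mu}{\lambda}C_{j,i}\to C_{j,i}$ sends each copy identically to the previous one and kills the $0$-th copies of $\mathbb 1$ and of $F$. Fix $i\in I$ and put $P_i=\bigotimes_{j\ne i}C_{j,i}$, for any chosen ordering of the factors. For $j\neq i$ let $u_j/u_i:\frac{\lambda_j}{\lambda_i}P_i\to P_i$ be the endomorphism of degree $\lambda_j/\lambda_i$ induced by the periodicity map of the factor $C_{j,i}$. Then $\alpha_i\otimes\mathrm{Id}_{P_i}:\lambda_iP_i\to FP_i$ is a homotopy equivalence, so that the endomorphism $$\frac{\alpha_j}{\alpha_i}:=\lambda_i^{-1}\otimes\big((\alpha_i\otimes \mathrm{Id}_{P_i})^{-1}\circ(\alpha_j\otimes\mathrm{Id}_{P_i})\big):\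 \frac{\lambda_j}{\lambda_i}P_i\to P_i$$ is defined up to homotopy, and for all $j\neq i$ $$\frac{u_j}{u_i}\simeq\frac{\alpha_j}{\alpha_i}$$ as endomorphisms of $P_i$ of degree $\lambda_j/\lambda_i$. -/

import Mathlib

open CategoryTheory MonoidalCategory Limits CochainComplex.HomComplex

namespace CatDiag

universe v u w' w

noncomputable section

/-! ## Homotopy categories and their dg monoidal structures -/

section Homotopy

variable {B : Type u} [Category.{v} B] [Preadditive B]

/-- The full subcategory of complexes over `B` with the property `P` (and chain maps). -/
abbrev Cx (P : ObjectProperty (CochainComplex B ℤ)) := P.FullSubcategory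

variable {P : ObjectProperty (CochainComplex B ℤ)}

/-- Graded maps of degree `n`, i.e. elements of `Hom^n(X, Y)`, not necessarily chain maps.
The differential of `Hom^•(X, Y)` is `δ`. -/
abbrev Coch (X Y : Cx P) (n : ℤ) := Cochain X.obj Y.obj n

/-- A chain map, seen as an element of `Hom^0(X, Y)`. -/
abbrev coch {X Y : Cx P} (f : X ⟶ Y) : Coch X Y 0 := Cochain.ofHom f.hom

/-- Two elements of `Hom^0(X, Y)` are homotopic if their difference is a boundary. For chain maps
this is the usual chain homotopy relation. If one of the two is a chain map, so is the other. -/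
def Homotopic {X Y : Cx P} (f g : Coch X Y 0) : Prop :=
  ∃ H : Coch X Y (-1), δ (-1) 0 H = f - g

/-- `X ≃ 0` in the homotopy category. -/
def IsContractible (X : Cx P) : Prop := Homotopic (coch (𝟙 X)) 0

/-- `g` is an inverse of `f` up to homotopy. -/
def IsHomotopyInverse {X Y : Cx P} (f : X ⟶ Y) (g : Y ⟶ X) : Prop :=
  Homotopic (coch (f ≫ g)) (coch (𝟙 X)) ∧ Homotopic (coch (g ≫ f)) (coch (𝟙 Y))

/-- A monoidal structure on the category of complexes with property `P` (whose homotopy category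
is then a monoidal homotopy category) in which the tensor product of maps is defined for
graded maps of every degree: it is additive, functorial, compatible with the differentials of the
`Hom` complexes, satisfies the interchange law with the Koszul sign, and the associators and
unitors are natural for all graded maps. -/
class DGMonoidal (P : ObjectProperty (CochainComplex B ℤ)) [MonoidalCategory (Cx P)] where
  /-- `X ⊗ z` for a graded map `z`. -/
  wL (X : Cx P) {Y Z : Cx P} {n : ℤ} : Coch Y Z n →+ Coch (X ⊗ Y) (X ⊗ Z) n
  /-- `z ⊗ Y` for a graded map `z`. -/
  wR {X Z : Cx P} {n : ℤ} (Y : Cx P) : Coch X Z n →+ Coch (X ⊗ Y) (Z ⊗ Y) n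
  wL_coch (X : Cx P) {Y Z : Cx P} (f : Y ⟶ Z) : wL X (coch f) = coch (X ◁ f)
  wR_coch {X Z : Cx P} (f : X ⟶ Z) (Y : Cx P) : wR Y (coch f) = coch (f ▷ Y)
  wL_comp (X : Cx P) {Y Z W : Cx P} {m n p : ℤ} (z : Coch Y Z m) (z' : Coch Z W n)
    (h : m + n = p) : wL X (z.comp z' h) = (wL X z).comp (wL X z') h
  wR_comp {Y Z W : Cx P} {m n p : ℤ} (z : Coch Y Z m) (z' : Coch Z W n) (h : m + n = p)
    (X : Cx P) : wR X (z.comp z' h) = (wR X z).comp (wR X z') h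
  δ_wL (X : Cx P) {Y Z : Cx P} (m n : ℤ) (z : Coch Y Z m) : δ m n (wL X z) = wL X (δ m n z)
  δ_wR {Y Z : Cx P} (m n : ℤ) (z : Coch Y Z m) (X : Cx P) : δ m n (wR X z) = wR X (δ m n z)
  exchange {X X' Y Y' : Cx P} {m n p : ℤ} (f : Coch X X' m) (g : Coch Y Y' n) (h : m + n = p)
    (h' : n + m = p) :
    (wL X g).comp (wR Y' f) h' = (m * n).negOnePow • (wR Y f).comp (wL X' g) h
  assoc_left {X X' : Cx P} {n : ℤ} (z : Coch X X' n) (Y Z : Cx P) :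
    (wR Z (wR Y z)).comp (coch (α_ X' Y Z).hom) (add_zero n) =
      (coch (α_ X Y Z).hom).comp (wR (Y ⊗ Z) z) (zero_add n)
  assoc_middle (X : Cx P) {Y Y' : Cx P} {n : ℤ} (z : Coch Y Y' n) (Z : Cx P) :
    (wR Z (wL X z)).comp (coch (α_ X Y' Z).hom) (add_zero n) =
      (coch (α_ X Y Z).hom).comp (wL X (wR Z z)) (zero_add n)
  assoc_right (X Y : Cx P) {Z Z' : Cx P} {n : ℤ} (z : Coch Z Z' n) :
    (wL (X ⊗ Y) z).comp (coch (α_ X Y Z').hom) (add_zero n) =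
      (coch (α_ X Y Z).hom).comp (wL X (wL Y z)) (zero_add n)
  left_unitor {X X' : Cx P} {n : ℤ} (z : Coch X X' n) :
    (wL (𝟙_ (Cx P)) z).comp (coch (λ_ X').hom) (add_zero n) =
      (coch (λ_ X).hom).comp z (zero_add n)
  right_unitor {X X' : Cx P} {n : ℤ} (z : Coch X X' n) :
    (wR (𝟙_ (Cx P)) z).comp (coch (ρ_ X').hom) (add_zero n) =
      (coch (ρ_ X).hom).comp z (zero_add n)

/-- Closure under mapping cones. Together with stability under shifts this says that the complexes
with property `P` form a triangulated subcategory of the homotopy category `K(B)`. -/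
class IsClosedUnderCones [HasBinaryBiproducts B] (P : ObjectProperty (CochainComplex B ℤ)) :
    Prop where
  cone {X Y : CochainComplex B ℤ} (f : X ⟶ Y) : P X → P Y → P (CochainComplex.mappingCone f)

/-- The mapping cone `Cone(f)`, with underlying graded object `X[1] ⊕ Y`. -/
def cone [HasBinaryBiproducts B] [IsClosedUnderCones P] {X Y : Cx P} (f : X ⟶ Y) : Cx P :=
  ⟨CochainComplex.mappingCone f.hom, IsClosedUnderCones.cone _ X.property Y.property⟩

/-- The projection `Cone(f) ⟶ X[1]` of graded objects, as a map of degree `1`. -/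
def coneFst [HasBinaryBiproducts B] [IsClosedUnderCones P] {X Y : Cx P} (f : X ⟶ Y) :
    Coch (cone f) X 1 := (CochainComplex.mappingCone.fst f.hom).1

/-- The projection `Cone(f) ⟶ Y` of graded objects. -/
def coneSnd [HasBinaryBiproducts B] [IsClosedUnderCones P] {X Y : Cx P} (f : X ⟶ Y) :
    Coch (cone f) Y 0 := CochainComplex.mappingCone.snd f.hom

/-- The inclusion `X[1] ⟶ Cone(f)` of graded objects, as a map of degree `-1`. -/
def coneInl [HasBinaryBiproducts B] [IsClosedUnderCones P] {X Y : Cx P} (f : X ⟶ Y) :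
    Coch X (cone f) (-1) := CochainComplex.mappingCone.inl f.hom

/-- The inclusion `Y ⟶ Cone(f)`. -/
def coneInr [HasBinaryBiproducts B] [IsClosedUnderCones P] {X Y : Cx P} (f : X ⟶ Y) :
    Y ⟶ cone f := ObjectProperty.homMk (CochainComplex.mappingCone.inr f.hom)

/-- The shift `X[n]`. -/
abbrev shift [P.IsStableUnderShift ℤ] (X : Cx P) (n : ℤ) : Cx P :=
  ⟨(shiftFunctor (CochainComplex B ℤ) n).obj X.obj, P.le_shift n _ X.property⟩

/-- The identity of the graded object underlying `X`, as a closed map `X ⟶ X[-1]` of degree `1`. -/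
def toShift [P.IsStableUnderShift ℤ] (X : Cx P) : Coch X (shift X (-1)) 1 :=
  (Cochain.ofHom (𝟙 X.obj)).rightShift (-1) 1 (add_neg_cancel 1)

/-- The identity of the graded object underlying `X`, as a closed map `X[-1] ⟶ X` of
degree `-1`. -/
def fromShift [P.IsStableUnderShift ℤ] (X : Cx P) : Coch (shift X (-1)) X (-1) :=
  (Cochain.ofHom (𝟙 ((shiftFunctor (CochainComplex B ℤ) (-1 : ℤ)).obj X.obj))).rightUnshift (-1)
    (zero_add (-1))

/-! ## Sums that are simultaneously products -/

/-- `S`, with the injections `ι k` and the projections `π k`, is at the same time the coproduct and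
the product of the complexes `X k` (for graded maps of every degree). -/
structure IsBisum {X : ℕ → Cx P} {S : Cx P} (ι : ∀ k, X k ⟶ S) (π : ∀ k, S ⟶ X k) : Prop where
  ι_π_self (k : ℕ) : ι k ≫ π k = 𝟙 (X k)
  ι_π_ne (k l : ℕ) (h : k ≠ l) : ι k ≫ π l = 0
  coproduct (Z : Cx P) (n : ℤ) : Function.Bijective
    (fun (z : Coch S Z n) (k : ℕ) => ((coch (ι k)).comp z (zero_add n) : Coch (X k) Z n))
  product (Z : Cx P) (n : ℤ) : Function.Bijective
    (fun (z : Coch Z S n) (k : ℕ) => (z.comp (coch (π k)) (add_zero n) : Coch Z (X k) n))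

namespace IsBisum

variable {X : ℕ → Cx P} {S : Cx P} {ι : ∀ k, X k ⟶ S} {π : ∀ k, S ⟶ X k}

lemma exists_desc (h : IsBisum ι π) {Z : Cx P} (g : ∀ k, X k ⟶ Z) :
    ∃ f : S ⟶ Z, ∀ k, ι k ≫ f = g k := by
  obtain ⟨z, hz⟩ := (h.coproduct Z 0).2 (fun k => coch (g k))
  have hz' : ∀ k, (coch (ι k)).comp z (zero_add 0) = coch (g k) := fun k => congrFun hz k
  have hδ : δ 0 1 z = 0 := by
    apply (h.coproduct Z 1).1
    funext k
    have h1 := congrArg (δ 0 1) (hz' k)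
    rw [δ_ofHom_comp, δ_ofHom] at h1
    simpa using h1
  refine ⟨ObjectProperty.homMk (Cocycle.homOf (Cocycle.mk z 1 (zero_add 1) hδ)), fun k => ?_⟩
  apply ObjectProperty.hom_ext
  apply Cochain.ofHom_injective
  change coch _ = coch (g k)
  rw [← hz' k]
  simp [coch, Cochain.ofHom_comp]

lemma exists_lift (h : IsBisum ι π) {Z : Cx P} (g : ∀ k, Z ⟶ X k) :
    ∃ f : Z ⟶ S, ∀ k, f ≫ π k = g k := by
  obtain ⟨z, hz⟩ := (h.product Z 0).2 (fun k => coch (g k))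
  have hz' : ∀ k, z.comp (coch (π k)) (add_zero 0) = coch (g k) := fun k => congrFun hz k
  have hδ : δ 0 1 z = 0 := by
    apply (h.product Z 1).1
    funext k
    have h1 := congrArg (δ 0 1) (hz' k)
    rw [δ_comp_ofHom, δ_ofHom] at h1
    simpa using h1
  refine ⟨ObjectProperty.homMk (Cocycle.homOf (Cocycle.mk z 1 (zero_add 1) hδ)), fun k => ?_⟩
  apply ObjectProperty.hom_ext
  apply Cochain.ofHom_injective
  change coch _ = coch (g k)
  rw [← hz' k]
  simp [coch, Cochain.ofHom_comp]

/-- The chain map out of the coproduct with given components. -/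
def desc (h : IsBisum ι π) {Z : Cx P} (g : ∀ k, X k ⟶ Z) : S ⟶ Z := (h.exists_desc g).choose

/-- The chain map into the product with given components. -/
def lift (h : IsBisum ι π) {Z : Cx P} (g : ∀ k, Z ⟶ X k) : Z ⟶ S := (h.exists_lift g).choose

lemma ι_desc (h : IsBisum ι π) {Z : Cx P} (g : ∀ k, X k ⟶ Z) (k : ℕ) :
    ι k ≫ h.desc g = g k := (h.exists_desc g).choose_spec k

lemma lift_π (h : IsBisum ι π) {Z : Cx P} (g : ∀ k, Z ⟶ X k) (k : ℕ) :
    h.lift g ≫ π k = g k := (h.exists_lift g).choose_spec k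

end IsBisum

end Homotopy

/-! ## Scalars -/

section Scalars

variable {B : Type u} [Category.{v} B] [Preadditive B] {P : ObjectProperty (CochainComplex B ℤ)}
  [MonoidalCategory (Cx P)] {K : Type w} [Category.{w'} K] [MonoidalCategory K]

/-- The complex underlying the image of the scalar `s` in the Drinfeld center. -/
abbrev sc (ρ : K ⥤ Center (Cx P)) (s : K) : Cx P := (ρ ⋙ Center.forget (Cx P)).obj s

/-- The map of complexes induced by a map of scalars. -/
abbrev scMap (ρ : K ⥤ Center (Cx P)) {s t : K} (f : s ⟶ t) : sc ρ s ⟶ sc ρ t :=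
  (ρ ⋙ Center.forget (Cx P)).map f

/-- The braiding isomorphism `s ⊗ X ≅ X ⊗ s` of the scalar `s` with an arbitrary object. -/
abbrev swap (ρ : K ⥤ Center (Cx P)) (s : K) (X : Cx P) : sc ρ s ⊗ X ≅ X ⊗ sc ρ s :=
  (ρ.obj s).2.β X

/-- The braidings of the scalars are natural with respect to graded maps of every degree. -/
def IsDGCentral [DGMonoidal P] (ρ : K ⥤ Center (Cx P)) : Prop :=
  ∀ (s : K) (X Y : Cx P) (n : ℤ) (z : Coch X Y n),
    (DGMonoidal.wL (sc ρ s) z).comp (coch (swap ρ s Y).hom) (add_zero n) =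
      (coch (swap ρ s X).hom).comp (DGMonoidal.wR (sc ρ s) z) (zero_add n)

/-- The isomorphism `s ⊗ t ≅ (s ⊗ t)` between the tensor product of complexes and the tensor
product of scalars. -/
abbrev scMul (ρ : K ⥤ Center (Cx P)) [ρ.Monoidal] (s t : K) :
    sc ρ s ⊗ sc ρ t ≅ sc ρ (s ⊗ t) :=
  Functor.Monoidal.μIso (ρ ⋙ Center.forget (Cx P)) s t

/-- The isomorphism between the unit complex and the unit scalar. -/
abbrev scOne (ρ : K ⥤ Center (Cx P)) [ρ.Monoidal] : 𝟙_ (Cx P) ≅ sc ρ (𝟙_ K) :=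
  Functor.Monoidal.εIso (ρ ⋙ Center.forget (Cx P))

/-- The tensor powers `𝟙, s, s², s³, …` of a scalar. -/
def scPow (ρ : K ⥤ Center (Cx P)) (s : K) : ℕ → Cx P
  | 0 => 𝟙_ (Cx P)
  | k + 1 => sc ρ s ⊗ scPow ρ s k

/-- The scalar `s` is small, exhibited by the object `𝟙[u] = 𝟙 ⊕ s ⊕ s² ⊕ ⋯`, where `u` is a
formal variable of degree `s`: this sum exists, it is also a product, and
`X ⊗ 𝟙[u] ⊗ Y` is both the sum and the product of the `X ⊗ sᵏ ⊗ Y` for all `X` and `Y`. -/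
structure Small (ρ : K ⥤ Center (Cx P)) (s : K) where
  /-- the object `𝟙[u]` -/
  obj : Cx P
  /-- the injection of the summand `uᵏ` -/
  ι (k : ℕ) : scPow ρ s k ⟶ obj
  /-- the projection to the summand `uᵏ` -/
  π (k : ℕ) : obj ⟶ scPow ρ s k
  isBisum : IsBisum ι π
  isBisum_tensor (X Y : Cx P) :
    IsBisum (fun k => X ◁ (ι k ▷ Y)) (fun k => X ◁ (π k ▷ Y))

namespace Small

variable {ρ : K ⥤ Center (Cx P)} {s : K}

/-- Multiplication by `u`: it sends `s ⊗ uᵏ` identically to `uᵏ⁺¹`. -/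
def mulU (Γ : Small ρ s) : sc ρ s ⊗ Γ.obj ⟶ Γ.obj :=
  Γ.isBisum.lift (fun k => match k with
    | 0 => 0
    | k + 1 => sc ρ s ◁ Γ.π k)

/-- Division by `u`: it kills `u⁰` and sends `uᵏ⁺¹` identically to `s ⊗ uᵏ`. -/
def divU (Γ : Small ρ s) : Γ.obj ⟶ sc ρ s ⊗ Γ.obj :=
  Γ.isBisum.desc (fun k => match k with
    | 0 => 0
    | k + 1 => sc ρ s ◁ Γ.ι k)

end Small

variable (K) in
/-- An invertible scalar, with a chosen inverse. -/
structure InvertibleScalar where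
  obj : K
  inv : K
  iso : obj ⊗ inv ≅ 𝟙_ K

/-- The scalar `l / m`. -/
abbrev InvertibleScalar.div (l m : InvertibleScalar K) : K := l.obj ⊗ m.inv

end Scalars

/-! ## Eigenmaps -/

section Eigenmaps

variable {B : Type u} [Category.{v} B] [Preadditive B] [HasBinaryBiproducts B]
  {P : ObjectProperty (CochainComplex B ℤ)}
  [P.IsStableUnderShift ℤ] [IsClosedUnderCones P] [MonoidalCategory (Cx P)] [DGMonoidal P]
  {K : Type w} [Category.{w'} K] [MonoidalCategory K] [SymmetricCategory K]
  (ρ : K ⥤ Center (Cx P)) [ρ.Monoidal]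

/-- The tensor product of a finite sequence of complexes, in the given order. -/
def tensorList : List (Cx P) → Cx P
  | [] => 𝟙_ (Cx P)
  | X :: L => X ⊗ tensorList L

/-- The collection of maps `α i : λ i ⟶ F` is a saturated collection of eigenmaps for `F`. -/
structure IsSaturated {I : Type*} {lam : I → K} {F : Cx P} (α : ∀ i, sc ρ (lam i) ⟶ F) : Prop where
  /-- The tensor product of all the eigencones is contractible, in every order. -/
  pd1 : ∀ L : List I, L.Nodup → (∀ i, i ∈ L) →
    IsContractible (tensorList (L.map fun i => cone (α i)))
  /-- The index set is minimal with this property. -/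
  pd2 : ∀ J : Set I, J ≠ Set.univ → ¬ ∀ L : List I, L.Nodup → (∀ i, i ∈ L ↔ i ∈ J) →
    IsContractible (tensorList (L.map fun i => cone (α i)))
  /-- Every tensor product of eigencones in which each index occurs is contractible. -/
  pd3 : ∀ L : List I, (∀ i, i ∈ L) →
    IsContractible (tensorList (L.map fun i => cone (α i)))

/-- The collection of maps `α i : λ i ⟶ F` is obstruction-free: there are homotopies `h i` which
express that `α i` commutes with `F`, such that the cycles
`z i j = h i ∘ α j + h j ∘ α i` (for `i ≠ j`) and `w i = h i ∘ α i` are null-homotopic. -/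
def IsObstructionFree {I : Type*} {lam : I → K} {F : Cx P} (α : ∀ i, sc ρ (lam i) ⟶ F) : Prop :=
  ∃ h : ∀ i, Coch (sc ρ (lam i) ⊗ F) (F ⊗ F) (-1),
    (∀ i, δ (-1) 0 (h i) = coch (α i ▷ F) - coch ((swap ρ (lam i) F).hom ≫ F ◁ α i)) ∧
    (∀ i j, i ≠ j → ∃ k : Coch (sc ρ (lam i) ⊗ sc ρ (lam j)) (F ⊗ F) (-2),
      δ (-2) (-1) k =
        (coch (sc ρ (lam i) ◁ α j)).comp (h i) (zero_add (-1)) +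
        (coch ((swap ρ (lam i) (sc ρ (lam j))).hom ≫ sc ρ (lam j) ◁ α i)).comp (h j)
          (zero_add (-1))) ∧
    (∀ i, ∃ k : Coch (sc ρ (lam i) ⊗ sc ρ (lam i)) (F ⊗ F) (-2),
      δ (-2) (-1) k = (coch (sc ρ (lam i) ◁ α i)).comp (h i) (zero_add (-1)))

/-- The isomorphism of scalars `l / m ≅ m⁻¹ ⊗ l`. -/
def divIso (l m : InvertibleScalar K) : sc ρ (l.div m) ≅ sc ρ m.inv ⊗ sc ρ l.obj :=
  (ρ ⋙ Center.forget (Cx P)).mapIso (β_ l.obj m.inv) ≪≫ (scMul ρ m.inv l.obj).symm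

/-- The isomorphism of scalars `m⁻¹ ⊗ m ≅ 𝟙`. -/
def invMulIso (m : InvertibleScalar K) : sc ρ m.inv ⊗ sc ρ m.obj ≅ 𝟙_ (Cx P) :=
  scMul ρ m.inv m.obj ≪≫
    (ρ ⋙ Center.forget (Cx P)).mapIso (β_ m.inv m.obj ≪≫ m.iso) ≪≫ (scOne ρ).symm

/-- The isomorphism of scalars `(m / l) ⊗ (l / m) ≅ 𝟙`. -/
def divMulDivIso (m l : InvertibleScalar K) : sc ρ (m.div l) ⊗ sc ρ (l.div m) ≅ 𝟙_ (Cx P) :=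
  scMul ρ (m.div l) (l.div m) ≪≫
    (ρ ⋙ Center.forget (Cx P)).mapIso
      (α_ m.obj l.inv (l.obj ⊗ m.inv) ≪≫
        whiskerLeftIso m.obj ((α_ l.inv l.obj m.inv).symm ≪≫
          whiskerRightIso (β_ l.inv l.obj ≪≫ l.iso) m.inv ≪≫ λ_ m.inv) ≪≫ m.iso) ≪≫
    (scOne ρ).symm

variable {F : Cx P}

/-- `α : l ⟶ F`, divided by `m`: the map `l / m ⟶ m⁻¹ F`. -/
def divMap {l : InvertibleScalar K} (m : InvertibleScalar K) (α : sc ρ l.obj ⟶ F) :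
    sc ρ (l.div m) ⟶ sc ρ m.inv ⊗ F :=
  (divIso ρ l m).hom ≫ sc ρ m.inv ◁ α

/-- `β : m ⟶ F`, divided by `m`: the map `𝟙 ⟶ m⁻¹ F`. -/
def divSelfMap {m : InvertibleScalar K} (β : sc ρ m.obj ⟶ F) : 𝟙_ (Cx P) ⟶ sc ρ m.inv ⊗ F :=
  (invMulIso ρ m).inv ≫ sc ρ m.inv ◁ β

variable {ρ}

/-- For `l / m` small, the map from `⨁_{k ≥ 1} (l/m)ᵏ` to `⨁_{k ≥ 0} (l/m)ᵏ m⁻¹ F` which is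
`α` from the `k`-th summand to the `(k-1)`-st one and `-β` from the `k`-th summand to the
`k`-th one. Here the source is written as `(l/m) ⊗ 𝟙[u]` and the target as `𝟙[u] ⊗ m⁻¹ F`. -/
def zigzagPos {l m : InvertibleScalar K} (Γ : Small ρ (l.div m))
    (α : sc ρ l.obj ⟶ F) (β : sc ρ m.obj ⟶ F) :
    sc ρ (l.div m) ⊗ Γ.obj ⟶ Γ.obj ⊗ (sc ρ m.inv ⊗ F) :=
  (swap ρ (l.div m) Γ.obj).hom ≫ Γ.obj ◁ divMap ρ m α -
    Γ.mulU ≫ (ρ_ Γ.obj).inv ≫ Γ.obj ◁ divSelfMap ρ β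

/-- For `l / m` small, the map from `⨁_{k ≥ 0} (l/m)ᵏ` to `⨁_{k ≥ 0} (l/m)ᵏ m⁻¹ F` which is
`α` from the `k`-th summand to the `(k-1)`-st one, for `k ≥ 1`, and `-β` from the `k`-th summand
to the `k`-th one, for `k ≥ 0`. -/
def zigzagNeg {l m : InvertibleScalar K} (Γ : Small ρ (l.div m))
    (α : sc ρ l.obj ⟶ F) (β : sc ρ m.obj ⟶ F) :
    Γ.obj ⟶ Γ.obj ⊗ (sc ρ m.inv ⊗ F) :=
  Γ.divU ≫ (swap ρ (l.div m) Γ.obj).hom ≫ Γ.obj ◁ divMap ρ m α -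
    (ρ_ Γ.obj).inv ≫ Γ.obj ◁ divSelfMap ρ β

/-- A complex `C` with an endomorphism of degree `s`, that is, a map `s ⊗ C ⟶ C`. -/
structure PeriodicComplex (ρ : K ⥤ Center (Cx P)) (s : K) where
  obj : Cx P
  map : Coch (sc ρ s ⊗ obj) obj 0

/-- Given `s`-endomorphisms `f` of `X` and `g` of `Y`, compatible with `φ : X ⟶ Y`, the induced
`s`-endomorphism `f[1] ⊕ g` of `Cone(φ)`. -/
def coneEnd {s : K} {X Y : Cx P} (φ : X ⟶ Y) (f : sc ρ s ⊗ X ⟶ X) (g : sc ρ s ⊗ Y ⟶ Y) :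
    Coch (sc ρ s ⊗ cone φ) (cone φ) 0 :=
  ((DGMonoidal.wL (sc ρ s) (coneFst φ)).comp (coch f) (add_zero 1)).comp (coneInl φ)
      (add_neg_cancel 1) +
    ((DGMonoidal.wL (sc ρ s) (coneSnd φ)).comp (coch g) (add_zero 0)).comp (coch (coneInr φ))
      (add_zero 0)

/-- The complex `C_{α,β}(F)`, for `l / m` small, with its periodicity endomorphism of degree
`l / m`, which sends each copy of `𝟙` and of `F` identically to the next one. -/
def cPos {l m : InvertibleScalar K} (Γ : Small ρ (l.div m))
    (α : sc ρ l.obj ⟶ F) (β : sc ρ m.obj ⟶ F) : PeriodicComplex ρ (l.div m) where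
  obj := cone (zigzagPos Γ α β)
  map := coneEnd (zigzagPos Γ α β) (sc ρ (l.div m) ◁ Γ.mulU)
    ((α_ _ _ _).inv ≫ Γ.mulU ▷ (sc ρ m.inv ⊗ F))

/-- The map `(m/l) ⊗ 𝟙[u] ⟶ 𝟙[u]`, for `u` of degree `l / m`, which sends `uᵏ⁺¹` identically to
`uᵏ` and kills `u⁰`. -/
def lowerU {l m : InvertibleScalar K} (Γ : Small ρ (l.div m)) :
    sc ρ (m.div l) ⊗ Γ.obj ⟶ Γ.obj :=
  sc ρ (m.div l) ◁ Γ.divU ≫ (α_ _ _ _).inv ≫ (divMulDivIso ρ m l).hom ▷ Γ.obj ≫ (λ_ Γ.obj).hom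

/-- The complex `C_{β,α}(F)`, for `l / m` small, with its periodicity endomorphism of degree
`m / l`, which sends each copy of `𝟙` and of `F` identically to the previous one, and kills
the first copy of `𝟙` and of `F`. -/
def cNeg {l m : InvertibleScalar K} (Γ : Small ρ (l.div m))
    (α : sc ρ l.obj ⟶ F) (β : sc ρ m.obj ⟶ F) : PeriodicComplex ρ (m.div l) where
  obj := shift (cone (zigzagNeg Γ α β)) (-1)
  map := ((DGMonoidal.wL (sc ρ (m.div l)) (fromShift (cone (zigzagNeg Γ α β)))).comp
    (coneEnd (zigzagNeg Γ α β) (lowerU Γ) ((α_ _ _ _).inv ≫ lowerU Γ ▷ (sc ρ m.inv ⊗ F)))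
      (add_zero (-1))).comp (toShift (cone (zigzagNeg Γ α β))) (by norm_num)

section Interpolation

variable {I : Type*} [LinearOrder I] {lam : I → InvertibleScalar K}
  (Γ : ∀ i j, j < i → Small ρ ((lam i).div (lam j))) (α : ∀ i, sc ρ (lam i).obj ⟶ F)

/-- The complex `C_{j,i}(F)` for `j ≠ i`, with its periodicity endomorphism `u_j / u_i` of degree
`λ_j / λ_i`. -/
def cPair (i : I) (j : {j : I // j ≠ i}) : PeriodicComplex ρ ((lam j.1).div (lam i)) :=
  if h : i < j.1 then cPos (Γ j.1 i h) (α j.1) (α i)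
  else cNeg (Γ i j.1 (lt_of_le_of_ne (not_lt.mp h) j.2)) (α i) (α j.1)

/-- The interpolation complex `P_i(F)`: the tensor product of the complexes `C_{j,i}(F)` over the
sequence `L` of indices `j ≠ i`. -/
def interpolation (i : I) (L : List {j : I // j ≠ i}) : Cx P :=
  tensorList (L.map fun j => (cPair Γ α i j).obj)

/-- The endomorphism `u_j / u_i` of `P_i(F)`, of degree `λ_j / λ_i`: the scalar `λ_j / λ_i` is moved
past the tensor factors to the left of `C_{j,i}(F)`, and then the endomorphism `u_j / u_i` of
`C_{j,i}(F)` is applied. -/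
def periodicity (i : I) (j : {j : I // j ≠ i}) : (L : List {j : I // j ≠ i}) →
    Coch (sc ρ ((lam j.1).div (lam i)) ⊗ interpolation Γ α i L) (interpolation Γ α i L) 0
  | [] => 0
  | k :: L =>
    if h : k = j then
      (coch (α_ _ _ _).inv).comp
        (DGMonoidal.wR (interpolation Γ α i L) (h ▸ (cPair Γ α i j).map :
          Coch (sc ρ ((lam j.1).div (lam i)) ⊗ (cPair Γ α i k).obj) (cPair Γ α i k).obj 0))
        (zero_add 0)
    else
      (coch ((α_ _ _ _).inv ≫
        (swap ρ ((lam j.1).div (lam i)) (cPair Γ α i k).obj).hom ▷ interpolation Γ α i L ≫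
        (α_ _ _ _).hom)).comp
        (DGMonoidal.wL (cPair Γ α i k).obj (periodicity i j L)) (zero_add 0)

end Interpolation

/-- The endomorphism `α / β` of `M`, of degree `l / m`, where `α : l ⟶ F` and `β : m ⟶ F`, and
`g : F ⊗ M ⟶ m ⊗ M` is an inverse up to homotopy of `β ⊗ M`: it is `m⁻¹` applied to the
composition of `α ⊗ M : l ⊗ M ⟶ F ⊗ M` with `g`. -/
def eigenQuotient {l m : InvertibleScalar K} {M : Cx P} (α : sc ρ l.obj ⟶ F)
    (g : F ⊗ M ⟶ sc ρ m.obj ⊗ M) : sc ρ (l.div m) ⊗ M ⟶ M :=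
  (divIso ρ l m).hom ▷ M ≫ (α_ _ _ _).hom ≫ sc ρ m.inv ◁ (α ▷ M ≫ g) ≫ (α_ _ _ _).inv ≫
    (invMulIso ρ m).hom ▷ M ≫ (λ_ M).hom

end Eigenmaps

end

end CatDiag

open CatDiag

/-!
Write `C_j` for `C_{j,i}` and `P` for the tensor product of the `C_j` with `j ≠ i`.

**The eigenmap `α_i` is an equivalence on `P`.** By saturation, the tensor product of all the cones
of the `α_j` is contractible, and in it the cones with `j ≠ i` can be replaced by the `C_j` one at
a time (`isContractible_interpolation`). Indeed, let `Cone(α_j)` be contractible between two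
objects `X` and `Y`, so that `α_j` is an equivalence there (`isContractible_cone_iff`). The zigzag
map whose cone is `C_j`, up to a shift, is a diagonal matrix with entries `α_j` (times powers of
scalars) up to a term involving `α_i`, which raises or lowers the exponent of `u` by one. Up to
homotopy such a map is the composition of a diagonal equivalence with a map `1 - N`, and the
geometric series of `N` converges: if `N` raises the exponent since `𝟙[u]` is a product, and if `N`
lowers it since `𝟙[u]` is a sum (`Series.isHEquivAt_pos`, `Series.isHEquivAt_neg`).

**The endomorphisms `u_j / u_i` and `α_j / α_i` agree.** An endomorphism of `P` of degree
`λ_j / λ_i` is the same as a map `V : λ_j P ⟶ λ_i P`, and the claim for `u_j / u_i` amounts to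
`α_j ⊗ P ≃ (α_i ⊗ P) ∘ V`, as the homotopy inverse of `α_i ⊗ P` can then be cancelled
(`FactorsThrough`, `eigenQuotient_homotopic`).

On the factor `C_j` this holds for the following reason (`factorsThrough_cone`). The complex `C_j`
is, up to a shift, the cone of `±(α_j - α_i ∘ U) : λ_j Z ⟶ Z F`, where `Z` is `𝟙[u]` divided by a
scalar and `U : λ_j Z ⟶ λ_i Z` is multiplication or division by `u`. The map that moves `F` to the
left, from the copy of `λ_j Z F` in `λ_j C_j` to the copy of `F λ_j Z` in `F C_j`, is a homotopy
between `α_j` and `α_i ∘ V`, except that on the copy of `λ_j Z F` the homotopies `h_i` and `h_j`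
have to be added, as `α_i` and `α_j` commute with `F` only up to homotopy. The null-homotopies of
`w_i`, `w_j` and `z_{ij}` give the last entry of the matrix.

The relation is inherited by tensor products with the other factors `C_k`
(`FactorsThrough.past_cone`): a homotopy `H` on `M` induces one on `C_k M`, whose part on the copies
of `F M` is `F H` corrected by `h_i` and `h_j`. It commutes with the zigzag map of `C_k`, which
involves `α_k` and `α_i`, up to the null-homotopies of `z_{jk}`, `z_{ik}`, `z_{ij}` and `w_i`.

The rest is about moving scalars around. Tensor products are nested to the right, and `sw T X N`
moves the central object `T` past `X` in `T ⊗ (X ⊗ N)`; the isomorphisms `quotSplit` replace `λ_j`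
by `λ_i ⊗ λ_j / λ_i`. The objects `𝟙[u] ⊗ λ⁻¹` are not treated as central: all that is needed
is a map that moves `F` past them (`FObj`).
-/

namespace CatDiag

universe v u w' w

noncomputable section

/-! ### Graded maps and chain maps -/

section Graded

variable {B : Type u} [Category.{v} B] [Preadditive B] {P : ObjectProperty (CochainComplex B ℤ)}
variable {X Y Z W : Cx P} {m n p : ℤ}

lemma coch_comp (f : X ⟶ Y) (g : Y ⟶ Z) :
    coch (f ≫ g) = (coch f).comp (coch g) (zero_add 0) := Cochain.ofHom_comp _ _

lemma coch_sub (f g : X ⟶ Y) : coch (f - g) = coch f - coch g := Cochain.ofHom_sub _ _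

lemma coch_neg (f : X ⟶ Y) : coch (-f) = -coch f := Cochain.ofHom_neg _

lemma coch_zero : coch (0 : X ⟶ Y) = 0 := Cochain.ofHom_zero _ _

lemma coch_injective {f g : X ⟶ Y} (h : coch f = coch g) : f = g :=
  ObjectProperty.hom_ext _ (Cochain.ofHom_injective h)

lemma δ_coch (f : X ⟶ Y) : δ 0 n (coch f) = 0 := δ_ofHom _

/-- A closed graded map of degree `0` is a chain map. -/
lemma exists_eq_coch (z : Coch X Y 0) (h : δ 0 1 z = 0) : ∃ f : X ⟶ Y, coch f = z :=
  ⟨ObjectProperty.homMk (Cocycle.homOf (Cocycle.mk z 1 (zero_add 1) h)),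
    Cocycle.cochain_ofHom_homOf_eq_coe _⟩

/-- The composition `z ∘ f` of a graded map with a chain map. -/
def pre (f : X ⟶ Y) (z : Coch Y Z n) : Coch X Z n := (coch f).comp z (zero_add n)

/-- The composition `g ∘ z` of a graded map with a chain map. -/
def post (z : Coch X Y n) (g : Y ⟶ Z) : Coch X Z n := z.comp (coch g) (add_zero n)

lemma pre_id (z : Coch X Y n) : pre (𝟙 X) z = z := Cochain.id_comp _

lemma post_id (z : Coch X Y n) : post z (𝟙 Y) = z := Cochain.comp_id _

lemma pre_pre (f : X ⟶ Y) (g : Y ⟶ Z) (z : Coch Z W n) : pre f (pre g z) = pre (f ≫ g) z := by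
  rw [pre, pre, pre, coch_comp, Cochain.comp_assoc_of_first_is_zero_cochain]

lemma post_post (z : Coch X Y n) (f : Y ⟶ Z) (g : Z ⟶ W) :
    post (post z f) g = post z (f ≫ g) := by
  rw [post, post, post, coch_comp, Cochain.comp_assoc_of_second_is_zero_cochain]

lemma post_pre (f : X ⟶ Y) (z : Coch Y Z n) (g : Z ⟶ W) :
    post (pre f z) g = pre f (post z g) :=
  Cochain.comp_assoc_of_first_is_zero_cochain _ _ _ _

lemma pre_add (f : X ⟶ Y) (z z' : Coch Y Z n) : pre f (z + z') = pre f z + pre f z' :=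
  Cochain.comp_add _ _ _ _

lemma pre_sub (f : X ⟶ Y) (z z' : Coch Y Z n) : pre f (z - z') = pre f z - pre f z' :=
  Cochain.comp_sub _ _ _ _

lemma pre_neg (f : X ⟶ Y) (z : Coch Y Z n) : pre f (-z) = -pre f z := Cochain.comp_neg _ _ _

lemma pre_zero (f : X ⟶ Y) : pre f (0 : Coch Y Z n) = 0 := Cochain.comp_zero _ _

lemma sub_pre (f g : X ⟶ Y) (z : Coch Y Z n) : pre (f - g) z = pre f z - pre g z := by
  rw [pre, coch_sub, Cochain.sub_comp]; rfl

lemma add_post (z z' : Coch X Y n) (f : Y ⟶ Z) : post (z + z') f = post z f + post z' f :=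
  Cochain.add_comp _ _ _ _

lemma sub_post (z z' : Coch X Y n) (f : Y ⟶ Z) : post (z - z') f = post z f - post z' f :=
  Cochain.sub_comp _ _ _ _

lemma neg_post (z : Coch X Y n) (f : Y ⟶ Z) : post (-z) f = -post z f := Cochain.neg_comp _ _ _

lemma zero_post (f : Y ⟶ Z) : post (0 : Coch X Y n) f = 0 := Cochain.zero_comp _ _

lemma post_sub (z : Coch X Y n) (f g : Y ⟶ Z) : post z (f - g) = post z f - post z g := by
  rw [post, coch_sub, Cochain.comp_sub]; rfl

lemma δ_pre (f : X ⟶ Y) (z : Coch Y Z m) : δ m n (pre f z) = pre f (δ m n z) :=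
  δ_ofHom_comp _ _ _

lemma δ_post (z : Coch X Y m) (g : Y ⟶ Z) : δ m n (post z g) = post (δ m n z) g :=
  δ_comp_ofHom _ _ _

lemma pre_coch (f : X ⟶ Y) (g : Y ⟶ Z) : pre f (coch g) = coch (f ≫ g) := (coch_comp _ _).symm

lemma post_coch (f : X ⟶ Y) (g : Y ⟶ Z) : post (coch f) g = coch (f ≫ g) := (coch_comp _ _).symm

lemma pre_comp (f : X ⟶ Y) (z : Coch Y Z m) (z' : Coch Z W n) (h : m + n = p) :
    (pre f z).comp z' h = pre f (z.comp z' h) := Cochain.comp_assoc_of_first_is_zero_cochain ..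

lemma comp_post (z : Coch X Y m) (z' : Coch Y Z n) (h : m + n = p) (g : Z ⟶ W) :
    z.comp (post z' g) h = post (z.comp z' h) g :=
  (Cochain.comp_assoc_of_third_is_zero_cochain ..).symm

lemma post_comp (z : Coch X Y m) (f : Y ⟶ Z) (z' : Coch Z W n) (h : m + n = p) :
    (post z f).comp z' h = z.comp (pre f z') h :=
  Cochain.comp_assoc_of_second_is_zero_cochain ..

lemma pre_eq_iff (e : X ≅ Y) (z : Coch Y Z n) (z' : Coch X Z n) :
    pre e.hom z = z' ↔ z = pre e.inv z' := by
  constructor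
  · rintro rfl; rw [pre_pre, e.inv_hom_id, pre_id]
  · rintro rfl; rw [pre_pre, e.hom_inv_id, pre_id]

/-! ### Homotopies and homotopy equivalences -/

lemma Homotopic.refl (z : Coch X Y 0) : Homotopic z z := ⟨0, by simp⟩

lemma Homotopic.symm {z z' : Coch X Y 0} (h : Homotopic z z') : Homotopic z' z := by
  obtain ⟨H, hH⟩ := h
  exact ⟨-H, by rw [δ_neg, hH, neg_sub]⟩

lemma Homotopic.trans {z z' z'' : Coch X Y 0} (h : Homotopic z z') (h' : Homotopic z' z'') :
    Homotopic z z'' := by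
  obtain ⟨H, hH⟩ := h
  obtain ⟨H', hH'⟩ := h'
  exact ⟨H + H', by rw [δ_add, hH, hH', sub_add_sub_cancel]⟩

lemma Homotopic.pre {f g : Y ⟶ Z} (h : Homotopic (coch f) (coch g)) (e : X ⟶ Y) :
    Homotopic (coch (e ≫ f)) (coch (e ≫ g)) := by
  obtain ⟨H, hH⟩ := h
  exact ⟨CatDiag.pre e H, by rw [δ_pre, hH, pre_sub, pre_coch, pre_coch]⟩

lemma Homotopic.post {f g : X ⟶ Y} (h : Homotopic (coch f) (coch g)) (e : Y ⟶ Z) :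
    Homotopic (coch (f ≫ e)) (coch (g ≫ e)) := by
  obtain ⟨H, hH⟩ := h
  exact ⟨CatDiag.post H e, by rw [δ_post, hH, sub_post, post_coch, post_coch]⟩

/-- `f` is a homotopy equivalence. -/
def IsHEquiv (f : X ⟶ Y) : Prop := ∃ g, IsHomotopyInverse f g

lemma IsHEquiv.of_isIso (f : X ⟶ Y) [IsIso f] : IsHEquiv f :=
  ⟨inv f, by rw [IsIso.hom_inv_id]; exact .refl _, by rw [IsIso.inv_hom_id]; exact .refl _⟩

lemma IsHEquiv.comp {f : X ⟶ Y} {g : Y ⟶ Z} (hf : IsHEquiv f) (hg : IsHEquiv g) :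
    IsHEquiv (f ≫ g) := by
  obtain ⟨f', h1, h2⟩ := hf
  obtain ⟨g', h3, h4⟩ := hg
  refine ⟨g' ≫ f', ?_, ?_⟩
  · refine Homotopic.trans ?_ h1
    have := (h3.post f').pre f
    simpa only [Category.assoc, Category.id_comp] using this
  · refine Homotopic.trans ?_ h4
    have := (h2.post g).pre g'
    simpa only [Category.assoc, Category.id_comp] using this

lemma IsHEquiv.of_homotopic {f g : X ⟶ Y} (hf : IsHEquiv f) (h : Homotopic (coch f) (coch g)) :
    IsHEquiv g := by
  obtain ⟨f', h1, h2⟩ := hf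
  exact ⟨f', (h.symm.post f').trans h1, (h.symm.pre f').trans h2⟩

lemma IsHEquiv.neg {f : X ⟶ Y} (hf : IsHEquiv f) : IsHEquiv (-f) := by
  obtain ⟨f', h1, h2⟩ := hf
  exact ⟨-f', by simpa [IsHomotopyInverse] using And.intro h1 h2⟩

/-- Contractibility is invariant under isomorphisms. -/
lemma IsContractible.of_iso (e : X ≅ Y) (h : IsContractible X) : IsContractible Y := by
  have := Homotopic.post (Homotopic.pre (f := 𝟙 X) (g := 0) (by rwa [coch_zero]) e.inv) e.hom
  simpa [IsContractible, coch_zero] using this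

end Graded

/-! ### Tensor products of graded maps -/

section Tensor

variable {B : Type u} [Category.{v} B] [Preadditive B] {P : ObjectProperty (CochainComplex B ℤ)}
  [MonoidalCategory (Cx P)] [DGMonoidal P]
variable {X X' Y Y' Z Z' W W' M M' : Cx P} {m n p : ℤ}

open DGMonoidal

lemma whiskerLeft_sub' (f g : Y ⟶ Z) : X ◁ (f - g) = X ◁ f - X ◁ g :=
  coch_injective (by rw [← wL_coch, coch_sub, map_sub, wL_coch, wL_coch, coch_sub])

lemma whiskerLeft_neg' (f : Y ⟶ Z) : X ◁ (-f) = -X ◁ f :=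
  coch_injective (by rw [← wL_coch, coch_neg, map_neg, wL_coch, coch_neg])

lemma whiskerLeft_zero' : X ◁ (0 : Y ⟶ Z) = 0 :=
  coch_injective (by rw [← wL_coch, coch_zero, map_zero, coch_zero])

lemma sub_whiskerRight' (f g : Y ⟶ Z) : (f - g) ▷ X = f ▷ X - g ▷ X :=
  coch_injective (by rw [← wR_coch, coch_sub, map_sub, wR_coch, wR_coch, coch_sub])

lemma neg_whiskerRight' (f : Y ⟶ Z) : (-f) ▷ X = -f ▷ X :=
  coch_injective (by rw [← wR_coch, coch_neg, map_neg, wR_coch, coch_neg])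

lemma zero_whiskerRight' : (0 : Y ⟶ Z) ▷ X = 0 :=
  coch_injective (by rw [← wR_coch, coch_zero, map_zero, coch_zero])

lemma wL_pre (f : Y ⟶ Z) (z : Coch Z W n) : wL X (pre f z) = pre (X ◁ f) (wL X z) := by
  rw [pre, wL_comp, wL_coch]; rfl

lemma wL_post (z : Coch Y Z n) (f : Z ⟶ W) : wL X (post z f) = post (wL X z) (X ◁ f) := by
  rw [post, wL_comp, wL_coch]; rfl

lemma wR_pre (f : Y ⟶ Z) (z : Coch Z W n) : wR X (pre f z) = pre (f ▷ X) (wR X z) := by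
  rw [pre, wR_comp, wR_coch]; rfl

lemma wR_post (z : Coch Y Z n) (f : Z ⟶ W) : wR X (post z f) = post (wR X z) (f ▷ X) := by
  rw [post, wR_comp, wR_coch]; rfl

/-- The interchange law has no sign if one of the two maps is a chain map. -/
lemma pre_wR_exchange (z : Coch X X' n) (f : Y ⟶ Y') :
    pre (X ◁ f) (wR Y' z) = post (wR Y z) (X' ◁ f) := by
  have := exchange z (coch f) (add_zero n) (zero_add n)
  rw [wL_coch, wL_coch, mul_zero, Int.negOnePow_zero, one_smul] at this
  exact this

lemma pre_wL_exchange (f : X ⟶ X') (z : Coch Y Y' n) :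
    pre (f ▷ Y) (wL X' z) = post (wL X z) (f ▷ Y') := by
  have := exchange (coch f) z (zero_add n) (add_zero n)
  rw [wR_coch, wR_coch, zero_mul, Int.negOnePow_zero, one_smul] at this
  exact this.symm

/-- For `f : X ⊗ Y ⟶ Z ⊗ W`, the map `f ⊗ M` between right-nested tensor products. -/
def act (f : X ⊗ Y ⟶ Z ⊗ W) (M : Cx P) : X ⊗ (Y ⊗ M) ⟶ Z ⊗ (W ⊗ M) :=
  (α_ X Y M).inv ≫ f ▷ M ≫ (α_ Z W M).hom

/-- For a graded map `z : X ⊗ Y ⟶ Z ⊗ W`, the graded map `z ⊗ M` between right-nested tensor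
products. -/
def gact (z : Coch (X ⊗ Y) (Z ⊗ W) n) (M : Cx P) : Coch (X ⊗ (Y ⊗ M)) (Z ⊗ (W ⊗ M)) n :=
  pre (α_ X Y M).inv (post (wR M z) (α_ Z W M).hom)

lemma gact_coch (f : X ⊗ Y ⟶ Z ⊗ W) : gact (coch f) M = coch (act f M) := by
  rw [gact, wR_coch, post_coch, pre_coch, act]

lemma δ_gact (z : Coch (X ⊗ Y) (Z ⊗ W) m) : δ m n (gact z M) = gact (δ m n z) M := by
  rw [gact, δ_pre, δ_post, δ_wR, gact]

lemma gact_add (z z' : Coch (X ⊗ Y) (Z ⊗ W) n) : gact (z + z') M = gact z M + gact z' M := by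
  simp only [gact, map_add, add_post, pre_add]

lemma gact_sub (z z' : Coch (X ⊗ Y) (Z ⊗ W) n) : gact (z - z') M = gact z M - gact z' M := by
  simp only [gact, map_sub, sub_post, pre_sub]

omit [DGMonoidal P] in
lemma act_comp (f : X ⊗ Y ⟶ Z ⊗ W) (g : Z ⊗ W ⟶ X' ⊗ Y') : act (f ≫ g) M = act f M ≫ act g M := by
  simp [act]

omit [DGMonoidal P] in
lemma act_id : act (𝟙 (X ⊗ Y)) M = 𝟙 _ := by simp [act]

omit [DGMonoidal P] in
lemma act_whiskerLeft (f : Y ⟶ Z) : act (X ◁ f) M = X ◁ (f ▷ M) := by simp [act]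

omit [DGMonoidal P] in
lemma act_whiskerRight (f : X ⟶ Z) : act (f ▷ Y) M = f ▷ (Y ⊗ M) := by simp [act]

omit [DGMonoidal P] in
lemma act_natural (f : X ⊗ Y ⟶ Z ⊗ W) (g : M ⟶ M') :
    act f M ≫ Z ◁ (W ◁ g) = X ◁ (Y ◁ g) ≫ act f M' := by
  have h1 : (α_ Z W M).hom ≫ Z ◁ (W ◁ g) = (Z ⊗ W) ◁ g ≫ (α_ Z W M').hom := by simp
  have h2 : X ◁ (Y ◁ g) ≫ (α_ X Y M').inv = (α_ X Y M).inv ≫ (X ⊗ Y) ◁ g := by simp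
  rw [act, act, Category.assoc, Category.assoc, h1, reassoc_of% h2, whisker_exchange_assoc]

omit [DGMonoidal P] in
lemma act_isoHomInv (f : X ⊗ Y ≅ Z ⊗ W) : act f.hom M ≫ act f.inv M = 𝟙 _ := by
  rw [← act_comp, f.hom_inv_id, act_id]

omit [DGMonoidal P] in
lemma act_isoInvHom (f : X ⊗ Y ≅ Z ⊗ W) : act f.inv M ≫ act f.hom M = 𝟙 _ := by
  rw [← act_comp, f.inv_hom_id, act_id]

lemma gact_pre (f : X ⊗ Y ⟶ Z ⊗ W) (z : Coch (Z ⊗ W) (X' ⊗ Y') n) :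
    gact (pre f z) M = pre (act f M) (gact z M) := by
  rw [gact, gact, act, wR_pre, post_pre, pre_pre, pre_pre]; simp

lemma gact_post (z : Coch (X ⊗ Y) (Z ⊗ W) n) (f : Z ⊗ W ⟶ X' ⊗ Y') :
    gact (post z f) M = post (gact z M) (act f M) := by
  rw [gact, gact, act, wR_post, post_pre, post_post, post_post]; simp

/-- The associator is natural for graded maps of the third factor. -/
lemma post_assoc_right (z : Coch Z Z' n) :
    post (wL (X ⊗ Y) z) (α_ X Y Z').hom = pre (α_ X Y Z).hom (wL X (wL Y z)) :=
  assoc_right X Y z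

lemma post_assoc_middle (z : Coch Y Y' n) :
    post (wR Z (wL X z)) (α_ X Y' Z).hom = pre (α_ X Y Z).hom (wL X (wR Z z)) :=
  assoc_middle X z Z

lemma post_assoc_left (z : Coch X X' n) :
    post (wR Z (wR Y z)) (α_ X' Y Z).hom = pre (α_ X Y Z).hom (wR (Y ⊗ Z) z) :=
  assoc_left z Y Z

/-- `f ⊗ M` is natural in `M` for graded maps. -/
lemma act_natural_graded (f : X ⊗ Y ⟶ Z ⊗ W) (z : Coch M M' n) :
    pre (act f M) (wL Z (wL W z)) = post (wL X (wL Y z)) (act f M') := by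
  have h1 := post_assoc_right (X := X) (Y := Y) z
  rw [eq_comm, pre_eq_iff] at h1
  have h2 := (post_assoc_right (X := Z) (Y := W) z).symm
  rw [act, act, ← pre_pre, ← pre_pre, h2, h1, post_pre, post_post]
  congr 1
  rw [← post_pre, pre_wL_exchange, post_post]
  simp

lemma gact_wL (z : Coch Y Z n) : gact (wL X z) M = wL X (wR M z) := by
  rw [gact, post_assoc_middle, pre_pre, Iso.inv_hom_id, pre_id]

lemma gact_wR (z : Coch X Z n) : gact (wR Y z) M = wR (Y ⊗ M) z := by
  rw [gact, post_assoc_left, pre_pre, Iso.inv_hom_id, pre_id]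

lemma IsHEquiv.whiskerLeft {f : Y ⟶ Z} (h : IsHEquiv f) (X : Cx P) : IsHEquiv (X ◁ f) := by
  obtain ⟨g, ⟨H, hH⟩, H', hH'⟩ := h
  refine ⟨X ◁ g, ⟨wL X H, ?_⟩, wL X H', ?_⟩
  · rw [δ_wL, hH, map_sub, wL_coch, wL_coch]; simp
  · rw [δ_wL, hH', map_sub, wL_coch, wL_coch]; simp

end Tensor

/-! ### Mapping cones -/

section Cones

variable {B : Type u} [Category.{v} B] [Preadditive B] {P : ObjectProperty (CochainComplex B ℤ)}

/-- The structure maps of a complex `C` whose underlying graded object is `A[1] ⊕ G`, with the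
differential of the mapping cone of `φ : A ⟶ G`. In contrast to `cone φ` itself, this notion is
preserved by tensor products on either side and by isomorphisms of `A` and `G`. -/
structure ConeData {A G : Cx P} (φ : A ⟶ G) (C : Cx P) where
  /-- the inclusion of `A[1]` -/
  inl : Coch A C (-1)
  /-- the inclusion of `G` -/
  inr : G ⟶ C
  /-- the projection to `A[1]` -/
  fst : Coch C A 1
  /-- the projection to `G` -/
  snd : Coch C G 0
  inl_fst : inl.comp fst (neg_add_cancel 1) = coch (𝟙 A)
  inl_snd : inl.comp snd (add_zero (-1)) = 0
  inr_fst : pre inr fst = 0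
  inr_snd : pre inr snd = coch (𝟙 G)
  id : fst.comp inl (add_neg_cancel 1) + post snd inr = coch (𝟙 C)
  δ_inl : δ (-1) 0 inl = coch (φ ≫ inr)
  δ_fst : δ 1 2 fst = 0
  δ_snd : δ 0 1 snd = -post fst φ

namespace ConeData

variable {A G C A' G' C' : Cx P} {φ : A ⟶ G} {φ' : A' ⟶ G'}

/-- The structure maps of the mapping cone. -/
def ofCone [HasBinaryBiproducts B] [IsClosedUnderCones P] (φ : A ⟶ G) :
    ConeData φ (cone φ) where
  inl := coneInl φ
  inr := coneInr φ
  fst := coneFst φ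
  snd := coneSnd φ
  inl_fst := CochainComplex.mappingCone.inl_fst _
  inl_snd := CochainComplex.mappingCone.inl_snd _
  inr_fst := CochainComplex.mappingCone.inr_fst _
  inr_snd := CochainComplex.mappingCone.inr_snd _
  id := CochainComplex.mappingCone.id _
  δ_inl := CochainComplex.mappingCone.δ_inl _
  δ_fst := Cocycle.δ_eq_zero _ _
  δ_snd := CochainComplex.mappingCone.δ_snd _

/-- The cone structure transported along isomorphisms of `A` and `G`. -/
def ofIso (K : ConeData φ C) (e : A' ≅ A) (e' : G ≅ G') (h : φ' = e.hom ≫ φ ≫ e'.hom) :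
    ConeData φ' C where
  inl := pre e.hom K.inl
  inr := e'.inv ≫ K.inr
  fst := post K.fst e.inv
  snd := post K.snd e'.hom
  inl_fst := by
    rw [comp_post, pre_comp, K.inl_fst, pre_coch, post_coch]; simp
  inl_snd := by
    rw [comp_post, pre_comp, K.inl_snd, pre_zero, zero_post]
  inr_fst := by
    rw [← post_pre, ← pre_pre, K.inr_fst, pre_zero, zero_post]
  inr_snd := by
    rw [← post_pre, ← pre_pre, K.inr_snd, pre_coch, post_coch]; simp
  id := by
    rw [post_comp, pre_pre, Iso.inv_hom_id, pre_id, post_post, Iso.hom_inv_id_assoc, K.id]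
  δ_inl := by
    rw [δ_pre, K.δ_inl, pre_coch, h]; simp
  δ_fst := by rw [δ_post, K.δ_fst, zero_post]
  δ_snd := by
    rw [δ_post, K.δ_snd, neg_post, post_post, post_post, h]; simp

section Tensor

variable [MonoidalCategory (Cx P)] [DGMonoidal P]

open DGMonoidal

/-- The cone structure of `X ⊗ C`. -/
def tensorLeft (K : ConeData φ C) (X : Cx P) : ConeData (X ◁ φ) (X ⊗ C) where
  inl := wL X K.inl
  inr := X ◁ K.inr
  fst := wL X K.fst
  snd := wL X K.snd
  inl_fst := by rw [← wL_comp, K.inl_fst, wL_coch, whiskerLeft_id]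
  inl_snd := by rw [← wL_comp, K.inl_snd, map_zero]
  inr_fst := by rw [← wL_pre, K.inr_fst, map_zero]
  inr_snd := by rw [← wL_pre, K.inr_snd, wL_coch, whiskerLeft_id]
  id := by rw [← wL_comp, ← wL_post, ← map_add, K.id, wL_coch, whiskerLeft_id]
  δ_inl := by rw [δ_wL, K.δ_inl, wL_coch, MonoidalCategory.whiskerLeft_comp]
  δ_fst := by rw [δ_wL, K.δ_fst, map_zero]
  δ_snd := by rw [δ_wL, K.δ_snd, map_neg, wL_post]

/-- The cone structure of `C ⊗ Y`. -/
def tensorRight (K : ConeData φ C) (Y : Cx P) : ConeData (φ ▷ Y) (C ⊗ Y) where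
  inl := wR Y K.inl
  inr := K.inr ▷ Y
  fst := wR Y K.fst
  snd := wR Y K.snd
  inl_fst := by rw [← wR_comp, K.inl_fst, wR_coch, id_whiskerRight]
  inl_snd := by rw [← wR_comp, K.inl_snd, map_zero]
  inr_fst := by rw [← wR_pre, K.inr_fst, map_zero]
  inr_snd := by rw [← wR_pre, K.inr_snd, wR_coch, id_whiskerRight]
  id := by rw [← wR_comp, ← wR_post, ← map_add, K.id, wR_coch, id_whiskerRight]
  δ_inl := by rw [δ_wR, K.δ_inl, wR_coch, comp_whiskerRight]
  δ_fst := by rw [δ_wR, K.δ_fst, map_zero]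
  δ_snd := by rw [δ_wR, K.δ_snd, map_neg, wR_post]

end Tensor

/-- The graded map between two cones with diagonal components `f` and `g`. -/
def diag (K : ConeData φ C) (K' : ConeData φ' C') (f : A ⟶ A') (g : G ⟶ G') : Coch C C' 0 :=
  (post K.fst f).comp K'.inl (add_neg_cancel 1) + post K.snd (g ≫ K'.inr)

/-- A map `D : C ⟶ C'` of cones is diagonal, with components `f` and `g`. -/
structure IsDiag (K : ConeData φ C) (K' : ConeData φ' C') (D : C ⟶ C') (f : A ⟶ A')
    (g : G ⟶ G') : Prop where
  fst : pre D K'.fst = post K.fst f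
  snd : pre D K'.snd = post K.snd g

lemma IsDiag.eq_diag {K : ConeData φ C} {K' : ConeData φ' C'} {D : C ⟶ C'} {f : A ⟶ A'}
    {g : G ⟶ G'} (h : IsDiag K K' D f g) : coch D = diag K K' f g := by
  have := congrArg (pre D) K'.id
  rw [pre_coch, Category.comp_id, pre_add, ← pre_comp, ← post_pre, h.fst, h.snd, post_post] at this
  exact this.symm

lemma IsDiag.comp {A'' G'' C'' : Cx P} {φ'' : A'' ⟶ G''} {K : ConeData φ C} {K' : ConeData φ' C'}
    {K'' : ConeData φ'' C''} {D : C ⟶ C'} {f : A ⟶ A'} {g : G ⟶ G'} {D' : C' ⟶ C''}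
    {f' : A' ⟶ A''} {g' : G' ⟶ G''} (h : IsDiag K K' D f g) (h' : IsDiag K' K'' D' f' g') :
    IsDiag K K'' (D ≫ D') (f ≫ f') (g ≫ g') where
  fst := by rw [← pre_pre, h'.fst, ← post_pre, h.fst, post_post]
  snd := by rw [← pre_pre, h'.snd, ← post_pre, h.snd, post_post]

lemma IsDiag.sub {K : ConeData φ C} {K' : ConeData φ' C'} {D : C ⟶ C'} {f : A ⟶ A'}
    {g : G ⟶ G'} {D' : C ⟶ C'} {f' : A ⟶ A'} {g' : G ⟶ G'} (h : IsDiag K K' D f g)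
    (h' : IsDiag K K' D' f' g') : IsDiag K K' (D - D') (f - f') (g - g') where
  fst := by rw [sub_pre, post_sub, h.fst, h'.fst]
  snd := by rw [sub_pre, post_sub, h.snd, h'.snd]

/-- The graded map `diag` is closed, hence a chain map, if its components commute with the
differentials of the cones. -/
lemma exists_isDiag (K : ConeData φ C) (K' : ConeData φ' C') (f : A ⟶ A') (g : G ⟶ G')
    (h : f ≫ φ' = φ ≫ g) : ∃ D : C ⟶ C', coch D = diag K K' f g ∧ IsDiag K K' D f g := by
  obtain ⟨D, hD⟩ := exists_eq_coch (diag K K' f g) (by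
    rw [diag, δ_add, δ_post, δ_comp _ _ _ 2 0 1 (by norm_num) (by norm_num) (by norm_num), δ_post,
      K.δ_fst, K'.δ_inl, K.δ_snd, zero_post, Cochain.zero_comp, smul_zero, add_zero, neg_post,
      post_post, ← Category.assoc, ← h, Category.assoc]
    change post (post K.fst f) _ + _ = _
    rw [post_post, add_neg_cancel])
  refine ⟨D, hD, ?_, ?_⟩
  · change (coch D).comp _ _ = _
    rw [hD, diag, Cochain.add_comp, post_comp K.snd, ← pre_pre, K'.inr_fst, pre_zero,
      Cochain.comp_zero, add_zero,
      Cochain.comp_assoc _ _ _ (add_neg_cancel 1) (neg_add_cancel 1) (by norm_num), K'.inl_fst]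
    exact post_id _
  · change (coch D).comp _ _ = _
    rw [hD, diag, Cochain.add_comp, post_comp K.snd, ← pre_pre, K'.inr_snd, pre_coch,
      Cochain.comp_assoc _ _ _ (add_neg_cancel 1) (add_zero (-1)) (by norm_num), K'.inl_snd,
      Cochain.comp_zero, zero_add, Category.comp_id]
    rfl

/-- A graded map of degree `-1` between cones, given by its matrix, and its boundary. The sign of
the first component is the one of the shift `A[1]`. -/
lemma exists_homotopy (K : ConeData φ C) (K' : ConeData φ' C') {f : Coch A A' 0} {g : Coch G G' 0}
    (E : G ⟶ A') (HA : Coch A A' (-1)) (HG : Coch G G' (-1)) (N : Coch A G' (-2))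
    (hA : f = coch (φ ≫ E) + δ (-1) 0 HA) (hG : g = coch (E ≫ φ') + δ (-1) 0 HG) :
    ∃ H : Coch C C' (-1), δ (-1) 0 H =
      (K.fst.comp f (add_zero 1)).comp K'.inl (add_neg_cancel 1) +
        post (K.snd.comp g (add_zero 0)) K'.inr +
        K.fst.comp (post (pre φ HG - post HA φ' + δ (-2) (-1) N) K'.inr) (add_neg_cancel 1) := by
  refine ⟨-(K.fst.comp (HA.comp K'.inl (show -1 + -1 = -2 by norm_num))
      (show 1 + -2 = -1 by norm_num)) +
    K.snd.comp (post HG K'.inr) (zero_add (-1)) + K.snd.comp (pre E K'.inl) (zero_add (-1)) +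
    K.fst.comp (post N K'.inr) (show 1 + -2 = -1 by norm_num), ?_⟩
  have e1 : δ (-1) 0 (K.fst.comp (HA.comp K'.inl (show -1 + -1 = -2 by norm_num))
      (show 1 + -2 = -1 by norm_num)) =
      K.fst.comp (post (post HA φ') K'.inr) (add_neg_cancel 1) -
        (K.fst.comp (δ (-1) 0 HA) (add_zero 1)).comp K'.inl (add_neg_cancel 1) := by
    rw [δ_comp _ _ _ 2 (-1) 0 (by norm_num) (by norm_num) (by norm_num), K.δ_fst,
      Cochain.zero_comp, smul_zero, add_zero,
      δ_comp _ _ _ 0 0 (-1) (by norm_num) (by norm_num) (by norm_num), K'.δ_inl, Cochain.comp_add,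
      Cochain.comp_assoc_of_second_is_zero_cochain]
    simp only [Int.negOnePow_neg, Int.negOnePow_one, Units.neg_smul, one_smul, Cochain.comp_neg,
      sub_eq_add_neg]
    rw [post_post]; rfl
  have e2 : δ (-1) 0 (K.snd.comp (post HG K'.inr) (zero_add (-1))) =
      post (K.snd.comp (δ (-1) 0 HG) (add_zero 0)) K'.inr +
        K.fst.comp (post (pre φ HG) K'.inr) (add_neg_cancel 1) := by
    rw [δ_comp _ _ _ 1 0 0 (by norm_num) (by norm_num) (by norm_num), K.δ_snd, δ_post, comp_post,
      Cochain.neg_comp, post_comp, post_pre]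
    simp only [Int.negOnePow_neg, Int.negOnePow_one, Units.neg_smul, one_smul, neg_neg]
  have e3 : δ (-1) 0 (K.snd.comp (pre E K'.inl) (zero_add (-1))) =
      post (post K.snd (E ≫ φ')) K'.inr +
        (post K.fst (φ ≫ E)).comp K'.inl (add_neg_cancel 1) := by
    rw [δ_comp _ _ _ 1 0 0 (by norm_num) (by norm_num) (by norm_num), K.δ_snd, δ_pre, K'.δ_inl,
      pre_coch, Cochain.neg_comp, post_comp, post_comp, pre_pre, post_post]
    simp only [Int.negOnePow_neg, Int.negOnePow_one, Units.neg_smul, one_smul, neg_neg,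
      Category.assoc]
    rfl
  have e4 : δ (-1) 0 (K.fst.comp (post N K'.inr) (show 1 + -2 = -1 by norm_num)) =
      K.fst.comp (post (δ (-2) (-1) N) K'.inr) (add_neg_cancel 1) := by
    rw [δ_comp _ _ _ 2 (-1) 0 (by norm_num) (by norm_num) (by norm_num), K.δ_fst,
      Cochain.zero_comp, smul_zero, add_zero, δ_post]
  rw [δ_add, δ_add, δ_add, δ_neg, e1, e2, e3, e4, hA, hG]
  simp only [Cochain.comp_add, Cochain.add_comp, add_post, sub_post, Cochain.comp_sub]
  change _ = (post K.fst (φ ≫ E)).comp _ _ + _ + (post (post K.snd (E ≫ φ')) _ + _) + _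
  abel

/-- A diagonal map of cones is null-homotopic if it admits a matrix of homotopies. -/
lemma IsDiag.nullHomotopic {K : ConeData φ C} {K' : ConeData φ' C'} {D : C ⟶ C'} {f : A ⟶ A'}
    {g : G ⟶ G'} (h : IsDiag K K' D f g)
    (E : G ⟶ A') (HA : Coch A A' (-1)) (HG : Coch G G' (-1)) (N : Coch A G' (-2))
    (hA : coch f = coch (φ ≫ E) + δ (-1) 0 HA) (hG : coch g = coch (E ≫ φ') + δ (-1) 0 HG)
    (hN : pre φ HG - post HA φ' + δ (-2) (-1) N = 0) :
    ∃ H : Coch C C' (-1), δ (-1) 0 H = coch D := by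
  obtain ⟨H, hH⟩ := exists_homotopy K K' E HA HG N hA hG
  refine ⟨H, ?_⟩
  rw [hH, hN, zero_post, Cochain.comp_zero, add_zero, h.eq_diag, diag, ← post_post]
  rfl

/-- A map whose cone is contractible is a homotopy equivalence. -/
lemma isHEquiv (K : ConeData φ C) (h : IsContractible C) : IsHEquiv φ := by
  obtain ⟨s, hs⟩ := h
  rw [sub_zero] at hs
  have h1 : δ 0 1 (s.comp K.fst (neg_add_cancel 1)) = -K.fst := by
    rw [δ_comp _ _ _ 0 2 1 (by norm_num) (by norm_num) (by norm_num), K.δ_fst, hs,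
      Cochain.comp_zero, Int.negOnePow_one, Units.neg_smul, one_smul, zero_add]
    exact congrArg Neg.neg (pre_id _)
  obtain ⟨g, hg⟩ := exists_eq_coch (pre K.inr (s.comp K.fst (neg_add_cancel 1))) (by
    rw [δ_pre, h1, pre_neg, K.inr_fst, neg_zero])
  refine ⟨g, ⟨K.inl.comp (s.comp K.fst (neg_add_cancel 1)) (add_zero (-1)), ?_⟩,
    -pre K.inr (s.comp K.snd (add_zero (-1))), ?_⟩
  · rw [δ_comp _ _ _ 0 1 0 (by norm_num) (by norm_num) (by norm_num), h1, K.δ_inl,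
      Cochain.comp_neg, K.inl_fst, Int.negOnePow_zero, one_smul]
    change _ + pre _ _ = _
    rw [← pre_pre, ← hg, pre_coch]
    abel
  · rw [δ_neg, δ_pre, δ_comp _ _ _ 0 1 0 (by norm_num) (by norm_num) (by norm_num), hs, K.δ_snd,
      Int.negOnePow_zero, one_smul, Cochain.comp_neg, comp_post, pre_add, pre_neg, ← post_pre,
      ← hg, post_coch]
    change -(_ + pre _ (pre _ _)) = _
    rw [pre_id, K.inr_snd]
    abel

/-- The cone of a homotopy equivalence is contractible. -/
lemma isContractible (K : ConeData φ C) (h : IsHEquiv φ) : IsContractible C := by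
  obtain ⟨g, ⟨p, hp⟩, q, hq⟩ := h
  obtain ⟨H, hH⟩ := exists_homotopy K K g (-p) (-q) 0 (f := coch (𝟙 A)) (g := coch (𝟙 G))
    (by rw [δ_neg, hp]; abel) (by rw [δ_neg, hq]; abel)
  -- The matrix of homotopies contracts `C` up to a map `x` with `x ∘ x = 0`.
  set x : Coch C C 0 := K.fst.comp (post (pre φ (-q) - post (-p) φ + δ (-2) (-1) 0) K.inr)
    (add_neg_cancel 1) with hx
  have hH' : δ (-1) 0 H = coch (𝟙 C) + x := by
    rw [hH, ← K.id]
    congr 2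
    · exact congrArg (fun z => Cochain.comp z K.inl (add_neg_cancel 1)) (post_id _)
    · exact congrArg (fun z => post z K.inr) (post_id _)
  have hxx : x.comp x (add_zero 0) = 0 := by
    have h0 : pre K.inr x = 0 := by rw [hx, ← pre_comp, K.inr_fst, Cochain.zero_comp]
    have h1 : x = post (K.fst.comp (pre φ (-q) - post (-p) φ + δ (-2) (-1) 0)
      (add_neg_cancel 1)) K.inr := comp_post _ _ _ _
    calc x.comp x (add_zero 0) = (post (K.fst.comp (pre φ (-q) - post (-p) φ + δ (-2) (-1) 0)
          (add_neg_cancel 1)) K.inr).comp x (add_zero 0) := by rw [← h1]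
      _ = 0 := by rw [post_comp, h0, Cochain.comp_zero]
  have hδx : δ 0 1 x = 0 := by
    have : δ 0 1 (δ (-1) 0 H) = 0 := δ_δ _ _ _ _
    rwa [hH', δ_add, δ_coch, zero_add] at this
  refine ⟨H - H.comp x (add_zero (-1)), ?_⟩
  rw [δ_sub, δ_comp_zero_cochain _ _ _ (by norm_num), hδx, hH', Cochain.comp_zero, zero_add,
    Cochain.add_comp, hxx, add_zero]
  change _ - pre _ _ = _
  rw [pre_id]
  abel

end ConeData

end Cones

/-! ### Shifts -/

section Shift

variable {B : Type u} [Category.{v} B] [Preadditive B] {P : ObjectProperty (CochainComplex B ℤ)}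
  [P.IsStableUnderShift ℤ]

lemma toShift_comp_fromShift (X : Cx P) :
    (toShift X).comp (fromShift X) (add_neg_cancel 1) = coch (𝟙 X) := by
  ext p
  rw [Cochain.comp_v _ _ (add_neg_cancel 1) p (p + 1) p (by lia) (by lia), toShift, fromShift,
    Cochain.rightShift_v _ (-1) 1 _ p (p + 1) (by lia) p (by lia),
    Cochain.rightUnshift_v _ _ _ (p + 1) p (by lia) (p + 1) (by lia)]
  simp [coch]

lemma fromShift_comp_toShift (X : Cx P) :
    (fromShift X).comp (toShift X) (neg_add_cancel 1) = coch (𝟙 (shift X (-1))) := by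
  ext p
  rw [Cochain.comp_v _ _ (neg_add_cancel 1) p (p + -1) p (by lia) (by lia), toShift, fromShift,
    Cochain.rightShift_v _ (-1) 1 _ (p + -1) p (by lia) (p + -1) (by lia),
    Cochain.rightUnshift_v _ _ _ p (p + -1) (by lia) p (by lia)]
  have h (Y : B) : (𝟙 Y ≫ 𝟙 Y) ≫ 𝟙 Y ≫ 𝟙 Y = 𝟙 Y := by simp
  simp only [coch, Cochain.ofHom_v, ObjectProperty.FullSubcategory.id_hom,
    HomologicalComplex.id_f, CochainComplex.shiftFunctorObjXIso, HomologicalComplex.XIsoOfEq_rfl,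
    Iso.refl_hom, Iso.refl_inv]
  exact h (X.obj.X (p + -1))

lemma δ_toShift (X : Cx P) : δ 1 2 (toShift X) = 0 := by
  rw [toShift, Cochain.δ_rightShift _ (-1) 1 2 _ 1 (by norm_num)]
  simp

lemma δ_fromShift (X : Cx P) : δ (-1) 0 (fromShift X) = 0 := by
  rw [fromShift, Cochain.δ_rightUnshift _ (-1) _ 0 1 (by norm_num)]
  simp

end Shift

/-! ### Maps between bisums -/

section Bisum

variable {B : Type u} [Category.{v} B] [Preadditive B] {P : ObjectProperty (CochainComplex B ℤ)}

namespace IsBisum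

variable {X X' : ℕ → Cx P} {S S' Z : Cx P} {ι : ∀ k, X k ⟶ S} {π : ∀ k, S ⟶ X k}
  {ι' : ∀ k, X' k ⟶ S'} {π' : ∀ k, S' ⟶ X' k}

lemma hom_ext_ι (h : IsBisum ι π) {f g : S ⟶ Z} (hfg : ∀ k, ι k ≫ f = ι k ≫ g) : f = g := by
  refine coch_injective ((h.coproduct Z 0).1 (funext fun k => ?_))
  change pre _ _ = pre _ _
  rw [pre_coch, pre_coch, hfg]

lemma hom_ext_π (h : IsBisum ι π) {f g : Z ⟶ S} (hfg : ∀ k, f ≫ π k = g ≫ π k) : f = g := by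
  refine coch_injective ((h.product Z 0).1 (funext fun k => ?_))
  change post _ _ = post _ _
  rw [post_coch, post_coch, hfg]

lemma ι_π (h : IsBisum ι π) (k l : ℕ) :
    ι k ≫ π l = if e : k = l then eqToHom (congrArg X e) else 0 := by
  split_ifs with e
  · subst e; simpa using h.ι_π_self k
  · exact h.ι_π_ne k l e

/-- Bisums are invariant under isomorphisms of the sum. -/
lemma of_iso (h : IsBisum ι π) (e : S ≅ S') (e' : ∀ k, X k ≅ X' k)
    (hι : ∀ k, ι' k = (e' k).inv ≫ ι k ≫ e.hom) (hπ : ∀ k, π' k = e.inv ≫ π k ≫ (e' k).hom) :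
    IsBisum ι' π' where
  ι_π_self k := by simp [hι, hπ, reassoc_of% (h.ι_π_self k)]
  ι_π_ne k l hkl := by simp [hι, hπ, reassoc_of% (h.ι_π_ne k l hkl)]
  coproduct Z n := by
    constructor
    · intro z z' hz
      have := (h.coproduct Z n).1 (a₁ := pre e.hom z) (a₂ := pre e.hom z') (funext fun k => by
        have hk := congrArg (pre (e' k).hom) (congrFun hz k)
        change pre _ (pre _ _) = pre _ (pre _ _) at hk
        change pre _ (pre _ _) = pre _ (pre _ _)
        simpa [pre_pre, hι] using hk)
      simpa [pre_pre, pre_id] using congrArg (pre e.inv) this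
    · intro z
      obtain ⟨y, hy⟩ := (h.coproduct Z n).2 (fun k => pre (e' k).hom (z k))
      refine ⟨pre e.inv y, funext fun k => ?_⟩
      have hk := congrArg (pre (e' k).inv) (congrFun hy k)
      change pre _ (pre _ _) = _ at hk
      change pre _ (pre _ _) = _
      simpa [pre_pre, pre_id, hι] using hk
  product Z n := by
    constructor
    · intro z z' hz
      have := (h.product Z n).1 (a₁ := post z e.inv) (a₂ := post z' e.inv) (funext fun k => by
        have hk := congrArg (fun y => post y (e' k).inv) (congrFun hz k)
        change post (post _ _) _ = post (post _ _) _ at hk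
        change post (post _ _) _ = post (post _ _) _
        simpa [post_post, hπ] using hk)
      simpa [post_post, post_id] using congrArg (fun y => post y e.hom) this
    · intro z
      obtain ⟨y, hy⟩ := (h.product Z n).2 (fun k => post (z k) (e' k).inv)
      refine ⟨post y e.hom, funext fun k => ?_⟩
      have hk := congrArg (fun y => post y (e' k).hom) (congrFun hy k)
      change post (post _ _) _ = _ at hk
      change post (post _ _) _ = _
      simpa [post_post, post_id, hπ] using hk

/-- The diagonal map between two bisums. -/
def map (h : IsBisum ι π) (ι' : ∀ k, X' k ⟶ S') (f : ∀ k, X k ⟶ X' k) : S ⟶ S' :=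
  h.desc fun k => f k ≫ ι' k

lemma ι_map (h : IsBisum ι π) (f : ∀ k, X k ⟶ X' k) (k : ℕ) :
    ι k ≫ h.map ι' f = f k ≫ ι' k := h.ι_desc _ k

lemma map_π (h : IsBisum ι π) (h' : IsBisum ι' π') (f : ∀ k, X k ⟶ X' k) (k : ℕ) :
    h.map ι' f ≫ π' k = π k ≫ f k := by
  refine h.hom_ext_ι fun l => ?_
  rw [reassoc_of% (h.ι_map (ι' := ι') f l), h'.ι_π, ← Category.assoc, h.ι_π]
  split_ifs with e
  · subst e; simp
  · simp

/-- A diagonal map of bisums whose components have homotopy inverses has a diagonal homotopy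
inverse. -/
lemma exists_diagonal_inverse (h : IsBisum ι π) (h' : IsBisum ι' π') (f : ∀ k, X k ⟶ X' k)
    (hf : ∀ k, IsHEquiv (f k)) :
    ∃ g : ∀ k, X' k ⟶ X k, IsHomotopyInverse (h.map ι' f) (h'.map ι g) := by
  choose g hg using hf
  choose H hH using fun k => (hg k).1
  choose H' hH' using fun k => (hg k).2
  refine ⟨g, ?_, ?_⟩
  · obtain ⟨z, hz⟩ := (h.coproduct S (-1)).2 (fun k => post (H k) (ι k))
    refine ⟨z, (h.coproduct S 0).1 (funext fun k => ?_)⟩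
    have hk := congrArg (δ (-1) 0) (congrFun hz k)
    change δ (-1) 0 (pre _ _) = _ at hk
    change pre _ _ = pre _ _
    rw [← δ_pre, hk, δ_post, hH, pre_sub, pre_coch, pre_coch, sub_post, post_coch, post_coch,
      reassoc_of% (h.ι_map (ι' := ι') f k), h'.ι_map]
    simp
  · obtain ⟨z, hz⟩ := (h'.coproduct S' (-1)).2 (fun k => post (H' k) (ι' k))
    refine ⟨z, (h'.coproduct S' 0).1 (funext fun k => ?_)⟩
    have hk := congrArg (δ (-1) 0) (congrFun hz k)
    change δ (-1) 0 (pre _ _) = _ at hk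
    change pre _ _ = pre _ _
    rw [← δ_pre, hk, δ_post, hH', pre_sub, pre_coch, pre_coch, sub_post, post_coch, post_coch,
      reassoc_of% (h'.ι_map (ι' := ι) g k), h.ι_map]
    simp

/-- If `N` raises the index of the summands by one, then `1 - N` is invertible: the geometric
series converges since `S` is a product. -/
lemma isIso_one_sub_of_raising (h : IsBisum ι π) (N : S ⟶ S) (n : ∀ k, X k ⟶ X (k + 1))
    (h0 : N ≫ π 0 = 0) (hN : ∀ k, N ≫ π (k + 1) = π k ≫ n k) : IsIso (𝟙 S - N) := by
  have inj (Z : Cx P) (w : Z ⟶ S) (hw : w ≫ (𝟙 S - N) = 0) : w = 0 := by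
    refine h.hom_ext_π fun k => ?_
    induction k with
    | zero =>
      have := congrArg (· ≫ π 0) hw
      simpa [Preadditive.comp_sub, Preadditive.sub_comp, h0] using this
    | succ k ih =>
      have := congrArg (· ≫ π (k + 1)) hw
      simp only [Preadditive.comp_sub, Preadditive.sub_comp, Category.assoc, hN,
        Category.comp_id, zero_comp, reassoc_of% ih] at this
      simpa using this
  let w : ∀ k, S ⟶ X k := fun k => Nat.rec (π 0) (fun k y => π (k + 1) + y ≫ n k) k
  have hw : h.lift w ≫ (𝟙 S - N) = 𝟙 S := by
    refine h.hom_ext_π fun k => ?_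
    cases k with
    | zero => simp [Preadditive.comp_sub, Preadditive.sub_comp, h0, h.lift_π, w]
    | succ k =>
      simp only [Preadditive.comp_sub, Preadditive.sub_comp, Category.assoc, hN,
        Category.comp_id, h.lift_π, reassoc_of% (h.lift_π w k), Category.id_comp]
      simp [w]
  refine ⟨h.lift w, sub_eq_zero.mp (inj _ _ ?_), hw⟩
  rw [Preadditive.sub_comp, Category.assoc, hw, Category.comp_id, Category.id_comp, sub_self]

/-- If `N` lowers the index of the summands by one, then `1 - N` is invertible: the geometric
series is finite on each summand. -/
lemma isIso_one_sub_of_lowering (h : IsBisum ι π) (N : S ⟶ S) (n : ∀ k, X (k + 1) ⟶ X k)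
    (h0 : ι 0 ≫ N = 0) (hN : ∀ k, ι (k + 1) ≫ N = n k ≫ ι k) : IsIso (𝟙 S - N) := by
  have inj (Z : Cx P) (w : S ⟶ Z) (hw : (𝟙 S - N) ≫ w = 0) : w = 0 := by
    refine h.hom_ext_ι fun k => ?_
    induction k with
    | zero =>
      have := congrArg (ι 0 ≫ ·) hw
      simpa [Preadditive.comp_sub, Preadditive.sub_comp, reassoc_of% h0] using this
    | succ k ih =>
      have := congrArg (ι (k + 1) ≫ ·) hw
      simp only [Preadditive.comp_sub, Preadditive.sub_comp, Category.id_comp,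
        reassoc_of% (hN k), ih, comp_zero] at this
      simpa using this
  let w : ∀ k, X k ⟶ S := fun k => Nat.rec (ι 0) (fun k y => ι (k + 1) + n k ≫ y) k
  have hw : (𝟙 S - N) ≫ h.desc w = 𝟙 S := by
    refine h.hom_ext_ι fun k => ?_
    cases k with
    | zero => simp [Preadditive.sub_comp, Preadditive.comp_sub, reassoc_of% h0, h.ι_desc, w]
    | succ k =>
      simp only [Preadditive.sub_comp, Preadditive.comp_sub, Category.id_comp,
        reassoc_of% (hN k), h.ι_desc]
      simp [w]
  refine ⟨h.desc w, hw, sub_eq_zero.mp (inj _ _ ?_)⟩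
  rw [Preadditive.comp_sub, reassoc_of% hw, Category.comp_id, sub_self]

/-- A diagonal equivalence of bisums, perturbed by a map raising the index. -/
lemma isHEquiv_sub_of_raising (h : IsBisum ι π) (h' : IsBisum ι' π') (f : ∀ k, X k ⟶ X' k)
    (hf : ∀ k, IsHEquiv (f k)) (N : S ⟶ S') (n : ∀ k, X k ⟶ X' (k + 1))
    (h0 : N ≫ π' 0 = 0) (hN : ∀ k, N ≫ π' (k + 1) = π k ≫ n k) :
    IsHEquiv (h.map ι' f - N) := by
  obtain ⟨g, hg⟩ := h.exists_diagonal_inverse h' f hf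
  have : IsIso (𝟙 S' - h'.map ι g ≫ N) :=
    h'.isIso_one_sub_of_raising _ (fun k => g k ≫ n k) (by simp [h0])
      (fun k => by simp [hN, reassoc_of% (h'.map_π h g k)])
  refine (IsHEquiv.comp ⟨_, hg⟩ (.of_isIso (𝟙 S' - h'.map ι g ≫ N))).of_homotopic ?_
  rw [Preadditive.comp_sub, Category.comp_id]
  obtain ⟨H, hH⟩ := hg.1.post N
  exact ⟨-H, by rw [δ_neg, hH, coch_sub, coch_sub, Category.id_comp, Category.assoc]; abel⟩

/-- A diagonal equivalence of bisums, perturbed by a map lowering the index. -/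
lemma isHEquiv_sub_of_lowering (h : IsBisum ι π) (h' : IsBisum ι' π') (f : ∀ k, X k ⟶ X' k)
    (hf : ∀ k, IsHEquiv (f k)) (N : S ⟶ S') (n : ∀ k, X (k + 1) ⟶ X' k)
    (h0 : ι 0 ≫ N = 0) (hN : ∀ k, ι (k + 1) ≫ N = n k ≫ ι' k) :
    IsHEquiv (h.map ι' f - N) := by
  obtain ⟨g, hg⟩ := h.exists_diagonal_inverse h' f hf
  have : IsIso (𝟙 S' - h'.map ι g ≫ N) :=
    h'.isIso_one_sub_of_lowering _ (fun k => g (k + 1) ≫ n k)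
      (by simp [reassoc_of% (h'.ι_map (ι' := ι) g 0), h0])
      (fun k => by simp [reassoc_of% (h'.ι_map (ι' := ι) g (k + 1)), hN])
  refine (IsHEquiv.comp ⟨_, hg⟩ (.of_isIso (𝟙 S' - h'.map ι g ≫ N))).of_homotopic ?_
  rw [Preadditive.comp_sub, Category.comp_id]
  obtain ⟨H, hH⟩ := hg.1.post N
  exact ⟨-H, by rw [δ_neg, hH, coch_sub, coch_sub, Category.id_comp, Category.assoc]; abel⟩

end IsBisum

end Bisum

/-! ### Moving scalars past other objects -/

section CenterHom

variable {C : Type u} [Category.{v} C] [MonoidalCategory C]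

/-- Moving the source of a map `A ⟶ Z ⊗ W` of central objects past `X` is the same as moving the
factors `W` and `Z` past `X` one after the other. -/
lemma center_comm_split {A Z W : Center C} (f : A ⟶ Z ⊗ W) (X N : C) :
    (f.f ▷ (X ⊗ N) ≫ (α_ Z.1 W.1 (X ⊗ N)).hom) ≫
      Z.1 ◁ ((α_ W.1 X N).inv ≫ (W.2.β X).hom ▷ N ≫ (α_ X W.1 N).hom) ≫
        ((α_ Z.1 X (W.1 ⊗ N)).inv ≫ (Z.2.β X).hom ▷ (W.1 ⊗ N) ≫ (α_ X Z.1 (W.1 ⊗ N)).hom) =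
    ((α_ A.1 X N).inv ≫ (A.2.β X).hom ▷ N ≫ (α_ X A.1 N).hom) ≫
      X ◁ (f.f ▷ N ≫ (α_ Z.1 W.1 N).hom) := by
  have h := congrArg (fun g => (α_ A.1 X N).inv ≫ g ▷ N ≫ (α_ X (Z.1 ⊗ W.1) N).hom ≫
    X ◁ (α_ Z.1 W.1 N).hom) (f.comm X)
  dsimp only [Center.tensor_β, Iso.trans_hom, whiskerLeftIso_hom, Iso.symm_hom,
    whiskerRightIso_hom] at h
  calc _ = (α_ A.1 X N).inv ≫ (f.f ▷ X ≫ (α_ Z.1 W.1 X).hom ≫ Z.1 ◁ (W.2.β X).hom ≫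
        (α_ Z.1 X W.1).inv ≫ (Z.2.β X).hom ▷ W.1 ≫ (α_ X Z.1 W.1).hom) ▷ N ≫
        (α_ X (Z.1 ⊗ W.1) N).hom ≫ X ◁ (α_ Z.1 W.1 N).hom := by monoidal
    _ = _ := h
    _ = _ := by monoidal

lemma whiskerRight_associator_natural {A X Y N N' : C} (g : A ⟶ X ⊗ Y) (f : N ⟶ N') :
    (g ▷ N ≫ (α_ X Y N).hom) ≫ X ◁ Y ◁ f = A ◁ f ≫ g ▷ N' ≫ (α_ X Y N').hom := by
  rw [whisker_exchange_assoc]; simp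

lemma associator_inv_whiskerRight_natural {X Y N N' : C} (g : X ⊗ Y ⟶ 𝟙_ C) (f : N ⟶ N') :
    X ◁ Y ◁ f ≫ (α_ X Y N').inv ≫ g ▷ N' ≫ (λ_ N').hom =
      ((α_ X Y N).inv ≫ g ▷ N ≫ (λ_ N).hom) ≫ f := by
  simp only [Category.assoc, ← leftUnitor_naturality]
  rw [← whisker_exchange_assoc]; simp

lemma merge_past {Z W X : C} (f : Z ⊗ W ⟶ 𝟙_ C) (b : W ⊗ X ⟶ X ⊗ W) (b' : Z ⊗ X ⟶ X ⊗ Z)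
    (h : f ▷ X ≫ (λ_ X).hom ≫ (ρ_ X).inv =
      ((α_ Z W X).hom ≫ Z ◁ b ≫ (α_ Z X W).inv ≫ b' ▷ W ≫ (α_ X Z W).hom) ≫ X ◁ f) (N : C) :
    Z ◁ ((α_ W X N).inv ≫ b ▷ N ≫ (α_ X W N).hom) ≫
      ((α_ Z X (W ⊗ N)).inv ≫ b' ▷ (W ⊗ N) ≫ (α_ X Z (W ⊗ N)).hom) ≫
        X ◁ ((α_ Z W N).inv ≫ f ▷ N ≫ (λ_ N).hom) =
    (α_ Z W (X ⊗ N)).inv ≫ f ▷ (X ⊗ N) ≫ (λ_ (X ⊗ N)).hom := by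
  calc _ = Z ◁ (α_ W X N).inv ≫ (α_ Z (W ⊗ X) N).inv ≫ (α_ Z W X).inv ▷ N ≫
        (((α_ Z W X).hom ≫ Z ◁ b ≫ (α_ Z X W).inv ≫ b' ▷ W ≫ (α_ X Z W).hom) ≫ X ◁ f) ▷ N ≫
        (α_ X (𝟙_ C) N).hom ≫ X ◁ (λ_ N).hom := by monoidal
    _ = Z ◁ (α_ W X N).inv ≫ (α_ Z (W ⊗ X) N).inv ≫ (α_ Z W X).inv ▷ N ≫
        (f ▷ X ≫ (λ_ X).hom ≫ (ρ_ X).inv) ▷ N ≫ (α_ X (𝟙_ C) N).hom ≫ X ◁ (λ_ N).hom := by rw [h]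
    _ = _ := by monoidal

/-- Contracting `Z ⊗ W` to the unit is compatible with moving `Z` and `W` past `X`. -/
lemma center_comm_merge {Z W : Center C} (f : Z ⊗ W ⟶ 𝟙_ (Center C)) (X N : C) :
    Z.1 ◁ ((α_ W.1 X N).inv ≫ (W.2.β X).hom ▷ N ≫ (α_ X W.1 N).hom) ≫
      ((α_ Z.1 X (W.1 ⊗ N)).inv ≫ (Z.2.β X).hom ▷ (W.1 ⊗ N) ≫ (α_ X Z.1 (W.1 ⊗ N)).hom) ≫
        X ◁ ((α_ Z.1 W.1 N).inv ≫ f.f ▷ N ≫ (λ_ N).hom) =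
    (α_ Z.1 W.1 (X ⊗ N)).inv ≫ f.f ▷ (X ⊗ N) ≫ (λ_ (X ⊗ N)).hom :=
  merge_past f.f _ _ (f.comm X) N

end CenterHom

section Center

variable {B : Type u} [Category.{v} B] [Preadditive B] {P : ObjectProperty (CochainComplex B ℤ)}
  [MonoidalCategory (Cx P)]
variable {X X' Y Z W N N' : Cx P} {n : ℤ}

/-- The isomorphism `f ⊗ M` between right-nested tensor products. -/
def actIso (f : X ⊗ Y ≅ Z ⊗ W) (M : Cx P) : X ⊗ (Y ⊗ M) ≅ Z ⊗ (W ⊗ M) where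
  hom := act f.hom M
  inv := act f.inv M
  hom_inv_id := act_isoHomInv f
  inv_hom_id := act_isoInvHom f

lemma actIso_hom (f : X ⊗ Y ≅ Z ⊗ W) : (actIso f N).hom = act f.hom N := rfl

variable (T : Center (Cx P))

/-- The isomorphism `T ⊗ (X ⊗ N) ≅ X ⊗ (T ⊗ N)` moving a central object `T` past `X`. -/
def sw (X N : Cx P) : T.1 ⊗ (X ⊗ N) ≅ X ⊗ (T.1 ⊗ N) := actIso (T.2.β X) N

lemma sw_natural_left (f : X ⟶ Y) (N : Cx P) :
    T.1 ◁ (f ▷ N) ≫ (sw T Y N).hom = (sw T X N).hom ≫ f ▷ (T.1 ⊗ N) := by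
  rw [sw, sw, actIso_hom, actIso_hom, ← act_whiskerLeft, ← act_whiskerRight, ← act_comp,
    ← act_comp, HalfBraiding.naturality]

lemma sw_natural_right (X : Cx P) (f : N ⟶ N') :
    T.1 ◁ (X ◁ f) ≫ (sw T X N').hom = (sw T X N).hom ≫ X ◁ (T.1 ◁ f) :=
  (act_natural _ f).symm

lemma sw_tensor (X Y N : Cx P) :
    (sw T (X ⊗ Y) N).hom = T.1 ◁ (α_ X Y N).hom ≫ (sw T X (Y ⊗ N)).hom ≫
      X ◁ (sw T Y N).hom ≫ (α_ X Y (T.1 ⊗ N)).inv := by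
  rw [sw, sw, sw, actIso_hom, actIso_hom, actIso_hom, act, act, act, HalfBraiding.monoidal]
  monoidal

/-- Moving a central object past a map of right-nested tensor products. -/
lemma sw_act (f : X ⊗ Y ⟶ Z ⊗ W) (N : Cx P) :
    T.1 ◁ act f N ≫ (sw T Z (W ⊗ N)).hom ≫ Z ◁ (sw T W N).hom =
      (sw T X (Y ⊗ N)).hom ≫ X ◁ (sw T Y N).hom ≫ act f (T.1 ⊗ N) := by
  have h3 := sw_natural_left T f N
  rw [sw_tensor, sw_tensor] at h3
  simp only [act, MonoidalCategory.whiskerLeft_comp, Category.assoc] at h3 ⊢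
  rw [← cancel_mono (α_ Z W (T.1 ⊗ N)).inv, ← cancel_epi (T.1 ◁ (α_ X Y N).hom)]
  simpa using h3

/-- Two central objects may be moved past a third object in either order. -/
lemma sw_sw (S : Center (Cx P)) (X N : Cx P) :
    T.1 ◁ (sw S X N).hom ≫ (sw T X (S.1 ⊗ N)).hom ≫ X ◁ (sw T S.1 N).hom =
      (sw T S.1 (X ⊗ N)).hom ≫ S.1 ◁ (sw T X N).hom ≫ (sw S X (T.1 ⊗ N)).hom :=
  sw_act T (S.2.β X).hom N

section Graded

variable [DGMonoidal P]

open DGMonoidal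

lemma sw_natural_right_graded (X : Cx P) (z : Coch N N' n) :
    pre (sw T X N).hom (wL X (wL T.1 z)) = post (wL T.1 (wL X z)) (sw T X N').hom :=
  act_natural_graded _ z

/-- The half-braiding of `T` is natural with respect to graded maps of every degree. -/
def IsGradedCentral : Prop :=
  ∀ (X Y : Cx P) (n : ℤ) (z : Coch X Y n),
    post (wL T.1 z) (T.2.β Y).hom = pre (T.2.β X).hom (wR T.1 z)

variable {T}

lemma sw_natural_left_graded (hT : IsGradedCentral T) (z : Coch X Y n) (N : Cx P) :
    post (wL T.1 (wR N z)) (sw T Y N).hom = pre (sw T X N).hom (wR (T.1 ⊗ N) z) := by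
  have := congrArg (fun y => gact y N) (hT X Y n z)
  change gact (post _ _) N = gact (pre _ _) N at this
  rwa [gact_post, gact_pre, gact_wL, gact_wR] at this

end Graded

/-- The half-braidings of `S` and `T` with each other are mutually inverse. -/
def IsSymm (S T : Center (Cx P)) : Prop := (S.2.β T.1).hom ≫ (T.2.β S.1).hom = 𝟙 _

/-- The half-braiding of `T` with itself is trivial. -/
def IsSelfTrivial (T : Center (Cx P)) : Prop := (T.2.β T.1).hom = 𝟙 _

variable {S T}

lemma IsSymm.sw_sw {S T : Center (Cx P)} (h : IsSymm S T) (N : Cx P) :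
    (sw S T.1 N).hom ≫ (sw T S.1 N).hom = 𝟙 _ := by
  rw [sw, sw, actIso_hom, actIso_hom, ← act_comp]
  exact (congrArg (fun f => act f N) h).trans act_id

lemma IsSymm.symm {S T : Center (Cx P)} (h : IsSymm S T) : IsSymm T S := by
  dsimp only [IsSymm] at h ⊢
  rw [← cancel_epi (S.2.β T.1).hom, reassoc_of% h, Category.comp_id]

lemma IsSymm.sw_inv {S T : Center (Cx P)} (h : IsSymm S T) (N : Cx P) :
    (sw S T.1 N).inv = (sw T S.1 N).hom := by
  rw [← cancel_epi (sw S T.1 N).hom, Iso.hom_inv_id, h.sw_sw]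

lemma IsSelfTrivial.sw (h : IsSelfTrivial T) (N : Cx P) : (sw T T.1 N).hom = 𝟙 _ := by
  rw [CatDiag.sw, actIso_hom]
  exact (congrArg (fun f => act f N) h).trans act_id

end Center

/-! ### Quotients of invertible scalars -/

section Quotient

variable {B : Type u} [Category.{v} B] [Preadditive B] {P : ObjectProperty (CochainComplex B ℤ)}
  [MonoidalCategory (Cx P)]
variable {L M M' S : Center (Cx P)} (ε : M' ⊗ M ≅ 𝟙_ (Center (Cx P))) (d : S ≅ M' ⊗ L)
variable {N N' : Cx P}

/-- A splitting `S ≅ M' ⊗ L`, as an isomorphism `S ⊗ N ≅ M' ⊗ (L ⊗ N)`. -/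
def split (N : Cx P) : S.1 ⊗ N ≅ M'.1 ⊗ (L.1 ⊗ N) :=
  whiskerRightIso (X := S.1) (Y := M'.1 ⊗ L.1) ((Center.forget (Cx P)).mapIso d) N ≪≫ α_ _ _ _

/-- A pairing `M' ⊗ M ≅ 𝟙`, as an isomorphism `M' ⊗ (M ⊗ N) ≅ N`. -/
def contract (N : Cx P) : M'.1 ⊗ (M.1 ⊗ N) ≅ N :=
  (α_ _ _ _).symm ≪≫ whiskerRightIso (X := M'.1 ⊗ M.1) (Y := 𝟙_ (Cx P))
    ((Center.forget (Cx P)).mapIso ε) N ≪≫ λ_ N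

/-- The isomorphism `N ≅ M ⊗ (M' ⊗ N)` obtained from a pairing `M' ⊗ M ≅ 𝟙`. -/
def expand (N : Cx P) : N ≅ M.1 ⊗ (M'.1 ⊗ N) := (contract ε N).symm ≪≫ sw M' M.1 N

/-- If `S` is the quotient of `L` by `M`, the isomorphism `L ⊗ N ≅ M ⊗ (S ⊗ N)`. -/
def quotSplit (N : Cx P) : L.1 ⊗ N ≅ M.1 ⊗ (S.1 ⊗ N) :=
  expand ε _ ≪≫ whiskerLeftIso _ (split d N).symm

lemma split_hom (N : Cx P) : (split d N).hom = d.hom.f ▷ N ≫ (α_ M'.1 L.1 N).hom := rfl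

lemma contract_hom (N : Cx P) :
    (contract ε N).hom = (α_ M'.1 M.1 N).inv ≫ ε.hom.f ▷ N ≫ (λ_ N).hom := rfl

lemma expand_hom (N : Cx P) : (expand ε N).hom = (contract ε N).inv ≫ (sw M' M.1 N).hom := rfl

lemma quotSplit_hom (N : Cx P) :
    (quotSplit ε d N).hom = (expand ε (L.1 ⊗ N)).hom ≫ M.1 ◁ (split d N).inv := rfl

lemma split_natural (f : N ⟶ N') :
    (split d N).hom ≫ M'.1 ◁ L.1 ◁ f = S.1 ◁ f ≫ (split d N').hom :=
  whiskerRight_associator_natural d.hom.f f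

lemma split_inv_natural (f : N ⟶ N') :
    (split d N).inv ≫ S.1 ◁ f = M'.1 ◁ L.1 ◁ f ≫ (split d N').inv := by
  rw [Iso.inv_comp_eq, reassoc_of% split_natural, Iso.hom_inv_id, Category.comp_id]

lemma contract_natural (f : N ⟶ N') :
    M'.1 ◁ M.1 ◁ f ≫ (contract ε N').hom = (contract ε N).hom ≫ f :=
  associator_inv_whiskerRight_natural ε.hom.f f

lemma contract_inv_natural (f : N ⟶ N') :
    (contract ε N).inv ≫ M'.1 ◁ M.1 ◁ f = f ≫ (contract ε N').inv := by
  rw [Iso.inv_comp_eq, ← reassoc_of% contract_natural, Iso.hom_inv_id, Category.comp_id]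

lemma expand_natural (f : N ⟶ N') :
    (expand ε N).hom ≫ M.1 ◁ M'.1 ◁ f = f ≫ (expand ε N').hom := by
  rw [expand_hom, expand_hom, Category.assoc, ← sw_natural_right, reassoc_of% contract_inv_natural]

lemma quotSplit_natural (f : N ⟶ N') :
    (quotSplit ε d N).hom ≫ M.1 ◁ S.1 ◁ f = L.1 ◁ f ≫ (quotSplit ε d N').hom := by
  rw [quotSplit_hom, quotSplit_hom, Category.assoc, ← MonoidalCategory.whiskerLeft_comp,
    split_inv_natural, MonoidalCategory.whiskerLeft_comp, reassoc_of% expand_natural]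

lemma split_sw (X N : Cx P) :
    (split d (X ⊗ N)).hom ≫ M'.1 ◁ (sw L X N).hom ≫ (sw M' X (L.1 ⊗ N)).hom =
      (sw S X N).hom ≫ X ◁ (split d N).hom :=
  center_comm_split d.hom X N

lemma contract_sw (X N : Cx P) :
    M'.1 ◁ (sw M X N).hom ≫ (sw M' X (M.1 ⊗ N)).hom ≫ X ◁ (contract ε N).hom =
      (contract ε (X ⊗ N)).hom :=
  center_comm_merge ε.hom X N

/-- Since `M` and `M'` are central, the copy of `M ⊗ M'` created to the left of `X` may be moved to
its right. -/
lemma expand_sw (X N : Cx P) :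
    (expand ε (X ⊗ N)).hom ≫ M.1 ◁ (sw M' X N).hom ≫ (sw M X (M'.1 ⊗ N)).hom =
      X ◁ (expand ε N).hom := by
  rw [expand_hom, expand_hom, Category.assoc, ← sw_sw, Iso.inv_comp_eq,
    MonoidalCategory.whiskerLeft_comp, ← reassoc_of% contract_sw,
    ← MonoidalCategory.whiskerLeft_comp_assoc, Iso.hom_inv_id]
  simp

lemma quotSplit_sw (X N : Cx P) :
    (quotSplit ε d (X ⊗ N)).hom ≫ M.1 ◁ (sw S X N).hom ≫ (sw M X (S.1 ⊗ N)).hom =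
      (sw L X N).hom ≫ X ◁ (quotSplit ε d N).hom := by
  have h : (split d (X ⊗ N)).inv ≫ (sw S X N).hom =
      M'.1 ◁ (sw L X N).hom ≫ (sw M' X (L.1 ⊗ N)).hom ≫ X ◁ (split d N).inv := by
    rw [Iso.inv_comp_eq, reassoc_of% split_sw, ← MonoidalCategory.whiskerLeft_comp, Iso.hom_inv_id,
      MonoidalCategory.whiskerLeft_id, Category.comp_id]
  rw [quotSplit_hom, quotSplit_hom, Category.assoc, ← MonoidalCategory.whiskerLeft_comp_assoc, h]
  simp only [MonoidalCategory.whiskerLeft_comp, Category.assoc]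
  rw [sw_natural_right, reassoc_of% expand_natural, reassoc_of% expand_sw]

/-- One of the two triangle identities for `M` and `M'`. -/
lemma whiskerLeft_contract_inv (hM : IsSelfTrivial M) (N : Cx P) :
    M.1 ◁ (contract ε N).inv = (expand ε (M.1 ⊗ N)).hom := by
  have := expand_sw ε M.1 N
  rw [hM.sw, Category.comp_id, expand_hom ε N, MonoidalCategory.whiskerLeft_comp,
    cancel_mono] at this
  exact this.symm

/-- The other triangle identity, which follows from the first since every object `N` is of the form
`M ⊗ (M' ⊗ N)`. -/
lemma whiskerLeft_expand (hM : IsSelfTrivial M) (N : Cx P) :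
    M'.1 ◁ (expand ε N).hom = (contract ε (M'.1 ⊗ N)).inv := by
  suffices hN : ∀ N : Cx P,
      M'.1 ◁ (expand ε (M.1 ⊗ N)).hom = (contract ε (M'.1 ⊗ (M.1 ⊗ N))).inv by
    have h1 := congrArg (M'.1 ◁ ·) (expand_natural ε (expand ε N).hom)
    have h2 := contract_inv_natural ε (M'.1 ◁ (expand ε N).hom)
    simp only [MonoidalCategory.whiskerLeft_comp, hN] at h1
    rw [← h2, cancel_mono] at h1
    exact h1
  intro N
  rw [← whiskerLeft_contract_inv ε hM, ← cancel_epi (contract ε N).inv, contract_inv_natural]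

/-- If `S` is the quotient of `L` by `M`, the isomorphism `S ⊗ N ≅ L ⊗ (M' ⊗ N)`. -/
def splitRight (N : Cx P) : S.1 ⊗ N ≅ L.1 ⊗ (M'.1 ⊗ N) := split d N ≪≫ sw M' L.1 N

lemma splitRight_hom (N : Cx P) :
    (splitRight d N).hom = (split d N).hom ≫ (sw M' L.1 N).hom := rfl

lemma expand_sw_right (h : IsSymm M L) (N : Cx P) :
    (expand ε (L.1 ⊗ N)).hom ≫ M.1 ◁ (sw M' L.1 N).hom =
      L.1 ◁ (expand ε N).hom ≫ (sw L M.1 (M'.1 ⊗ N)).hom := by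
  rw [← expand_sw, Category.assoc, Category.assoc, h.sw_sw, Category.comp_id]

lemma splitRight_quotSplit (h : IsSymm M L) (hM : IsSelfTrivial M) (N : Cx P) :
    (splitRight d N).hom ≫ (quotSplit ε d (M'.1 ⊗ N)).hom =
      S.1 ◁ (expand ε N).hom ≫ (sw S M.1 (M'.1 ⊗ N)).hom := by
  have h1 : (expand ε (M'.1 ⊗ (L.1 ⊗ N))).hom = M'.1 ◁ (expand ε (L.1 ⊗ N)).hom ≫
      (sw M' M.1 (M'.1 ⊗ (L.1 ⊗ N))).hom := by
    rw [whiskerLeft_expand ε hM, expand_hom]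
  rw [← cancel_mono (M.1 ◁ (split d (M'.1 ⊗ N)).hom), Category.assoc, Category.assoc, ← split_sw,
    ← reassoc_of% split_natural, quotSplit_hom, splitRight_hom, Category.assoc, Category.assoc,
    ← MonoidalCategory.whiskerLeft_comp, Iso.inv_hom_id, MonoidalCategory.whiskerLeft_id,
    Category.comp_id, ← expand_natural, h1, Category.assoc, ← sw_natural_right,
    ← MonoidalCategory.whiskerLeft_comp_assoc, ← MonoidalCategory.whiskerLeft_comp_assoc,
    expand_sw_right ε h]

/-- Splitting off `M` and contracting it again is the identity. -/
lemma split_quotSplit_contract (hM : IsSelfTrivial M) (N : Cx P) :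
    (split d N).hom ≫ M'.1 ◁ (quotSplit ε d N).hom ≫ (contract ε (S.1 ⊗ N)).hom = 𝟙 _ := by
  rw [quotSplit_hom, MonoidalCategory.whiskerLeft_comp, Category.assoc, contract_natural,
    whiskerLeft_expand ε hM, Iso.inv_hom_id_assoc, Iso.hom_inv_id]

variable {L' T : Center (Cx P)} (ε' : L' ⊗ L ≅ 𝟙_ (Center (Cx P))) (d' : T ≅ L' ⊗ M)

/-- If `S` is the quotient of `L` by `M` and `T` is the quotient of `M` by `L`, the map
`T ⊗ (S ⊗ N) ⟶ N` which cancels first `M` and then `L`. -/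
def cancelQuot (N : Cx P) : T.1 ⊗ (S.1 ⊗ N) ⟶ N :=
  (split d' (S.1 ⊗ N)).hom ≫ L'.1 ◁ M.1 ◁ (split d N).hom ≫
    L'.1 ◁ (expand ε (L.1 ⊗ N)).inv ≫ (contract ε' N).hom

/-- Splitting `M` into `L ⊗ T` and cancelling `T ⊗ S` undoes the splitting of `L` into `M ⊗ S`. -/
lemma quotSplit_cancelQuot (hL : IsSelfTrivial L) (N : Cx P) :
    (quotSplit ε' d' (S.1 ⊗ N)).hom ≫ L.1 ◁ cancelQuot ε d ε' d' N =
      (quotSplit ε d N).inv := by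
  have h : (quotSplit ε d N).inv = M.1 ◁ (split d N).hom ≫ (expand ε (L.1 ⊗ N)).inv := rfl
  rw [h, quotSplit_hom, cancelQuot]
  simp only [MonoidalCategory.whiskerLeft_comp, Category.assoc]
  rw [← MonoidalCategory.whiskerLeft_comp_assoc, Iso.inv_hom_id, MonoidalCategory.whiskerLeft_id,
    Category.id_comp, reassoc_of% expand_natural, reassoc_of% expand_natural,
    ← whiskerLeft_contract_inv ε' hL, ← MonoidalCategory.whiskerLeft_comp, Iso.inv_hom_id]
  simp

section Graded

variable [DGMonoidal P] {n : ℤ}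

open DGMonoidal

lemma whiskerRight_associator_natural_graded {A X Y : Cx P} (g : A ⟶ X ⊗ Y) (z : Coch N N' n) :
    pre (g ▷ N ≫ (α_ X Y N).hom) (wL X (wL Y z)) = post (wL A z) (g ▷ N' ≫ (α_ X Y N').hom) := by
  rw [← pre_pre, ← post_assoc_right, ← post_pre, pre_wL_exchange, post_post]

lemma associator_inv_whiskerRight_natural_graded {X Y : Cx P} (g : X ⊗ Y ⟶ 𝟙_ (Cx P))
    (z : Coch N N' n) :
    post (wL X (wL Y z)) ((α_ X Y N').inv ≫ g ▷ N' ≫ (λ_ N').hom) =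
      pre ((α_ X Y N).inv ≫ g ▷ N ≫ (λ_ N).hom) z := by
  have h1 := post_assoc_right (X := X) (Y := Y) z
  rw [eq_comm, pre_eq_iff] at h1
  have h2 : pre (λ_ N).hom z = post (wL (𝟙_ (Cx P)) z) (λ_ N').hom := (left_unitor z).symm
  rw [h1, post_pre, post_post, Iso.hom_inv_id_assoc, ← pre_pre, ← pre_pre, h2, ← post_pre (g ▷ N),
    pre_wL_exchange, post_post]

lemma expand_natural_graded (z : Coch N N' n) :
    pre (expand ε N).hom (wL M.1 (wL M'.1 z)) = post z (expand ε N').hom := by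
  have h : post (wL M'.1 (wL M.1 z)) (contract ε N').hom = pre (contract ε N).hom z :=
    associator_inv_whiskerRight_natural_graded ε.hom.f z
  have h' : post z (contract ε N').inv = pre (contract ε N).inv (wL M'.1 (wL M.1 z)) := by
    rw [← pre_eq_iff, ← post_pre, ← h, post_post, Iso.hom_inv_id, post_id]
  rw [expand_hom, expand_hom, ← pre_pre, sw_natural_right_graded, ← post_pre, ← h', post_post]

lemma quotSplit_natural_graded (z : Coch N N' n) :
    pre (quotSplit ε d N).hom (wL M.1 (wL S.1 z)) =
      post (wL L.1 z) (quotSplit ε d N').hom := by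
  have h : pre (split d N).hom (wL M'.1 (wL L.1 z)) = post (wL S.1 z) (split d N').hom :=
    whiskerRight_associator_natural_graded d.hom.f z
  have h' : pre (split d N).inv (wL S.1 z) = post (wL M'.1 (wL L.1 z)) (split d N').inv := by
    rw [eq_comm, ← pre_eq_iff, ← post_pre, h, post_post, Iso.hom_inv_id, post_id]
  rw [quotSplit_hom, quotSplit_hom, ← pre_pre, ← wL_pre, h', wL_post, ← post_pre,
    expand_natural_graded, post_post]

end Graded

end Quotient

/-! ### Objects that commute with `F` -/

section FObj

variable {C : Type u} [Category.{v} C] [MonoidalCategory C]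

/-- An object `X` together with a map `X ⊗ F ⟶ F ⊗ X` which moves `F` to the left. The map is not
required to be invertible, so that for a sum it suffices to give it on the summands. -/
structure FObj (F : C) where
  /-- the underlying object -/
  obj : C
  /-- the map moving `F` to the left -/
  c : obj ⊗ F ⟶ F ⊗ obj

variable {F : C}

namespace FObj

/-- The tensor product of two objects that commute with `F`. -/
abbrev tensor (X Y : FObj F) : FObj F where
  obj := X.obj ⊗ Y.obj
  c := (α_ _ _ _).hom ≫ X.obj ◁ Y.c ≫ (α_ _ _ _).inv ≫ X.c ▷ Y.obj ≫ (α_ _ _ _).hom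

/-- The unit object. -/
abbrev unit (F : C) : FObj F := ⟨𝟙_ C, (λ_ F).hom ≫ (ρ_ F).inv⟩

/-- An object of the Drinfeld center commutes with every `F`. -/
abbrev ofCenter (F : C) (S : Center C) : FObj F := ⟨S.1, (S.2.β F).hom⟩

/-- A morphism compatible with the maps moving `F` to the left. -/
def IsHom (X Y : FObj F) (f : X.obj ⟶ Y.obj) : Prop := X.c ≫ F ◁ f = f ▷ F ≫ Y.c

variable {X Y Z W : FObj F}

lemma IsHom.comp {f : X.obj ⟶ Y.obj} {g : Y.obj ⟶ Z.obj} (hf : IsHom X Y f) (hg : IsHom Y Z g) :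
    IsHom X Z (f ≫ g) := by
  dsimp only [IsHom] at hf hg ⊢
  rw [MonoidalCategory.whiskerLeft_comp, reassoc_of% hf, hg, comp_whiskerRight_assoc]

lemma IsHom.inv {f : X.obj ≅ Y.obj} (hf : IsHom X Y f.hom) : IsHom Y X f.inv := by
  dsimp only [IsHom] at hf ⊢
  rw [← cancel_epi (f.hom ▷ F), ← reassoc_of% hf, ← MonoidalCategory.whiskerLeft_comp]
  simp

lemma IsHom.whiskerLeft {f : Y.obj ⟶ Z.obj} (hf : IsHom Y Z f) (X : FObj F) :
    IsHom (X.tensor Y) (X.tensor Z) (X.obj ◁ f) := by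
  dsimp only [IsHom, tensor] at hf ⊢
  have : (α_ F X.obj Y.obj).hom ≫ F ◁ X.obj ◁ f = (F ⊗ X.obj) ◁ f ≫ (α_ _ _ _).hom := by simp
  simp only [Category.assoc]
  rw [this, ← whisker_exchange_assoc]
  simp only [whisker_assoc, tensor_whiskerLeft, Category.assoc, Iso.inv_hom_id_assoc,
    ← MonoidalCategory.whiskerLeft_comp_assoc, hf]

lemma IsHom.whiskerRight {f : X.obj ⟶ Y.obj} (hf : IsHom X Y f) (Z : FObj F) :
    IsHom (X.tensor Z) (Y.tensor Z) (f ▷ Z.obj) := by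
  dsimp only [IsHom, tensor] at hf ⊢
  have h1 : (α_ F X.obj Z.obj).hom ≫ F ◁ (f ▷ Z.obj) = (F ◁ f) ▷ Z.obj ≫ (α_ _ _ _).hom := by simp
  have h2 : f ▷ Z.obj ▷ F ≫ (α_ Y.obj Z.obj F).hom = (α_ _ _ _).hom ≫ f ▷ (Z.obj ⊗ F) := by simp
  simp only [Category.assoc]
  rw [h1, reassoc_of% h2, ← whisker_exchange_assoc, ← comp_whiskerRight_assoc, hf]
  simp

lemma isHom_associator (X Y Z : FObj F) :
    IsHom ((X.tensor Y).tensor Z) (X.tensor (Y.tensor Z)) (α_ X.obj Y.obj Z.obj).hom := by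
  dsimp only [IsHom, tensor]
  monoidal

lemma isHom_leftUnitor (X : FObj F) : IsHom ((unit F).tensor X) X (λ_ X.obj).hom := by
  dsimp only [IsHom, tensor, unit]
  monoidal

lemma isHom_rightUnitor (X : FObj F) : IsHom (X.tensor (unit F)) X (ρ_ X.obj).hom := by
  dsimp only [IsHom, tensor, unit]
  monoidal

lemma isHom_ofCenter_merge {S T : Center C} (f : S ⊗ T ⟶ 𝟙_ (Center C)) :
    IsHom ((ofCenter F S).tensor (ofCenter F T)) (unit F) f.f := by
  have := f.comm F
  dsimp only [IsHom, tensor, ofCenter, unit]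
  exact this.symm

lemma isHom_ofCenter_split {A S T : Center C} (f : A ⟶ S ⊗ T) :
    IsHom (ofCenter F A) ((ofCenter F S).tensor (ofCenter F T)) f.f :=
  (f.comm F).symm

/-- Moving a central object past an object that commutes with `F` is compatible with `F`. -/
lemma isHom_halfBraiding (S : Center C) (X : FObj F) :
    IsHom ((ofCenter F S).tensor X) (X.tensor (ofCenter F S)) (S.2.β X.obj).hom := by
  have h := S.2.naturality X.c
  rw [S.2.monoidal, S.2.monoidal] at h
  dsimp only [IsHom, tensor, ofCenter] at h ⊢
  rw [← cancel_mono (α_ F X.obj S.1).inv, ← cancel_epi (α_ S.1 X.obj F).inv]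
  simpa using h

end FObj

end FObj

section Unfold

variable {B : Type u} [Category.{v} B] [Preadditive B] {P : ObjectProperty (CochainComplex B ℤ)}
  [MonoidalCategory (Cx P)]
variable {X Y Z N N' F : Cx P} {n : ℤ}

/-- For `f : X ⟶ Y ⊗ Z`, the map `f ⊗ N` with values in a right-nested tensor product. -/
def unf (f : X ⟶ Y ⊗ Z) (N : Cx P) : X ⊗ N ⟶ Y ⊗ (Z ⊗ N) := f ▷ N ≫ (α_ Y Z N).hom

lemma unf_sw (T : Center (Cx P)) (f : X ⟶ Y ⊗ Z) (N : Cx P) :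
    T.1 ◁ unf f N ≫ (sw T Y (Z ⊗ N)).hom ≫ Y ◁ (sw T Z N).hom =
      (sw T X N).hom ≫ unf f (T.1 ⊗ N) := by
  have h := sw_natural_left T f N
  rw [sw_tensor] at h
  rw [unf, unf, ← reassoc_of% h]
  simp

/-- The hypothesis that `f : A ⟶ Z ⊗ S` is compatible with `F`, for right-nested tensor products. -/
lemma act_c_unf {A Z : FObj F} {S : Center (Cx P)} {f : A.obj ⟶ Z.obj ⊗ S.1}
    (hf : FObj.IsHom A (Z.tensor (.ofCenter F S)) f) (N : Cx P) :
    act A.c N ≫ F ◁ unf f N = unf f (F ⊗ N) ≫ Z.obj ◁ (sw S F N).hom ≫ act Z.c (S.1 ⊗ N) := by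
  have h := congrArg (fun g => (α_ _ _ _).inv ≫ g ▷ N ≫ (α_ _ _ _).hom ≫ F ◁ (α_ _ _ _).hom) hf
  dsimp only [FObj.tensor, FObj.ofCenter] at h
  calc _ = _ := by simp only [act, unf]; monoidal
    _ = _ := h
    _ = _ := by simp only [act, unf, sw, actIso_hom]; monoidal

/-- The hypothesis that `f : S ⊗ Z ⟶ T ⊗ Z` is compatible with `F`, for right-nested tensor
products. -/
lemma act_c_act {Z : FObj F} {S T : Center (Cx P)} {f : S.1 ⊗ Z.obj ⟶ T.1 ⊗ Z.obj}
    (hf : FObj.IsHom ((FObj.ofCenter F S).tensor Z) ((FObj.ofCenter F T).tensor Z) f) (N : Cx P) :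
    act f (F ⊗ N) ≫ T.1 ◁ act Z.c N ≫ (sw T F (Z.obj ⊗ N)).hom =
      S.1 ◁ act Z.c N ≫ (sw S F (Z.obj ⊗ N)).hom ≫ F ◁ act f N := by
  have h := congrArg (fun g => (α_ _ _ _).inv ≫ (α_ _ _ _).inv ≫ g ▷ N ≫
    (α_ _ _ _).hom ≫ F ◁ (α_ _ _ _).hom) hf
  dsimp only [FObj.tensor, FObj.ofCenter] at h
  calc _ = _ := by simp only [act, sw, actIso_hom]; monoidal
    _ = _ := h.symm
    _ = _ := by simp only [act, sw, actIso_hom]; monoidal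

/-- The central object `T` may be moved through `γ`: moving `T` past `Z`, applying `γ` and moving
`F` back to the left is the same as applying `γ` directly. -/
def FObj.Commutes (Z : FObj F) {T : Center (Cx P)} (γ : T.1 ⟶ F) : Prop :=
  (T.2.β Z.obj).hom ≫ Z.obj ◁ γ ≫ Z.c = γ ▷ Z.obj

lemma FObj.Commutes.act {Z : FObj F} {T : Center (Cx P)} {γ : T.1 ⟶ F} (h : Z.Commutes γ)
    (N : Cx P) :
    (sw T Z.obj N).hom ≫ Z.obj ◁ (γ ▷ N) ≫ CatDiag.act Z.c N = γ ▷ (Z.obj ⊗ N) := by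
  rw [sw, actIso_hom, ← act_whiskerLeft, ← act_comp, ← act_comp, h, act_whiskerRight]

lemma FObj.Commutes.tensor {Z W : FObj F} {T : Center (Cx P)} {γ : T.1 ⟶ F} (h : Z.Commutes γ)
    (h' : W.Commutes γ) : (Z.tensor W).Commutes γ := by
  dsimp only [FObj.Commutes, FObj.tensor] at h h' ⊢
  rw [HalfBraiding.monoidal]
  calc _ = (α_ _ _ _).inv ≫ (T.2.β Z.obj).hom ▷ W.obj ≫ (α_ _ _ _).hom ≫
        Z.obj ◁ ((T.2.β W.obj).hom ≫ W.obj ◁ γ ≫ W.c) ≫ (α_ _ _ _).inv ≫ Z.c ▷ W.obj ≫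
        (α_ _ _ _).hom := by monoidal
    _ = (α_ _ _ _).inv ≫ ((T.2.β Z.obj).hom ≫ Z.obj ◁ γ ≫ Z.c) ▷ W.obj ≫ (α_ _ _ _).hom := by
        rw [h']; monoidal
    _ = _ := by rw [h]; simp

lemma FObj.Commutes.of_isHom {Z W : FObj F} {T : Center (Cx P)} {γ : T.1 ⟶ F} (h : Z.Commutes γ)
    (e : Z.obj ≅ W.obj) (he : FObj.IsHom Z W e.hom) : W.Commutes γ := by
  dsimp only [FObj.Commutes, FObj.IsHom] at h he ⊢
  rw [← cancel_epi (T.1 ◁ e.hom), T.2.naturality_assoc, ← whisker_exchange_assoc, ← he,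
    whisker_exchange, ← h]
  simp only [Category.assoc]

lemma halfBraiding_unit (T : Center (Cx P)) :
    (T.2.β (𝟙_ (Cx P))).hom = (ρ_ T.1).hom ≫ (λ_ T.1).inv := by
  rw [Iso.eq_comp_inv]
  exact congrArg Center.Hom.f (braiding_leftUnitor T)

lemma FObj.commutes_unit {T : Center (Cx P)} (γ : T.1 ⟶ F) : (FObj.unit F).Commutes γ := by
  dsimp only [FObj.Commutes, FObj.unit]
  rw [halfBraiding_unit]
  simp

lemma FObj.commutes_ofCenter {S T : Center (Cx P)} {γ : T.1 ⟶ F} (h : IsSymm T S) :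
    (FObj.ofCenter F S).Commutes γ := by
  dsimp only [FObj.Commutes, FObj.ofCenter]
  rw [S.2.naturality, ← Category.assoc]
  exact (congrArg (· ≫ γ ▷ S.1) h).trans (Category.id_comp _)

end Unfold

section Hc

variable {B : Type u} [Category.{v} B] [Preadditive B] {P : ObjectProperty (CochainComplex B ℤ)}
  [MonoidalCategory (Cx P)] [DGMonoidal P]
variable {X Y N N' N'' M F : Cx P} {n m : ℤ} {Z A : FObj F} {L S T : Center (Cx P)}

open DGMonoidal

/-- A graded map `K : L ⊗ N ⟶ F ⊗ N'` moved past `Z`, as a graded map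
`L ⊗ (Z ⊗ N) ⟶ F ⊗ (Z ⊗ N')`. -/
def past (Z : FObj F) (L : Center (Cx P)) (K : Coch (L.1 ⊗ N) (F ⊗ N') n) :
    Coch (L.1 ⊗ (Z.obj ⊗ N)) (F ⊗ (Z.obj ⊗ N')) n :=
  pre (sw L Z.obj N).hom (post (wL Z.obj K) (act Z.c N'))

lemma past_add (K K' : Coch (L.1 ⊗ N) (F ⊗ N') n) :
    past Z L (K + K') = past Z L K + past Z L K' := by
  simp only [past, map_add, add_post, pre_add]

lemma past_sub (K K' : Coch (L.1 ⊗ N) (F ⊗ N') n) :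
    past Z L (K - K') = past Z L K - past Z L K' := by
  simp only [past, map_sub, sub_post, pre_sub]

lemma δ_past (K : Coch (L.1 ⊗ N) (F ⊗ N') m) : δ m n (past Z L K) = past Z L (δ m n K) := by
  rw [past, δ_pre, δ_post, δ_wL, past]

lemma past_coch (f : L.1 ⊗ N ⟶ F ⊗ N') :
    past Z L (coch f) = coch ((sw L Z.obj N).hom ≫ Z.obj ◁ f ≫ act Z.c N') := by
  rw [past, wL_coch, post_coch, pre_coch]

lemma past_pre_left (f : N ⟶ N'') (K : Coch (L.1 ⊗ N'') (F ⊗ N') n) :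
    past Z L (pre (L.1 ◁ f) K) = pre (L.1 ◁ Z.obj ◁ f) (past Z L K) := by
  rw [past, past, wL_pre, post_pre, pre_pre, pre_pre, sw_natural_right]

lemma past_post (K : Coch (L.1 ⊗ N) (F ⊗ N') n) (f : N' ⟶ N'') :
    past Z L (post K (F ◁ f)) = post (past Z L K) (F ◁ Z.obj ◁ f) := by
  rw [past, past, wL_post, post_post, post_pre, post_post, act_natural]

lemma past_coch_whiskerRight {γ : L.1 ⟶ F} (h : Z.Commutes γ) (N : Cx P) :
    past Z L (coch (γ ▷ N)) = coch (γ ▷ (Z.obj ⊗ N)) := by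
  rw [past_coch, h.act]

/-- A graded map `K : L ⊗ N ⟶ F ⊗ N'` moved past the central object `S`. -/
def pastCenter (S L : Center (Cx P)) (K : Coch (L.1 ⊗ N) (F ⊗ N') n) :
    Coch (L.1 ⊗ (S.1 ⊗ N)) (F ⊗ (S.1 ⊗ N')) n :=
  pre (sw L S.1 N).hom (post (wL S.1 K) (sw S F N').hom)

/-- Moving a graded map past `A` and applying `f : A ⟶ Z ⊗ S` is the same as applying `f` first and
moving the graded map past `S` and `Z`. -/
lemma past_unf {f : A.obj ⟶ Z.obj ⊗ S.1}
    (hf : FObj.IsHom A (Z.tensor (.ofCenter F S)) f) (K : Coch (L.1 ⊗ N) (F ⊗ N') n) :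
    post (past A L K) (F ◁ unf f N') =
      pre (L.1 ◁ unf f N) (past Z L (pastCenter S L K)) := by
  have h : post (wL A.obj K) (unf f (F ⊗ N')) =
      pre (unf f (L.1 ⊗ N)) (wL Z.obj (wL S.1 K)) :=
    (whiskerRight_associator_natural_graded f K).symm
  rw [past, past, pastCenter, wL_pre, wL_post, post_pre, post_post, act_c_unf hf, ← post_post, h,
    post_pre, pre_pre, ← unf_sw, post_pre, pre_pre, pre_pre, post_post, Category.assoc]

end Hc

/-! ### Eigenmaps commuting with `F` up to homotopy -/

section Transport

variable {B : Type u} [Category.{v} B] [Preadditive B] {P : ObjectProperty (CochainComplex B ℤ)}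
  [MonoidalCategory (Cx P)] [DGMonoidal P]
variable {M F : Cx P} {L D S : Center (Cx P)}

open DGMonoidal

/-- `h` is a homotopy expressing that `γ : S ⟶ F` commutes with `F`. -/
def IsCommHomotopy (γ : S.1 ⟶ F) (h : Coch (S.1 ⊗ F) (F ⊗ F) (-1)) : Prop :=
  δ (-1) 0 h = coch (γ ▷ F) - coch ((S.2.β F).hom ≫ F ◁ γ)

/-- The obstruction `h ∘ γ' + h' ∘ γ` is null-homotopic. For `h = h'` and trivial
self-braiding, this is twice the obstruction `h ∘ γ`. -/
def Unobstructed {S S' : Center (Cx P)} (γ : S.1 ⟶ F) (h : Coch (S.1 ⊗ F) (F ⊗ F) (-1))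
    (γ' : S'.1 ⟶ F) (h' : Coch (S'.1 ⊗ F) (F ⊗ F) (-1)) : Prop :=
  ∃ k : Coch (S.1 ⊗ S'.1) (F ⊗ F) (-2), δ (-2) (-1) k =
    pre (S.1 ◁ γ') h + pre ((S.2.β S'.1).hom ≫ S'.1 ◁ γ) h'

/-- The homotopy `H` between the actions of `a` and of `b ∘ V` on `M`, transported to `F ⊗ M`:
besides `F ⊗ H`, it takes the homotopies which express that `a` and `b` commute with `F`. -/
def pastF (ha : Coch (L.1 ⊗ F) (F ⊗ F) (-1)) (hb : Coch (D.1 ⊗ F) (F ⊗ F) (-1))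
    (V : L.1 ⊗ M ⟶ D.1 ⊗ M) (H : Coch (L.1 ⊗ M) (F ⊗ M) (-1)) :
    Coch (L.1 ⊗ (F ⊗ M)) (F ⊗ (F ⊗ M)) (-1) :=
  pre (sw L F M).hom (wL F H) + gact ha M -
    pre ((sw L F M).hom ≫ F ◁ V ≫ (sw D F M).inv) (gact hb M)

variable {a : L.1 ⟶ F} {b : D.1 ⟶ F} {γ : S.1 ⟶ F} {ha : Coch (L.1 ⊗ F) (F ⊗ F) (-1)}
  {hb : Coch (D.1 ⊗ F) (F ⊗ F) (-1)} {hγ : Coch (S.1 ⊗ F) (F ⊗ F) (-1)}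

lemma IsCommHomotopy.δ_gact (h : IsCommHomotopy γ hγ) (M : Cx P) :
    δ (-1) 0 (gact hγ M) = coch (γ ▷ (F ⊗ M)) - coch ((sw S F M).hom ≫ F ◁ (γ ▷ M)) := by
  rw [CatDiag.δ_gact, h, gact_sub, gact_coch, gact_coch, act_whiskerRight, act_comp,
    act_whiskerLeft]
  rfl

lemma Unobstructed.gact {S S' : Center (Cx P)} {γ : S.1 ⟶ F} {h : Coch (S.1 ⊗ F) (F ⊗ F) (-1)}
    {γ' : S'.1 ⟶ F} {h' : Coch (S'.1 ⊗ F) (F ⊗ F) (-1)} (ho : Unobstructed γ h γ' h') (M : Cx P) :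
    ∃ k : Coch (S.1 ⊗ (S'.1 ⊗ M)) (F ⊗ (F ⊗ M)) (-2), δ (-2) (-1) k =
      pre (S.1 ◁ (γ' ▷ M)) (gact h M) +
        pre ((sw S S'.1 M).hom ≫ S'.1 ◁ (γ ▷ M)) (CatDiag.gact h' M) := by
  obtain ⟨k, hk⟩ := ho
  refine ⟨CatDiag.gact k M, ?_⟩
  rw [CatDiag.δ_gact, hk, gact_add, gact_pre, gact_pre, act_whiskerLeft, act_comp,
    act_whiskerLeft]
  rfl

lemma δ_pastF (hA : IsCommHomotopy a ha) (hB : IsCommHomotopy b hb) (V : L.1 ⊗ M ⟶ D.1 ⊗ M)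
    (H : Coch (L.1 ⊗ M) (F ⊗ M) (-1)) (hH : δ (-1) 0 H = coch (a ▷ M) - coch (V ≫ b ▷ M)) :
    δ (-1) 0 (pastF ha hb V H) = coch (a ▷ (F ⊗ M)) -
      coch (((sw L F M).hom ≫ F ◁ V ≫ (sw D F M).inv) ≫ b ▷ (F ⊗ M)) := by
  rw [pastF, δ_sub, δ_add, δ_pre, δ_pre, δ_wL, hH, hA.δ_gact, hB.δ_gact, map_sub, wL_coch, wL_coch,
    pre_sub, pre_sub, pre_coch, pre_coch, pre_coch, pre_coch]
  simp only [Category.assoc, MonoidalCategory.whiskerLeft_comp, Iso.inv_hom_id_assoc]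
  abel

/-- If the obstructions vanish, then the transported homotopy is compatible with `γ : S ⟶ F` up to
a homotopy of homotopies. -/
lemma exists_pastF_homotopy
    (hC : IsCommHomotopy γ hγ) (oa : Unobstructed a ha γ hγ) (ob : Unobstructed b hb γ hγ)
    (V : L.1 ⊗ M ⟶ D.1 ⊗ M)
    (H : Coch (L.1 ⊗ M) (F ⊗ M) (-1)) (hH : δ (-1) 0 H = coch (a ▷ M) - coch (V ≫ b ▷ M)) :
    ∃ k : Coch (L.1 ⊗ (S.1 ⊗ M)) (F ⊗ (F ⊗ M)) (-2), δ (-2) (-1) k =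
      pre (L.1 ◁ (γ ▷ M)) (pastF ha hb V H) - post (pastCenter S L H) (F ◁ (γ ▷ M)) := by
  obtain ⟨ka, hka⟩ := oa.gact M
  obtain ⟨kb, hkb⟩ := ob.gact M
  -- `F ⊗ H` and `H` are compared by the product of `H` with `hγ`; the remaining terms of the
  -- boundary of this product complete the compositions with `ha` and `hb` to the two obstructions.
  have hX : δ (-2) (-1) ((wL S.1 H).comp (gact hγ M) (show -1 + -1 = -2 by norm_num)) =
      pre (γ ▷ (L.1 ⊗ M)) (wL F H) - post (post (wL S.1 H) (sw S F M).hom) (F ◁ (γ ▷ M)) -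
        pre (S.1 ◁ (a ▷ M)) (gact hγ M) + pre (S.1 ◁ (V ≫ b ▷ M)) (gact hγ M) := by
    rw [δ_comp _ _ _ 0 0 (-1) (by norm_num) (by norm_num) (by norm_num), hC.δ_gact, δ_wL, hH,
      map_sub, wL_coch, wL_coch, Cochain.comp_sub, Cochain.sub_comp, pre_wL_exchange, post_post]
    simp only [Int.negOnePow_neg, Int.negOnePow_one, Units.neg_smul, one_smul]
    change post _ _ - post _ _ + -(pre _ _ - pre _ _) = _
    abel
  have e1 : L.1 ◁ (γ ▷ M) ≫ (sw L F M).hom = (sw L S.1 M).hom ≫ γ ▷ (L.1 ⊗ M) :=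
    sw_natural_left L γ M
  have e2 : L.1 ◁ (γ ▷ M) ≫ (sw L F M).hom ≫ F ◁ V ≫ (sw D F M).inv =
      ((sw L S.1 M).hom ≫ S.1 ◁ V ≫ (sw D S.1 M).inv) ≫ D.1 ◁ (γ ▷ M) := by
    have : γ ▷ (D.1 ⊗ M) ≫ (sw D F M).inv = (sw D S.1 M).inv ≫ D.1 ◁ (γ ▷ M) := by
      rw [Iso.eq_inv_comp, ← reassoc_of% sw_natural_left, Iso.hom_inv_id, Category.comp_id]
    rw [reassoc_of% e1, ← whisker_exchange_assoc, this]
    simp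
  refine ⟨pre (sw L S.1 M).hom ((wL S.1 H).comp (gact hγ M) (show -1 + -1 = -2 by norm_num)) + ka -
    pre ((sw L S.1 M).hom ≫ S.1 ◁ V ≫ (sw D S.1 M).inv) kb, ?_⟩
  rw [δ_sub, δ_add, δ_pre, δ_pre, hX, hka, hkb]
  simp only [pastF, pastCenter, pre_add, pre_sub, pre_pre, e1, e2, post_pre, Category.assoc,
    MonoidalCategory.whiskerLeft_comp, Iso.inv_hom_id_assoc]
  abel

end Transport

/-! ### Transporting quotients of eigenmaps through cones -/

section ConeTransport

variable {B : Type u} [Category.{v} B] [Preadditive B] {P : ObjectProperty (CochainComplex B ℤ)}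
  [MonoidalCategory (Cx P)] [DGMonoidal P]
variable {M M' F : Cx P} {L D S : Center (Cx P)}

open DGMonoidal

lemma sub_unf {A Z X Y : Cx P} (f : A ⟶ Z ⊗ X) (g : A ⟶ Z ⊗ Y) (a : X ⟶ F) (b : Y ⟶ F) (N : Cx P) :
    unf (f ≫ Z ◁ a - g ≫ Z ◁ b) N = unf f N ≫ Z ◁ (a ▷ N) - unf g N ≫ Z ◁ (b ▷ N) := by
  rw [unf, sub_whiskerRight', Preadditive.sub_comp]
  simp [unf]

namespace ConeData

variable {A G C X Y Z : Cx P}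

/-- The cone structure of `C ⊗ M`, where `C` is a cone of a map `φ : A ⟶ Z ⊗ F`, with the tensor
product `Z ⊗ (F ⊗ M)` nested to the right. -/
def nest {φ : A ⟶ Z ⊗ F} (K : ConeData φ C) (M : Cx P) : ConeData (unf φ M) (C ⊗ M) :=
  (K.tensorRight M).ofIso (Iso.refl _) (α_ Z F M) (by simp [unf])

lemma nest_fst {φ : A ⟶ Z ⊗ F} (K : ConeData φ C) (M : Cx P) :
    (K.nest M).fst = wR M K.fst := post_id _

lemma nest_snd {φ : A ⟶ Z ⊗ F} (K : ConeData φ C) (M : Cx P) :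
    (K.nest M).snd = post (wR M K.snd) (α_ Z F M).hom := rfl

lemma isDiag_whiskerRight {φ : A ⟶ G} (K : ConeData φ C) (γ : X ⟶ Y) :
    IsDiag (K.tensorLeft X) (K.tensorLeft Y) (γ ▷ C) (γ ▷ A) (γ ▷ G) :=
  ⟨pre_wL_exchange γ K.fst, pre_wL_exchange γ K.snd⟩

lemma isDiag_nest_whiskerLeft {φ : A ⟶ Z ⊗ F} (K : ConeData φ C) (f : M ⟶ M') :
    IsDiag (K.nest M) (K.nest M') (C ◁ f) (A ◁ f) (Z ◁ F ◁ f) where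
  fst := by rw [nest_fst, nest_fst, pre_wR_exchange]
  snd := by
    rw [nest_snd, nest_snd, ← post_pre, pre_wR_exchange, post_post, post_post]
    simp

lemma isDiag_nest_sw (hS : IsGradedCentral S) {φ : A ⟶ Z ⊗ F} (K : ConeData φ C) (M : Cx P) :
    IsDiag ((K.nest M).tensorLeft S.1) (K.nest (S.1 ⊗ M)) (sw S C M).hom (sw S A M).hom
      (sw S Z (F ⊗ M) ≪≫ whiskerLeftIso Z (sw S F M)).hom where
  fst := by
    change _ = post (wL S.1 (K.nest M).fst) _
    rw [nest_fst, nest_fst, sw_natural_left_graded hS]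
  snd := by
    change _ = post (wL S.1 (K.nest M).snd) _
    rw [nest_snd, nest_snd, ← post_pre, ← sw_natural_left_graded hS, sw_tensor, wL_post, post_post,
      post_post]
    simp

omit [MonoidalCategory (Cx P)] [DGMonoidal P] in
lemma IsDiag.inv {A' G' C' : Cx P} {φ : A ⟶ G} {φ' : A' ⟶ G'} {K : ConeData φ C}
    {K' : ConeData φ' C'} {D : C ≅ C'} {f : A ≅ A'} {g : G ≅ G'}
    (h : IsDiag K K' D.hom f.hom g.hom) : IsDiag K' K D.inv f.inv g.inv where
  fst := by
    rw [eq_comm, ← pre_eq_iff, ← post_pre, h.fst, post_post, Iso.hom_inv_id, post_id]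
  snd := by
    rw [eq_comm, ← pre_eq_iff, ← post_pre, h.snd, post_post, Iso.hom_inv_id, post_id]

end ConeData

/-- Up to homotopy, the action of `a : L ⟶ F` on `M` is the composition of `V` with the action of
`b : D ⟶ F`. -/
def FactorsThrough (a : L.1 ⟶ F) (b : D.1 ⟶ F) (M : Cx P) (V : L.1 ⊗ M ⟶ D.1 ⊗ M) : Prop :=
  ∃ H : Coch (L.1 ⊗ M) (F ⊗ M) (-1), δ (-1) 0 H = coch (a ▷ M) - coch (V ≫ b ▷ M)

variable {a : L.1 ⟶ F} {b : D.1 ⟶ F} {ha : Coch (L.1 ⊗ F) (F ⊗ F) (-1)}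
  {hb : Coch (D.1 ⊗ F) (F ⊗ F) (-1)}

lemma past_coch_comp {Z : FObj F} (hb : Z.Commutes b) {X Y : Cx P} (V : L.1 ⊗ X ⟶ D.1 ⊗ Y) :
    past Z L (coch (V ≫ b ▷ Y)) =
      coch (((sw L Z.obj X).hom ≫ Z.obj ◁ V ≫ (sw D Z.obj Y).inv) ≫ b ▷ (Z.obj ⊗ Y)) := by
  rw [past_coch, ← hb.act]
  simp

/-- The relation `a ≃ b ∘ V` on `M` is inherited by `C ⊗ M`, where `C` is the cone of a
difference of two maps induced by `γ₁` and `γ₂`, if the obstructions vanish. -/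
theorem FactorsThrough.past_cone {A Z : FObj F} {S₁ S₂ : Center (Cx P)}
    {f₁ : A.obj ⟶ Z.obj ⊗ S₁.1} {f₂ : A.obj ⟶ Z.obj ⊗ S₂.1} {γ₁ : S₁.1 ⟶ F} {γ₂ : S₂.1 ⟶ F}
    {h₁ : Coch (S₁.1 ⊗ F) (F ⊗ F) (-1)} {h₂ : Coch (S₂.1 ⊗ F) (F ⊗ F) (-1)} {C : Cx P}
    (K : ConeData (f₁ ≫ Z.obj ◁ γ₁ - f₂ ≫ Z.obj ◁ γ₂) C)
    (hf₁ : FObj.IsHom A (Z.tensor (.ofCenter F S₁)) f₁)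
    (hf₂ : FObj.IsHom A (Z.tensor (.ofCenter F S₂)) f₂)
    (hL : IsGradedCentral L) (hD : IsGradedCentral D)
    (hAa : A.Commutes a) (hAb : A.Commutes b) (hZa : Z.Commutes a) (hZb : Z.Commutes b)
    (ca : IsCommHomotopy a ha) (cb : IsCommHomotopy b hb)
    (c₁ : IsCommHomotopy γ₁ h₁) (c₂ : IsCommHomotopy γ₂ h₂)
    (oa₁ : Unobstructed a ha γ₁ h₁) (ob₁ : Unobstructed b hb γ₁ h₁)
    (oa₂ : Unobstructed a ha γ₂ h₂) (ob₂ : Unobstructed b hb γ₂ h₂)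
    {V : L.1 ⊗ M ⟶ D.1 ⊗ M} (hM : FactorsThrough a b M V) :
    FactorsThrough a b (C ⊗ M) ((sw L C M).hom ≫ C ◁ V ≫ (sw D C M).inv) := by
  obtain ⟨H, hH⟩ := hM
  obtain ⟨k₁, hk₁⟩ := exists_pastF_homotopy c₁ oa₁ ob₁ V H hH
  obtain ⟨k₂, hk₂⟩ := exists_pastF_homotopy c₂ oa₂ ob₂ V H hH
  have h := (((K.isDiag_nest_sw hL M).comp ((K.isDiag_nest_whiskerLeft V).comp
    (K.isDiag_nest_sw hD M).inv)).comp ((K.nest M).isDiag_whiskerRight b))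
  have h := ((K.nest M).isDiag_whiskerRight a).sub h
  -- The homotopies on `A ⊗ M` and `Z ⊗ (F ⊗ M)` come from `H`; they are compatible with the map of
  -- which `C` is the cone up to the corner entry, which comes from the obstructions.
  obtain ⟨H', hH'⟩ := h.nullHomotopic 0 (past A L H) (past Z L (pastF ha hb V H))
    (-(pre (L.1 ◁ unf f₁ M) (past Z L k₁) - pre (L.1 ◁ unf f₂ M) (past Z L k₂))) (by
      rw [δ_past, hH, past_sub, past_coch_whiskerRight hAa, past_coch_comp hAb, comp_zero,
        coch_zero, zero_add, coch_sub]) (by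
      rw [δ_past, δ_pastF ca cb V H hH, past_sub, past_coch_whiskerRight hZa, past_coch_comp hZb,
        zero_comp, coch_zero, zero_add, coch_sub]
      simp) (by
      rw [δ_neg, δ_sub, δ_pre, δ_pre, δ_past, δ_past, hk₁, hk₂, sub_unf]
      simp only [past_sub, past_pre_left, past_post, pre_sub, ← post_post, post_sub, sub_pre,
        MonoidalCategory.whiskerLeft_comp, whiskerLeft_sub', past_unf hf₁, past_unf hf₂, pre_pre,
        post_pre]
      abel)
  exact ⟨H', hH'.trans (coch_sub _ _)⟩

omit [DGMonoidal P] in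
lemma act_sw_of_isSelfTrivial {Z : FObj F} {U : L.1 ⊗ Z.obj ⟶ D.1 ⊗ Z.obj} (hLL : IsSelfTrivial L)
    (N : Cx P) :
    L.1 ◁ act U N ≫ (sw L D.1 (Z.obj ⊗ N)).hom ≫ D.1 ◁ (sw L Z.obj N).hom =
      L.1 ◁ (sw L Z.obj N).hom ≫ act U (L.1 ⊗ N) := by
  rw [sw_act, hLL.sw, Category.id_comp]

lemma past_sw {Z : FObj F} {n : ℤ} {N : Cx P} (hLD : IsSymm L D)
    (K : Coch (L.1 ⊗ (D.1 ⊗ M)) (F ⊗ N) n) :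
    pre ((sw L D.1 (Z.obj ⊗ M)).hom ≫ D.1 ◁ (sw L Z.obj M).hom)
      (past Z D (pre (sw D L.1 M).hom K)) = pre (L.1 ◁ (sw D Z.obj M).hom) (past Z L K) := by
  have h : ((sw L D.1 (Z.obj ⊗ M)).hom ≫ D.1 ◁ (sw L Z.obj M).hom) ≫
      (sw D Z.obj (L.1 ⊗ M)).hom ≫ Z.obj ◁ (sw D L.1 M).hom =
        L.1 ◁ (sw D Z.obj M).hom ≫ (sw L Z.obj (D.1 ⊗ M)).hom := by
    rw [Category.assoc, sw_sw D L, reassoc_of% hLD.sw_sw]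
  rw [past, past, wL_pre, post_pre, pre_pre, pre_pre, pre_pre, Category.assoc _ _ (Z.obj ◁ _), h]

/-- On the cone `C` of `e ≫ (a - U ≫ b)`, where `e : A ≅ L ⊗ (Z ⊗ M)`, the action of `a` is, up to
homotopy, the composition of the action of `b` with the map `V` induced by `U`, if the
obstructions vanish. The main part of the homotopy is the map `L ⊗ (Z ⊗ (F ⊗ M)) ⟶ F ⊗ A` moving `F`
to the left: since `φ` is the difference of the actions of `a` and of `b ∘ U`, composing it with
`φ` gives the required difference on `A`, and also on `Z ⊗ (F ⊗ M)`, there up to the homotopies `ha`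
and `hb`. -/
theorem factorsThrough_cone {Z : FObj F} {A C : Cx P} (e : A ≅ L.1 ⊗ (Z.obj ⊗ M))
    {U : L.1 ⊗ Z.obj ⟶ D.1 ⊗ Z.obj}
    (hU : FObj.IsHom ((FObj.ofCenter F L).tensor Z) ((FObj.ofCenter F D).tensor Z) U)
    {φ : A ⟶ Z.obj ⊗ (F ⊗ M)} (hφ : φ = e.hom ≫ ((sw L Z.obj M).hom ≫ Z.obj ◁ (a ▷ M) -
      act U M ≫ (sw D Z.obj M).hom ≫ Z.obj ◁ (b ▷ M)))
    (K : ConeData φ C) (hLL : IsSelfTrivial L) (hLD : IsSymm L D)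
    (hZa : Z.Commutes a) (hZb : Z.Commutes b)
    (ca : IsCommHomotopy a ha) (cb : IsCommHomotopy b hb)
    (oaa : ∃ k : Coch (L.1 ⊗ L.1) (F ⊗ F) (-2), δ (-2) (-1) k = pre (L.1 ◁ a) ha)
    (obb : ∃ k : Coch (D.1 ⊗ D.1) (F ⊗ F) (-2), δ (-2) (-1) k = pre (D.1 ◁ b) hb)
    (oba : Unobstructed b hb a ha)
    {V : L.1 ⊗ C ⟶ D.1 ⊗ C} {VA : L.1 ⊗ A ⟶ D.1 ⊗ A}
    (hV : ConeData.IsDiag (K.tensorLeft L.1) (K.tensorLeft D.1) V VA (act U (F ⊗ M)))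
    (hVA : VA ≫ D.1 ◁ e.hom = L.1 ◁ e.hom ≫ L.1 ◁ act U M ≫ (sw L D.1 (Z.obj ⊗ M)).hom) :
    FactorsThrough a b C V := by
  obtain ⟨kaa, hkaa⟩ := oaa
  obtain ⟨kbb, hkbb⟩ := obb
  obtain ⟨kba, hkba⟩ := oba.gact M
  have h := (K.isDiag_whiskerRight a).sub (hV.comp (K.isDiag_whiskerRight b))
  have hcomm := act_sw_of_isSelfTrivial (Z := Z) (U := U) hLL M
  -- The null-homotopies of the self-obstructions of `a` and `b`, tensored with `M`.
  have hkaa' : δ (-2) (-1) (gact kaa M) = pre (L.1 ◁ (a ▷ M)) (gact ha M) := by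
    rw [δ_gact, hkaa, gact_pre, act_whiskerLeft]
  have hkbb' : δ (-2) (-1) (gact kbb M) = pre (D.1 ◁ (b ▷ M)) (gact hb M) := by
    rw [δ_gact, hkbb, gact_pre, act_whiskerLeft]
  set E : L.1 ⊗ (Z.obj ⊗ (F ⊗ M)) ⟶ F ⊗ A :=
    L.1 ◁ act Z.c M ≫ (sw L F (Z.obj ⊗ M)).hom ≫ F ◁ e.inv with hE
  have hA : a ▷ A - VA ≫ b ▷ A = L.1 ◁ φ ≫ E := by
    have e1 : L.1 ◁ φ ≫ L.1 ◁ act Z.c M = L.1 ◁ e.hom ≫ (L.1 ◁ (a ▷ (Z.obj ⊗ M)) -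
        L.1 ◁ act U M ≫ L.1 ◁ (b ▷ (Z.obj ⊗ M))) := by
      rw [← MonoidalCategory.whiskerLeft_comp, hφ, Category.assoc, Preadditive.sub_comp,
        Category.assoc, hZa.act, Category.assoc, Category.assoc, hZb.act,
        MonoidalCategory.whiskerLeft_comp, whiskerLeft_sub', MonoidalCategory.whiskerLeft_comp]
    have e2 (X : Cx P) (f : X ⟶ F) (Y : Cx P) :
        L.1 ◁ (f ▷ Y) ≫ (sw L F Y).hom = (sw L X Y).hom ≫ f ▷ (L.1 ⊗ Y) := sw_natural_left L f Y
    rw [hE, reassoc_of% e1]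
    simp only [Preadditive.comp_sub, Preadditive.sub_comp, Category.assoc,
      reassoc_of% sw_natural_left]
    rw [hLL.sw, Category.id_comp, ← whisker_exchange, ← whisker_exchange, ← reassoc_of% hVA]
    simp [← MonoidalCategory.whiskerLeft_comp_assoc]
  have hG1 : E ≫ F ◁ φ = (sw L Z.obj (F ⊗ M)).hom ≫ Z.obj ◁ ((sw L F M).hom ≫ F ◁ (a ▷ M)) ≫
      act Z.c (F ⊗ M) - act U (F ⊗ M) ≫ (sw D Z.obj (F ⊗ M)).hom ≫
        Z.obj ◁ ((sw D F M).hom ≫ F ◁ (b ▷ M)) ≫ act Z.c (F ⊗ M) := by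
    have e3 (T : Center (Cx P)) : T.1 ◁ act Z.c M ≫ (sw T F (Z.obj ⊗ M)).hom ≫
        F ◁ (sw T Z.obj M).hom = (sw T Z.obj (F ⊗ M)).hom ≫ Z.obj ◁ (sw T F M).hom ≫
          act Z.c (T.1 ⊗ M) := sw_act T Z.c M
    have e4 := act_c_act hU M
    rw [hE, hφ]
    simp only [MonoidalCategory.whiskerLeft_comp, Category.assoc, whiskerLeft_sub']
    rw [← MonoidalCategory.whiskerLeft_comp_assoc, Iso.inv_hom_id]
    simp only [MonoidalCategory.whiskerLeft_id, Category.id_comp, Preadditive.comp_sub]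
    rw [reassoc_of% (e3 L), ← reassoc_of% e4, reassoc_of% (e3 D), ← act_natural, ← act_natural]
  have hG : coch (a ▷ (Z.obj ⊗ (F ⊗ M)) - act U (F ⊗ M) ≫ b ▷ (Z.obj ⊗ (F ⊗ M))) =
      coch (E ≫ F ◁ φ) + δ (-1) 0 (past Z L (gact ha M) -
        pre (act U (F ⊗ M)) (past Z D (gact hb M))) := by
    rw [δ_sub, δ_pre, δ_past, δ_past, ca.δ_gact, cb.δ_gact, past_sub, past_sub,
      past_coch_whiskerRight hZa, past_coch_whiskerRight hZb, past_coch, past_coch, pre_sub,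
      pre_coch, pre_coch, hG1, coch_sub, coch_sub]
    abel
  -- Composing the homotopy on `Z ⊗ (F ⊗ M)` with `φ` gives four terms. Two of them are the
  -- self-obstructions of `a` and `b`; the two mixed ones combine to the obstruction of `b` and `a`.
  obtain ⟨H', hH'⟩ := h.nullHomotopic E 0 _
    (-(pre (L.1 ◁ e.hom ≫ L.1 ◁ (sw L Z.obj M).hom) (past Z L (gact kaa M)) +
      pre (L.1 ◁ e.hom ≫ L.1 ◁ act U M ≫ L.1 ◁ (sw D Z.obj M).hom ≫ act U (D.1 ⊗ M))
        (past Z D (gact kbb M)) -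
      pre (L.1 ◁ e.hom ≫ L.1 ◁ act U M) (pre ((sw L D.1 (Z.obj ⊗ M)).hom ≫
        D.1 ◁ (sw L Z.obj M).hom) (past Z D kba)))) (by rw [hA, δ_zero, add_zero]) hG (by
      have e6 {X Y : Cx P} (f : X ⟶ Y) : L.1 ◁ (Z.obj ◁ f) ≫ act U Y =
        act U X ≫ D.1 ◁ (Z.obj ◁ f) := (act_natural U f).symm
      rw [δ_neg, δ_sub, δ_add, δ_pre, δ_pre, δ_pre, δ_pre, δ_past, δ_past, δ_past, hkaa', hkbb',
        hkba, zero_post, past_add, pre_add, ← pre_pre _ _ (gact ha M), past_sw hLD, hφ]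
      simp only [MonoidalCategory.whiskerLeft_comp, whiskerLeft_sub', pre_sub, sub_pre,
        past_pre_left, pre_pre, Category.assoc, Preadditive.comp_sub, Preadditive.sub_comp, pre_add,
        e6]
      rw [reassoc_of% hcomm]
      abel)
  exact ⟨H', hH'.trans (coch_sub _ _)⟩

end ConeTransport

/-! ### The object `𝟙[u]` -/

section Series

variable {B : Type u} [Category.{v} B] [Preadditive B] {P : ObjectProperty (CochainComplex B ℤ)}
  [MonoidalCategory (Cx P)]

/-- The object `𝟙[u]`, for `u` of degree `S`, with the multiplication and the division by `u`. The
tensor powers of `S` are given by the objects `pow k` with isomorphisms `S ⊗ pow k ≅ pow (k + 1)`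
and `𝟙 ≅ pow 0`. -/
structure Series (S : Center (Cx P)) where
  /-- the object `𝟙[u]` -/
  obj : Cx P
  /-- the tensor powers of `S` -/
  pow : ℕ → Cx P
  /-- the isomorphism between `𝟙` and the power with exponent `0` -/
  zero : 𝟙_ (Cx P) ≅ pow 0
  /-- the isomorphism between `S ⊗ Sᵏ` and the next power of `S` -/
  succ (k : ℕ) : S.1 ⊗ pow k ≅ pow (k + 1)
  /-- the injection of the summand `uᵏ` -/
  ι (k : ℕ) : pow k ⟶ obj
  /-- the projection to the summand `uᵏ` -/
  π (k : ℕ) : obj ⟶ pow k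
  isBisum_tensor (X Y : Cx P) : IsBisum (fun k => X ◁ (ι k ▷ Y)) (fun k => X ◁ (π k ▷ Y))
  /-- multiplication by `u` -/
  mulU : S.1 ⊗ obj ⟶ obj
  /-- division by `u` -/
  divU : obj ⟶ S.1 ⊗ obj
  ι_mulU (k : ℕ) : S.1 ◁ ι k ≫ mulU = (succ k).hom ≫ ι (k + 1)
  mulU_π_zero : mulU ≫ π 0 = 0
  mulU_π (k : ℕ) : mulU ≫ π (k + 1) = S.1 ◁ π k ≫ (succ k).hom
  ι_zero_divU : ι 0 ≫ divU = 0
  ι_divU (k : ℕ) : ι (k + 1) ≫ divU = (succ k).inv ≫ S.1 ◁ ι k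

namespace Series

variable {S : Center (Cx P)} (R : Series S) {F : Cx P}

lemma isBisum_whiskerRight (Y : Cx P) :
    IsBisum (fun k => R.ι k ▷ Y) (fun k => R.π k ▷ Y) :=
  (R.isBisum_tensor (𝟙_ _) Y).of_iso (λ_ _) (fun _ => λ_ _) (fun k => by simp) (fun k => by simp)

lemma isBisum_whiskerLeft (X : Cx P) :
    IsBisum (fun k => X ◁ R.ι k) (fun k => X ◁ R.π k) :=
  (R.isBisum_tensor X (𝟙_ _)).of_iso (whiskerLeftIso X (ρ_ _)) (fun _ => whiskerLeftIso X (ρ_ _))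
    (fun k => by simp only [whiskerLeftIso_hom, whiskerLeftIso_inv]; monoidal)
    (fun k => by simp only [whiskerLeftIso_hom, whiskerLeftIso_inv]; monoidal)

variable (F) in
/-- The map moving `F` past a tensor power of `S`. -/
def powC : (k : ℕ) → (R.pow k ⊗ F ⟶ F ⊗ R.pow k)
  | 0 => R.zero.inv ▷ F ≫ (FObj.unit F).c ≫ F ◁ R.zero.hom
  | k + 1 => (R.succ k).inv ▷ F ≫ ((FObj.ofCenter F S).tensor ⟨R.pow k, powC k⟩).c ≫
      F ◁ (R.succ k).hom

variable (F) in
/-- The tensor powers of `S` commute with `F`. -/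
abbrev powF (k : ℕ) : FObj F := ⟨R.pow k, R.powC F k⟩

variable (F) in
/-- The map moving `F` past `𝟙[u]`, which is diagonal with respect to the powers of `u`. -/
def c : R.obj ⊗ F ⟶ F ⊗ R.obj :=
  (R.isBisum_whiskerRight F).desc fun k => R.powC F k ≫ F ◁ R.ι k

variable (F) in
/-- The object `𝟙[u]` commutes with `F`, since the powers of `u` do. -/
abbrev fobj : FObj F := ⟨R.obj, R.c F⟩

lemma isHom_zero : FObj.IsHom (FObj.unit F) (R.powF F 0) R.zero.hom := by
  simp [FObj.IsHom, powC, ← comp_whiskerRight_assoc]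

lemma isHom_succ (k : ℕ) :
    FObj.IsHom ((FObj.ofCenter F S).tensor (R.powF F k)) (R.powF F (k + 1)) (R.succ k).hom := by
  dsimp only [FObj.IsHom, powC]
  rw [← comp_whiskerRight_assoc, Iso.hom_inv_id]
  simp

lemma isHom_ι (k : ℕ) : FObj.IsHom (R.powF F k) (R.fobj F) (R.ι k) := by
  dsimp only [FObj.IsHom]
  rw [c]
  exact ((R.isBisum_whiskerRight F).ι_desc (fun k => R.powC F k ≫ F ◁ R.ι k) k).symm

/-- Multiplication by `u` commutes with moving `F` past `𝟙[u]`, as can be seen on the summands. -/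
lemma isHom_mulU :
    FObj.IsHom ((FObj.ofCenter F S).tensor (R.fobj F)) (R.fobj F) R.mulU := by
  have hb : IsBisum (fun k => (S.1 ◁ R.ι k) ▷ F) (fun k => (S.1 ◁ R.π k) ▷ F) :=
    (R.isBisum_tensor S.1 F).of_iso (α_ _ _ _).symm (fun _ => (α_ _ _ _).symm)
      (fun k => by simp) (fun k => by simp)
  refine hb.hom_ext_ι fun k => ?_
  have h1 : _ = _ := (R.isHom_ι (F := F) k).whiskerLeft (FObj.ofCenter F S)
  have h2 : _ = _ := (R.isHom_succ (F := F) k).comp (R.isHom_ι (k + 1))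
  rw [← R.ι_mulU, MonoidalCategory.whiskerLeft_comp, comp_whiskerRight] at h2
  have h1' := congrArg (· ≫ F ◁ R.mulU) h1
  dsimp only [FObj.IsHom, FObj.tensor, FObj.ofCenter] at h1' h2 ⊢
  simp only [Category.assoc] at h1' h2 ⊢
  rw [← h2, ← h1']

lemma isHom_divU [DGMonoidal P] :
    FObj.IsHom (R.fobj F) ((FObj.ofCenter F S).tensor (R.fobj F)) R.divU := by
  refine (R.isBisum_whiskerRight F).hom_ext_ι fun k => ?_
  have h2 : _ = _ := R.isHom_ι (F := F) k
  rw [← reassoc_of% h2, ← comp_whiskerRight_assoc, ← MonoidalCategory.whiskerLeft_comp]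
  cases k with
  | zero =>
    rw [ι_zero_divU]
    rw [whiskerLeft_zero', zero_whiskerRight', zero_comp, comp_zero]
  | succ k =>
    have h1 : _ = _ := (FObj.IsHom.inv (R.isHom_succ (F := F) k)).comp
      ((R.isHom_ι k).whiskerLeft (FObj.ofCenter F S))
    rw [ι_divU, h1]

/-- A scalar `T` which is symmetric with `S` may be moved through `γ : T ⟶ F` past the powers of
`S`, and hence past `𝟙[u]`. -/
lemma powF_commutes {T : Center (Cx P)} (h : IsSymm T S) (γ : T.1 ⟶ F) (k : ℕ) :
    (R.powF F k).Commutes γ := by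
  induction k with
  | zero => exact (FObj.commutes_unit γ).of_isHom R.zero R.isHom_zero
  | succ k ih => exact ((FObj.commutes_ofCenter h).tensor ih).of_isHom (R.succ k) (R.isHom_succ k)

lemma commutes {T : Center (Cx P)} (h : IsSymm T S) (γ : T.1 ⟶ F) :
    (R.fobj F).Commutes γ := by
  refine (R.isBisum_whiskerLeft T.1).hom_ext_ι fun k => ?_
  have h1 : _ = _ := R.powF_commutes h γ k
  have h2 : _ = _ := R.isHom_ι (F := F) k
  dsimp only at h1 h2 ⊢
  rw [whisker_exchange, ← h1, T.2.naturality_assoc, ← whisker_exchange_assoc]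
  simp only [Category.assoc]
  rw [h2]

end Series

end Series

section SmallLemmas

variable {B : Type u} [Category.{v} B] [Preadditive B] {P : ObjectProperty (CochainComplex B ℤ)}
  [MonoidalCategory (Cx P)] [DGMonoidal P] {K : Type w} [Category.{w'} K] [MonoidalCategory K]
  {ρ : K ⥤ Center (Cx P)} {s : K}

/-- The object `𝟙[u]` of a small scalar. -/
def Small.series (Γ : Small ρ s) : Series (ρ.obj s) where
  obj := Γ.obj
  pow := scPow ρ s
  zero := Iso.refl _
  succ _ := Iso.refl _
  ι := Γ.ι
  π := Γ.π
  isBisum_tensor := Γ.isBisum_tensor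
  mulU := Γ.mulU
  divU := Γ.divU
  ι_mulU k := by
    refine Γ.isBisum.hom_ext_π fun l => ?_
    have h := Γ.isBisum.lift_π (fun k => match k with
      | 0 => (0 : (ρ.obj s).1 ⊗ Γ.obj ⟶ _)
      | k + 1 => (ρ.obj s).1 ◁ Γ.π k) l
    refine (Category.assoc _ _ _).trans ((congrArg _ h).trans ?_)
    refine Eq.trans ?_ (congrArg (· ≫ Γ.π l) (Category.id_comp (Γ.ι (k + 1)))).symm
    cases l with
    | zero => exact comp_zero.trans (Γ.isBisum.ι_π_ne (k + 1) 0 (by simp)).symm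
    | succ l =>
      refine (MonoidalCategory.whiskerLeft_comp _ _ _).symm.trans ?_
      by_cases e : k = l
      · subst e
        exact (congrArg _ (Γ.isBisum.ι_π_self k)).trans
          ((MonoidalCategory.whiskerLeft_id _ _).trans (Γ.isBisum.ι_π_self (k + 1)).symm)
      · exact (congrArg _ (Γ.isBisum.ι_π_ne k l e)).trans
          (whiskerLeft_zero'.trans (Γ.isBisum.ι_π_ne (k + 1) (l + 1) (by simpa using e)).symm)
  mulU_π_zero := Γ.isBisum.lift_π _ 0
  mulU_π k := (Γ.isBisum.lift_π _ (k + 1)).trans (Category.comp_id _).symm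
  ι_zero_divU := Γ.isBisum.ι_desc _ 0
  ι_divU k := (Γ.isBisum.ι_desc _ (k + 1)).trans (Category.id_comp _).symm

end SmallLemmas

/-! ### Zigzag maps that are homotopy equivalences -/

section Contractible

variable {B : Type u} [Category.{v} B] [Preadditive B] {P : ObjectProperty (CochainComplex B ℤ)}
  [MonoidalCategory (Cx P)] [DGMonoidal P]
variable {X Y V W Z G : Cx P} {S T : Center (Cx P)}

/-- `f` becomes a homotopy equivalence after tensoring with `X` on the left and with `Y` on the
right. -/
def IsHEquivAt (X Y : Cx P) (f : V ⟶ W) : Prop := IsHEquiv (X ◁ (f ▷ Y))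

omit [DGMonoidal P] in
lemma IsHEquivAt.comp_iso {f : V ⟶ W} (h : IsHEquivAt X Y f) (g : Z ⟶ V) [IsIso g] :
    IsHEquivAt X Y (g ≫ f) := by
  rw [IsHEquivAt, comp_whiskerRight, MonoidalCategory.whiskerLeft_comp]
  exact (IsHEquiv.of_isIso _).comp h

lemma IsHEquivAt.neg {f : V ⟶ W} (h : IsHEquivAt X Y f) : IsHEquivAt X Y (-f) := by
  rw [IsHEquivAt, neg_whiskerRight', whiskerLeft_neg']
  exact IsHEquiv.neg h

lemma IsHEquivAt.whiskerLeft {f : V ⟶ W} (h : IsHEquivAt X Y f) (T : Center (Cx P)) :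
    IsHEquivAt X Y (T.1 ◁ f) := by
  have e : X ◁ ((T.1 ◁ f) ▷ Y) = (X ◁ (α_ T.1 V Y).hom ≫ (sw T X (V ⊗ Y)).inv) ≫
      T.1 ◁ (X ◁ (f ▷ Y)) ≫ (sw T X (W ⊗ Y)).hom ≫ X ◁ (α_ T.1 W Y).inv := by
    rw [reassoc_of% sw_natural_right, Category.assoc, Iso.inv_hom_id_assoc,
      ← MonoidalCategory.whiskerLeft_comp, ← MonoidalCategory.whiskerLeft_comp]
    simp
  rw [IsHEquivAt, e]
  exact (IsHEquiv.of_isIso _).comp ((IsHEquiv.whiskerLeft h T.1).comp (IsHEquiv.of_isIso _))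

omit [DGMonoidal P] in
lemma IsHEquivAt.unit_whiskerLeft {f : V ⟶ W} (h : IsHEquivAt X Y f) :
    IsHEquivAt X Y (𝟙_ _ ◁ f) := by
  have e : X ◁ ((𝟙_ _ ◁ f) ▷ Y) = X ◁ ((λ_ V).hom ▷ Y) ≫ X ◁ (f ▷ Y) ≫ X ◁ ((λ_ W).inv ▷ Y) := by
    monoidal
  rw [IsHEquivAt, e]
  exact (IsHEquiv.of_isIso _).comp (IsHEquiv.comp h (IsHEquiv.of_isIso _))

omit [DGMonoidal P] in
lemma IsHEquivAt.iso_whiskerLeft {f : V ⟶ W} (e : Z ≅ G) (h : IsHEquivAt X Y (Z ◁ f)) :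
    IsHEquivAt X Y (G ◁ f) := by
  have e : X ◁ ((G ◁ f) ▷ Y) = X ◁ (e.inv ▷ V ▷ Y) ≫ X ◁ ((Z ◁ f) ▷ Y) ≫ X ◁ (e.hom ▷ W ▷ Y) := by
    simp only [← MonoidalCategory.whiskerLeft_comp, ← comp_whiskerRight, whisker_exchange]
    rw [← comp_whiskerRight_assoc]
    simp
  rw [IsHEquivAt, e]
  exact (IsHEquiv.of_isIso _).comp (IsHEquiv.comp h (IsHEquiv.of_isIso _))

lemma IsHEquivAt.pow_whiskerLeft (R : Series S) {f : V ⟶ W} (h : IsHEquivAt X Y f) (k : ℕ) :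
    IsHEquivAt X Y (R.pow k ◁ f) := by
  induction k with
  | zero => exact h.unit_whiskerLeft.iso_whiskerLeft R.zero
  | succ k ih =>
    refine IsHEquivAt.iso_whiskerLeft (R.succ k) ?_
    have e : X ◁ (((S.1 ⊗ R.pow k) ◁ f) ▷ Y) = X ◁ ((α_ _ _ _).hom ▷ Y) ≫
        X ◁ ((S.1 ◁ (R.pow k ◁ f)) ▷ Y) ≫ X ◁ ((α_ _ _ _).inv ▷ Y) := by
      monoidal
    rw [IsHEquivAt, e]
    exact (IsHEquiv.of_isIso _).comp (IsHEquiv.comp (ih.whiskerLeft S) (IsHEquiv.of_isIso _))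

namespace Series

variable (R : Series S)

omit [DGMonoidal P] in
lemma isBisum_target (X Y G : Cx P) :
    IsBisum (fun k => X ◁ ((R.ι k ▷ G) ▷ Y)) (fun k => X ◁ ((R.π k ▷ G) ▷ Y)) :=
  (R.isBisum_tensor X (G ⊗ Y)).of_iso (whiskerLeftIso X (α_ _ _ _).symm)
    (fun _ => whiskerLeftIso X (α_ _ _ _).symm)
    (fun k => by simp only [whiskerLeftIso_hom, whiskerLeftIso_inv, Iso.symm_hom, Iso.symm_inv,
                  ← MonoidalCategory.whiskerLeft_comp]; simp)
    (fun k => by simp only [whiskerLeftIso_hom, whiskerLeftIso_inv, Iso.symm_hom, Iso.symm_inv,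
                  ← MonoidalCategory.whiskerLeft_comp]; simp)

omit [DGMonoidal P] in
lemma isBisum_source (X Y : Cx P) :
    IsBisum (fun k => X ◁ ((S.1 ◁ R.ι k) ▷ Y)) (fun k => X ◁ ((S.1 ◁ R.π k) ▷ Y)) :=
  (R.isBisum_tensor (X ⊗ S.1) Y).of_iso (α_ _ _ _ ≪≫ whiskerLeftIso X (α_ _ _ _).symm)
    (fun _ => α_ _ _ _ ≪≫ whiskerLeftIso X (α_ _ _ _).symm)
    (fun k => by simp [← MonoidalCategory.whiskerLeft_comp])
    (fun k => by simp [← MonoidalCategory.whiskerLeft_comp])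

/-- A map which is `p` from the summand `S ⊗ uᵏ` to the summand `uᵏ` and `-q` from `S ⊗ uᵏ` to
`uᵏ⁺¹` is an equivalence if `p` is: it is diagonal up to a term that raises the exponent. -/
lemma isHEquivAt_pos {p : S.1 ⟶ G} (q : 𝟙_ (Cx P) ⟶ G) (hp : IsHEquivAt X Y p) :
    IsHEquivAt X Y ((S.2.β R.obj).hom ≫ R.obj ◁ p - R.mulU ≫ (ρ_ R.obj).inv ≫ R.obj ◁ q) := by
  have h := (R.isBisum_source X Y).isHEquiv_sub_of_raising (R.isBisum_target X Y G)
    (fun k => X ◁ (((S.2.β (R.pow k)).hom ≫ R.pow k ◁ p) ▷ Y))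
    (fun k => (hp.pow_whiskerLeft R k).comp_iso _)
    (X ◁ ((R.mulU ≫ (ρ_ R.obj).inv ≫ R.obj ◁ q) ▷ Y))
    (fun k => X ◁ (((R.succ k).hom ≫ (ρ_ _).inv ≫ R.pow (k + 1) ◁ q) ▷ Y))
    (by
      rw [← MonoidalCategory.whiskerLeft_comp, ← comp_whiskerRight, Category.assoc, Category.assoc,
        whisker_exchange, ← rightUnitor_inv_naturality_assoc, reassoc_of% R.mulU_π_zero, zero_comp,
        zero_whiskerRight', whiskerLeft_zero'])
    (fun k => by
      rw [← MonoidalCategory.whiskerLeft_comp, ← comp_whiskerRight, Category.assoc, Category.assoc,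
        whisker_exchange, ← rightUnitor_inv_naturality_assoc, reassoc_of% R.mulU_π k,
        ← MonoidalCategory.whiskerLeft_comp, ← comp_whiskerRight])
  have e : (R.isBisum_source X Y).map (fun k => X ◁ ((R.ι k ▷ G) ▷ Y))
      (fun k => X ◁ (((S.2.β (R.pow k)).hom ≫ R.pow k ◁ p) ▷ Y)) =
      X ◁ (((S.2.β R.obj).hom ≫ R.obj ◁ p) ▷ Y) := by
    refine (R.isBisum_source X Y).hom_ext_ι fun k => ((R.isBisum_source X Y).ι_map _ k).trans ?_
    rw [← MonoidalCategory.whiskerLeft_comp, ← comp_whiskerRight,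
      ← MonoidalCategory.whiskerLeft_comp, ← comp_whiskerRight, S.2.naturality_assoc,
      Category.assoc, whisker_exchange]
  rwa [e, ← whiskerLeft_sub', ← sub_whiskerRight'] at h

/-- A map which is `-q` from the summand `uᵏ` to the summand `uᵏ` and `p` from `uᵏ⁺¹` to `uᵏ` is
an equivalence if `q` is: it is diagonal up to a term that lowers the exponent. -/
lemma isHEquivAt_neg (p : S.1 ⟶ G) {q : 𝟙_ (Cx P) ⟶ G} (hq : IsHEquivAt X Y q) :
    IsHEquivAt X Y (R.divU ≫ (S.2.β R.obj).hom ≫ R.obj ◁ p - (ρ_ R.obj).inv ≫ R.obj ◁ q) := by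
  have h := (R.isBisum_tensor X Y).isHEquiv_sub_of_lowering (R.isBisum_target X Y G)
    (fun k => X ◁ (((ρ_ _).inv ≫ R.pow k ◁ q) ▷ Y))
    (fun k => (hq.pow_whiskerLeft R k).comp_iso _)
    (X ◁ ((R.divU ≫ (S.2.β R.obj).hom ≫ R.obj ◁ p) ▷ Y))
    (fun k => X ◁ (((R.succ k).inv ≫ (S.2.β (R.pow k)).hom ≫ R.pow k ◁ p) ▷ Y))
    (by
      rw [← MonoidalCategory.whiskerLeft_comp, ← comp_whiskerRight, reassoc_of% R.ι_zero_divU,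
        zero_comp, zero_whiskerRight', whiskerLeft_zero'])
    (fun k => by
      rw [← MonoidalCategory.whiskerLeft_comp, ← comp_whiskerRight, reassoc_of% R.ι_divU k,
        S.2.naturality_assoc, ← whisker_exchange, ← MonoidalCategory.whiskerLeft_comp,
        ← comp_whiskerRight]
      simp only [Category.assoc])
  have e : (R.isBisum_tensor X Y).map (fun k => X ◁ ((R.ι k ▷ G) ▷ Y))
      (fun k => X ◁ (((ρ_ _).inv ≫ R.pow k ◁ q) ▷ Y)) =
      X ◁ (((ρ_ R.obj).inv ≫ R.obj ◁ q) ▷ Y) := by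
    refine (R.isBisum_tensor X Y).hom_ext_ι fun k => ((R.isBisum_tensor X Y).ι_map _ k).trans ?_
    rw [← MonoidalCategory.whiskerLeft_comp, ← comp_whiskerRight,
      ← MonoidalCategory.whiskerLeft_comp, ← comp_whiskerRight, Category.assoc, whisker_exchange,
      rightUnitor_inv_naturality_assoc]
  rw [e, ← whiskerLeft_sub', ← sub_whiskerRight'] at h
  simpa using IsHEquivAt.neg h

end Series

end Contractible

/-! ### Operators of invertible degree -/

section ActOn

variable {B : Type u} [Category.{v} B] [Preadditive B] {P : ObjectProperty (CochainComplex B ℤ)}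
  [MonoidalCategory (Cx P)]
variable {X Y Z A N N' F : Cx P} {S T : Center (Cx P)}

/-- For `u : X ⊗ A ⟶ Y`, the map `u ⊗ N : X ⊗ (A ⊗ N) ⟶ Y ⊗ N`. -/
def actOn (u : X ⊗ A ⟶ Y) (N : Cx P) : X ⊗ (A ⊗ N) ⟶ Y ⊗ N := (α_ X A N).inv ≫ u ▷ N

lemma actOn_natural (u : X ⊗ A ⟶ Y) (f : N ⟶ N') :
    X ◁ A ◁ f ≫ actOn u N' = actOn u N ≫ Y ◁ f := by
  rw [actOn, actOn, Category.assoc, ← whisker_exchange]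
  simp

lemma actOn_sw (u : S.1 ⊗ A ⟶ A) (N : Cx P) :
    T.1 ◁ actOn u N ≫ (sw T A N).hom =
      (sw T S.1 (A ⊗ N)).hom ≫ S.1 ◁ (sw T A N).hom ≫ actOn u (T.1 ⊗ N) := by
  have h := sw_natural_left T u N
  rw [sw_tensor] at h
  rw [actOn, actOn, MonoidalCategory.whiskerLeft_comp, Category.assoc, h]
  simp [← MonoidalCategory.whiskerLeft_comp_assoc]

end ActOn

section Quotient

variable {B : Type u} [Category.{v} B] [Preadditive B] {P : ObjectProperty (CochainComplex B ℤ)}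
  [MonoidalCategory (Cx P)]
variable {L M M' S T : Center (Cx P)} (ε : M' ⊗ M ≅ 𝟙_ (Center (Cx P))) (d : S ≅ M' ⊗ L)
variable {X N N' F : Cx P}

lemma split_sw_left (N : Cx P) :
    T.1 ◁ (split d N).hom ≫ (sw T M'.1 (L.1 ⊗ N)).hom ≫ M'.1 ◁ (sw T L.1 N).hom =
      (sw T S.1 N).hom ≫ (split d (T.1 ⊗ N)).hom :=
  unf_sw T d.hom.f N

lemma merge_sw {X Y : Cx P} (f : X ⊗ Y ⟶ 𝟙_ (Cx P)) (N : Cx P) :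
    (sw T X (Y ⊗ N)).hom ≫ X ◁ (sw T Y N).hom ≫
        ((α_ X Y (T.1 ⊗ N)).inv ≫ f ▷ (T.1 ⊗ N) ≫ (λ_ _).hom) =
      T.1 ◁ ((α_ X Y N).inv ≫ f ▷ N ≫ (λ_ N).hom) := by
  have h1 : (sw T (𝟙_ (Cx P)) N).hom ≫ (λ_ (T.1 ⊗ N)).hom = T.1 ◁ (λ_ N).hom := by
    rw [sw, actIso_hom, act, halfBraiding_unit]
    simp
  have h2 := sw_natural_left T f N
  rw [sw_tensor] at h2
  rw [MonoidalCategory.whiskerLeft_comp, MonoidalCategory.whiskerLeft_comp, ← h1,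
    reassoc_of% h2, ← MonoidalCategory.whiskerLeft_comp_assoc]
  simp

lemma contract_sw_left (N : Cx P) :
    (sw T M'.1 (M.1 ⊗ N)).hom ≫ M'.1 ◁ (sw T M.1 N).hom ≫ (contract ε (T.1 ⊗ N)).hom =
      T.1 ◁ (contract ε N).hom :=
  merge_sw ε.hom.f N

lemma split_inv_eq (N : Cx P) : (split d N).inv = (α_ M'.1 L.1 N).inv ≫ d.inv.f ▷ N := rfl

lemma contract_inv_eq (N : Cx P) :
    (contract ε N).inv = (λ_ N).inv ≫ ε.inv.f ▷ N ≫ (α_ M'.1 M.1 N).hom := Category.assoc _ _ _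

/-- The quotient of two scalars with trivial self-braiding has trivial self-braiding. -/
lemma sw_self_quot (d : S ≅ M' ⊗ L) (hL : IsSelfTrivial L) (hM' : ∀ N, (sw M' M'.1 N).hom = 𝟙 _)
    (h : IsSymm L M') (N : Cx P) : (sw S S.1 N).hom = 𝟙 _ := by
  have h1 := split_sw d M'.1 (L.1 ⊗ N)
  have h2 := split_sw d L.1 N
  rw [hM', Category.comp_id] at h1
  rw [hL.sw, MonoidalCategory.whiskerLeft_id, Category.id_comp] at h2
  have h4 := congrArg (· ≫ M'.1 ◁ L.1 ◁ (split d N).hom) (split_sw_left (T := S) d N)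
  simp only [Category.assoc] at h4
  rw [← MonoidalCategory.whiskerLeft_comp, ← h2, MonoidalCategory.whiskerLeft_comp,
    ← reassoc_of% h1, ← MonoidalCategory.whiskerLeft_comp, h.sw_sw,
    MonoidalCategory.whiskerLeft_id, Category.comp_id, split_natural, ← Category.assoc,
    cancel_mono] at h4
  rw [← cancel_mono (S.1 ◁ (split d N).hom), ← h4, Category.id_comp]

/-- The inverse of a scalar with trivial self-braiding has trivial self-braiding. -/
lemma sw_self_inv (ε : M' ⊗ M ≅ 𝟙_ (Center (Cx P))) (hM : IsSelfTrivial M) (N : Cx P) :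
    (sw M' M'.1 N).hom = 𝟙 _ := by
  -- It suffices to treat the objects `M ⊗ N`, since `N ≅ M ⊗ (M' ⊗ N)`.
  have key (N : Cx P) : (sw M' M'.1 (M.1 ⊗ N)).hom = 𝟙 _ := by
    have h := contract_sw_left (T := M') ε N
    have h1 : (sw M' M.1 N).hom = (contract ε N).hom ≫ (expand ε N).hom := by simp [expand_hom]
    rw [h1, MonoidalCategory.whiskerLeft_comp, whiskerLeft_expand ε hM, Category.assoc,
      Iso.inv_hom_id, Category.comp_id] at h
    rw [← cancel_mono (M'.1 ◁ (contract ε N).hom), h, Category.id_comp]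
  have h := sw_natural_right M' M'.1 (expand ε N).hom
  rw [key, Category.comp_id] at h
  rw [← cancel_mono (M'.1 ◁ M'.1 ◁ (expand ε N).hom), ← h, Category.id_comp]

lemma quotSplit_whiskerRight (X N : Cx P) :
    (quotSplit ε d X).hom ▷ N ≫ (α_ _ _ _).hom ≫ M.1 ◁ (α_ _ _ _).hom =
      (α_ _ _ _).hom ≫ (quotSplit ε d (X ⊗ N)).hom := by
  simp only [quotSplit_hom, expand_hom, contract_inv_eq, split_inv_eq, sw, actIso_hom, act]
  monoidal

/-- Splitting off an invertible scalar is compatible with `F`. -/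
lemma isHom_quotSplit (Z : FObj F) :
    FObj.IsHom ((FObj.ofCenter F L).tensor Z)
      ((FObj.ofCenter F M).tensor ((FObj.ofCenter F S).tensor Z)) (quotSplit ε d Z.obj).hom := by
  change ((α_ _ _ _).hom ≫ L.1 ◁ Z.c ≫ (sw L F Z.obj).hom) ≫ _ = _ ≫ (α_ _ _ _).hom ≫
    M.1 ◁ ((α_ _ _ _).hom ≫ S.1 ◁ Z.c ≫ (sw S F Z.obj).hom) ≫ (sw M F (S.1 ⊗ Z.obj)).hom
  have h1 := quotSplit_sw ε d F Z.obj
  have h2 := quotSplit_whiskerRight ε d Z.obj F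
  have h3 := quotSplit_natural ε d Z.c
  simp only [MonoidalCategory.whiskerLeft_comp, Category.assoc]
  rw [reassoc_of% h2, reassoc_of% h3, h1]

end Quotient

/-! ### The maps defining the interpolation cones -/

section Zigzag

variable {B : Type u} [Category.{v} B] [Preadditive B] {P : ObjectProperty (CochainComplex B ℤ)}
  [MonoidalCategory (Cx P)]
variable {L M M' S T : Center (Cx P)} (ε : M' ⊗ M ≅ 𝟙_ (Center (Cx P))) (d : S ≅ M' ⊗ L)
variable {N N' F : Cx P}

/-- Splitting `S ≅ M' ⊗ L` after moving it past `R`. -/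
def numMap (R : Cx P) : S.1 ⊗ R ⟶ (R ⊗ M'.1) ⊗ L.1 :=
  (S.2.β R).hom ≫ R ◁ d.hom.f ≫ (α_ R M'.1 L.1).inv

/-- Creating `M' ⊗ M` to the right of `R`. -/
def denMap (R : Cx P) : R ⟶ (R ⊗ M'.1) ⊗ M.1 :=
  (ρ_ R).inv ≫ R ◁ ε.inv.f ≫ (α_ R M'.1 M.1).inv

lemma isHom_numMap (R : FObj F) :
    FObj.IsHom ((FObj.ofCenter F S).tensor R)
      ((R.tensor (.ofCenter F M')).tensor (.ofCenter F L)) (numMap d R.obj) :=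
  (FObj.isHom_halfBraiding S R).comp
    (((FObj.isHom_ofCenter_split d.hom).whiskerLeft R).comp
      (FObj.IsHom.inv (FObj.isHom_associator R (.ofCenter F M') (.ofCenter F L))))

lemma isHom_denMap (R : FObj F) :
    FObj.IsHom R ((R.tensor (.ofCenter F M')).tensor (.ofCenter F M)) (denMap ε R.obj) :=
  have h : FObj.IsHom (FObj.unit F) ((FObj.ofCenter F M').tensor (.ofCenter F M)) ε.inv.f :=
    FObj.IsHom.inv (X := (FObj.ofCenter F M').tensor (.ofCenter F M)) (Y := FObj.unit F)
      (f := (Center.forget (Cx P)).mapIso ε) (FObj.isHom_ofCenter_merge ε.hom)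
  (FObj.IsHom.inv (FObj.isHom_rightUnitor R)).comp
    ((h.whiskerLeft R).comp
      (FObj.IsHom.inv (FObj.isHom_associator R (.ofCenter F M') (.ofCenter F M))))

lemma unf_comp {X A Y Z : Cx P} (g : X ⟶ A) (f : A ⟶ Y ⊗ Z) (N : Cx P) :
    unf (g ≫ f) N = g ▷ N ≫ unf f N := by simp [unf]

lemma unf_numMap (R N : Cx P) : unf (numMap d R) N =
    (α_ _ _ _).hom ≫ (sw S R N).hom ≫ R ◁ (split d N).hom ≫ (α_ _ _ _).inv := by
  simp only [unf, numMap, sw, actIso_hom, act, split_hom]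
  monoidal

lemma unf_denMap (R N : Cx P) : unf (denMap ε R) N =
    R ◁ (contract ε N).inv ≫ (α_ _ _ _).inv := by
  simp only [unf, denMap, contract_inv_eq]
  monoidal

/-- Moving the two factors of `S ≅ M' ⊗ L` past `R` one after the other. -/
lemma splitRight_sw (h : IsSymm M' L) (R N : Cx P) :
    (splitRight d (R ⊗ N)).hom ≫ L.1 ◁ (sw M' R N).hom ≫ (sw L R (M'.1 ⊗ N)).hom ≫
      R ◁ (sw L M'.1 N).hom = (sw S R N).hom ≫ R ◁ (split d N).hom := by
  rw [splitRight_hom, Category.assoc, ← reassoc_of% sw_sw, ← split_sw,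
    ← MonoidalCategory.whiskerLeft_comp, h.sw_sw]
  simp

lemma splitRight_sw_left (N : Cx P) :
    T.1 ◁ (splitRight d N).hom ≫ (sw T L.1 (M'.1 ⊗ N)).hom ≫ L.1 ◁ (sw T M'.1 N).hom =
      (sw T S.1 N).hom ≫ (splitRight d (T.1 ⊗ N)).hom := by
  rw [splitRight_hom, splitRight_hom, ← reassoc_of% split_sw_left,
    MonoidalCategory.whiskerLeft_comp, Category.assoc, sw_sw]

lemma splitRight_natural (f : N ⟶ N') :
    (splitRight d N).hom ≫ L.1 ◁ M'.1 ◁ f = S.1 ◁ f ≫ (splitRight d N').hom := by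
  rw [splitRight_hom, splitRight_hom, Category.assoc, ← sw_natural_right, reassoc_of% split_natural]

/-- The map `L ⊗ X ⟶ M ⊗ X` obtained from an endomorphism of `X` of degree `S ≅ L / M`. -/
def quotMap {X : Cx P} (u : S.1 ⊗ X ⟶ X) : L.1 ⊗ X ⟶ M.1 ⊗ X := (quotSplit ε d X).hom ≫ M.1 ◁ u

lemma act_quotMap {X : Cx P} (u : S.1 ⊗ X ⟶ X) (N : Cx P) :
    act (quotMap ε d u) N = quotMap ε d (actOn u N) := by
  have h := quotSplit_whiskerRight ε d X N
  rw [← Iso.inv_comp_eq] at h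
  rw [quotMap, quotMap, ← h, act, actOn]
  simp

lemma isHom_quotMap {Z : FObj F} {u : S.1 ⊗ Z.obj ⟶ Z.obj}
    (hu : FObj.IsHom ((FObj.ofCenter F S).tensor Z) Z u) :
    FObj.IsHom ((FObj.ofCenter F L).tensor Z) ((FObj.ofCenter F M).tensor Z)
      (quotMap ε d u) :=
  (isHom_quotSplit ε d Z).comp (hu.whiskerLeft (.ofCenter F M))

/-- If `e : X ⟶ L ⊗ Y` is compatible with endomorphisms of degree `S`, then it is compatible with
the maps induced by these endomorphisms. -/
lemma quotMap_equivariant (hL : IsSelfTrivial L) (hLM : IsSymm L M) {X Y : Cx P}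
    {u : S.1 ⊗ X ⟶ X} {u' : S.1 ⊗ Y ⟶ Y} {e : X ⟶ L.1 ⊗ Y}
    (he : u ≫ e = S.1 ◁ e ≫ (sw S L.1 Y).hom ≫ L.1 ◁ u') :
    quotMap ε d u ≫ M.1 ◁ e = L.1 ◁ e ≫ L.1 ◁ quotMap ε d u' ≫ (sw L M.1 Y).hom := by
  have h1 : (quotSplit ε d (L.1 ⊗ Y)).hom ≫ M.1 ◁ (sw S L.1 Y).hom =
      L.1 ◁ (quotSplit ε d Y).hom ≫ (sw L M.1 (S.1 ⊗ Y)).hom := by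
    have := quotSplit_sw ε d L.1 Y
    rw [hL.sw, Category.id_comp] at this
    rw [← this, Category.assoc, Category.assoc, hLM.symm.sw_sw, Category.comp_id]
  rw [quotMap, quotMap, Category.assoc, ← MonoidalCategory.whiskerLeft_comp, he]
  simp only [MonoidalCategory.whiskerLeft_comp, Category.assoc]
  rw [reassoc_of% quotSplit_natural, reassoc_of% h1, sw_natural_right]

/-- The operator of degree `S` on `R ⊗ W` induced by the one on `R`. -/
lemma actOn_actOn {R W : Cx P} (u : S.1 ⊗ R ⟶ R) (N : Cx P) :
    actOn (actOn u W) N = S.1 ◁ (α_ R W N).hom ≫ actOn u (W ⊗ N) ≫ (α_ R W N).inv := by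
  simp [actOn]

section Pos

variable (R : Series S)

/-- The source of the map defining `C` for `L / M` small, as a multiple of `L`. -/
def posIso (N : Cx P) : (S.1 ⊗ R.obj) ⊗ N ≅ L.1 ⊗ ((R.obj ⊗ M'.1) ⊗ N) :=
  α_ _ _ _ ≪≫ splitRight d (R.obj ⊗ N) ≪≫
    whiskerLeftIso L.1 (sw M' R.obj N ≪≫ (α_ R.obj M'.1 N).symm)

lemma posIso_hom (N : Cx P) : (posIso d R N).hom = (α_ _ _ _).hom ≫
    (splitRight d (R.obj ⊗ N)).hom ≫ L.1 ◁ (sw M' R.obj N).hom ≫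
      L.1 ◁ (α_ R.obj M'.1 N).inv := by
  simp [posIso]

/-- In terms of `posIso`, the first component of the map defining `C` is the braiding of `L`. -/
lemma unf_pos_num (h : IsSymm M' L) (N : Cx P) :
    unf (numMap d R.obj) N = (posIso d R N).hom ≫ (sw L (R.obj ⊗ M'.1) N).hom := by
  rw [unf_numMap, posIso_hom, sw_tensor, ← reassoc_of% splitRight_sw d h]
  simp [← MonoidalCategory.whiskerLeft_comp_assoc]

/-- In terms of `posIso`, the second component of the map defining `C` is multiplication by `u`,
seen as a map `L ⊗ Z ⟶ M ⊗ Z` for `Z = 𝟙[u] ⊗ M'`, followed by the braiding of `M`. -/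
lemma unf_pos_den (hML : IsSymm M L) (hM : IsSelfTrivial M) (hSM : IsSymm S M)
    (hM'M : IsSymm M' M) (N : Cx P) :
    unf (R.mulU ≫ denMap ε R.obj) N = (posIso d R N).hom ≫
      act (quotMap ε d (actOn R.mulU M'.1)) N ≫ (sw M (R.obj ⊗ M'.1) N).hom := by
  have h1 := quotSplit_natural ε d (α_ R.obj M'.1 N).inv
  have h2 := quotSplit_natural ε d (sw M' R.obj N).hom
  rw [act_quotMap, quotMap, actOn_actOn, unf_comp, unf_denMap, posIso_hom, sw_tensor]
  simp only [Category.assoc, MonoidalCategory.whiskerLeft_comp]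
  rw [← reassoc_of% h1, ← reassoc_of% h2, reassoc_of% splitRight_quotSplit ε d hML hM]
  simp only [← MonoidalCategory.whiskerLeft_comp_assoc, Iso.inv_hom_id, Category.id_comp,
    MonoidalCategory.whiskerLeft_id]
  simp only [MonoidalCategory.whiskerLeft_comp, Category.assoc]
  rw [reassoc_of% actOn_sw, reassoc_of% sw_natural_right, reassoc_of% hSM.sw_sw,
    ← MonoidalCategory.whiskerLeft_comp_assoc, ← MonoidalCategory.whiskerLeft_comp_assoc,
    Category.assoc, expand_sw, reassoc_of% actOn_natural, ← MonoidalCategory.whiskerLeft_comp_assoc,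
    expand_hom, Category.assoc, hM'M.sw_sw]
  simp [actOn]

/-- `posIso` is compatible with multiplication by `u`. -/
lemma posIso_equivariant (hS : ∀ N, (sw S S.1 N).hom = 𝟙 _) (hSM' : IsSymm S M') (N : Cx P) :
    actOn (S.1 ◁ R.mulU) N ≫ (posIso d R N).hom = S.1 ◁ (posIso d R N).hom ≫
      (sw S L.1 ((R.obj ⊗ M'.1) ⊗ N)).hom ≫ L.1 ◁ actOn (actOn R.mulU M'.1) N := by
  have h1 : (splitRight d (S.1 ⊗ (R.obj ⊗ N))).hom ≫ L.1 ◁ (sw M' S.1 (R.obj ⊗ N)).hom =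
      S.1 ◁ (splitRight d (R.obj ⊗ N)).hom ≫ (sw S L.1 (M'.1 ⊗ (R.obj ⊗ N))).hom := by
    have := splitRight_sw_left (T := S) d (R.obj ⊗ N)
    rw [hS, Category.id_comp] at this
    rw [← this, Category.assoc, Category.assoc, ← MonoidalCategory.whiskerLeft_comp, hSM'.sw_sw]
    simp
  have h2 : actOn (S.1 ◁ R.mulU) N = S.1 ◁ (α_ _ _ _).hom ≫ S.1 ◁ actOn R.mulU N ≫
      (α_ _ _ _).inv := by simp [actOn]
  rw [posIso_hom, h2, actOn_actOn]
  simp only [Category.assoc, MonoidalCategory.whiskerLeft_comp, Iso.inv_hom_id_assoc]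
  rw [← reassoc_of% splitRight_natural, ← MonoidalCategory.whiskerLeft_comp_assoc L.1, actOn_sw]
  simp only [Category.assoc, MonoidalCategory.whiskerLeft_comp]
  rw [reassoc_of% h1, reassoc_of% sw_natural_right, reassoc_of% sw_natural_right]
  simp only [← MonoidalCategory.whiskerLeft_comp, ← MonoidalCategory.whiskerLeft_comp_assoc,
    Iso.inv_hom_id, MonoidalCategory.whiskerLeft_id, Category.id_comp]

end Pos

end Zigzag

section Neg

variable {B : Type u} [Category.{v} B] [Preadditive B] {P : ObjectProperty (CochainComplex B ℤ)}
  [MonoidalCategory (Cx P)]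
variable {L L' M M' S T : Center (Cx P)} (ε : M' ⊗ M ≅ 𝟙_ (Center (Cx P))) (d : S ≅ M' ⊗ L)
  (ε' : L' ⊗ L ≅ 𝟙_ (Center (Cx P))) (d' : T ≅ L' ⊗ M) (k : S ⊗ T ≅ 𝟙_ (Center (Cx P)))
  (R : Series T) {F : Cx P}

/-- The map `S ⊗ 𝟙[u] ⟶ 𝟙[u]` which sends `uᵏ⁺¹` to `uᵏ` and kills `u⁰`, where `S` is inverse to the
degree `T` of `u`. -/
def Series.lowerU : S.1 ⊗ R.obj ⟶ R.obj := S.1 ◁ R.divU ≫ (contract k R.obj).hom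

lemma contract_whiskerRight (X N : Cx P) :
    (contract ε X).hom ▷ N =
      (α_ _ _ _).hom ≫ M'.1 ◁ (α_ _ _ _).hom ≫ (contract ε (X ⊗ N)).hom := by
  simp only [contract_hom]
  monoidal

lemma actOn_lowerU (N : Cx P) :
    actOn (R.lowerU k) N = S.1 ◁ unf R.divU N ≫ (contract k (R.obj ⊗ N)).hom := by
  rw [actOn, Series.lowerU, comp_whiskerRight, contract_whiskerRight, unf]
  simp

lemma isHom_contract (X : FObj F) :
    FObj.IsHom ((FObj.ofCenter F M').tensor ((FObj.ofCenter F M).tensor X)) X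
      (contract ε X.obj).hom :=
  (FObj.IsHom.inv (FObj.isHom_associator (.ofCenter F M') (.ofCenter F M) X)).comp
    (((FObj.isHom_ofCenter_merge ε.hom).whiskerRight X).comp (FObj.isHom_leftUnitor X))

lemma isHom_lowerU [DGMonoidal P] :
    FObj.IsHom ((FObj.ofCenter F S).tensor (R.fobj F)) (R.fobj F) (R.lowerU k) :=
  (R.isHom_divU.whiskerLeft (.ofCenter F S)).comp (isHom_contract k (R.fobj F))

lemma isHom_actOn {X : FObj F} {u : S.1 ⊗ X.obj ⟶ X.obj}
    (hu : FObj.IsHom ((FObj.ofCenter F S).tensor X) X u) (W : FObj F) :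
    FObj.IsHom ((FObj.ofCenter F S).tensor (X.tensor W)) (X.tensor W) (actOn u W.obj) :=
  (FObj.IsHom.inv (FObj.isHom_associator (.ofCenter F S) X W)).comp (hu.whiskerRight W)

/-- The source of the map defining `C` for `M / L` small, as a multiple of `L`. -/
def negIso (N : Cx P) : R.obj ⊗ N ≅ L.1 ⊗ ((R.obj ⊗ L'.1) ⊗ N) :=
  expand ε' (R.obj ⊗ N) ≪≫ whiskerLeftIso L.1 (sw L' R.obj N ≪≫ (α_ R.obj L'.1 N).symm)

lemma negIso_hom (N : Cx P) : (negIso ε' R N).hom =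
    (expand ε' (R.obj ⊗ N)).hom ≫ L.1 ◁ (sw L' R.obj N).hom ≫ L.1 ◁ (α_ R.obj L'.1 N).inv := by
  simp [negIso]

/-- In terms of `negIso`, the second component of the map defining `C` is the braiding of `L`. -/
lemma unf_neg_den (h : IsSymm L' L) (N : Cx P) :
    unf (denMap ε' R.obj) N = (negIso ε' R N).hom ≫ (sw L (R.obj ⊗ L'.1) N).hom := by
  rw [unf_denMap, negIso_hom, sw_tensor]
  simp only [Category.assoc, ← MonoidalCategory.whiskerLeft_comp_assoc, Iso.inv_hom_id,
    MonoidalCategory.whiskerLeft_id, Category.id_comp]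
  rw [reassoc_of% expand_sw, ← MonoidalCategory.whiskerLeft_comp_assoc, expand_hom, Category.assoc,
    h.sw_sw, Category.comp_id]

variable {k} in
lemma quotSplit_actOn_lowerU (hM : IsSelfTrivial M)
    (hk : ∀ N, (contract k N).hom = cancelQuot ε' d' ε d N) (N : Cx P) :
    (quotSplit ε d (R.obj ⊗ N)).hom ≫ M.1 ◁ actOn (R.lowerU k) N =
      L.1 ◁ unf R.divU N ≫ (quotSplit ε' d' (R.obj ⊗ N)).inv := by
  rw [actOn_lowerU, MonoidalCategory.whiskerLeft_comp, reassoc_of% quotSplit_natural, hk,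
    quotSplit_cancelQuot ε' d' ε d hM]

variable {k} in
/-- In terms of `negIso`, the first component of the map defining `C` is division by `u`, seen as a
map `L ⊗ Z ⟶ M ⊗ Z` for `Z = 𝟙[u] ⊗ L'`, followed by the braiding of `M`. -/
lemma unf_neg_num (hM : IsSelfTrivial M) (hL : IsSelfTrivial L) (hLM : IsSymm L M)
    (hLT : IsSymm L T) (hL'M : IsSymm L' M)
    (hk : ∀ N, (contract k N).hom = cancelQuot ε' d' ε d N) (N : Cx P) :
    unf (R.divU ≫ numMap d' R.obj) N = (negIso ε' R N).hom ≫
      act (quotMap ε d (actOn (R.lowerU k) L'.1)) N ≫ (sw M (R.obj ⊗ L'.1) N).hom := by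
  have h1 := quotSplit_natural ε d (α_ R.obj L'.1 N).inv
  have h2 := expand_natural ε' (unf R.divU N)
  have h3 : (sw L' R.obj N).hom ≫ unf R.divU (L'.1 ⊗ N) =
      L'.1 ◁ unf R.divU N ≫ (sw L' T.1 (R.obj ⊗ N)).hom ≫ T.1 ◁ (sw L' R.obj N).hom :=
    (unf_sw L' R.divU N).symm
  have h4 : (expand ε' (T.1 ⊗ (R.obj ⊗ N))).hom ≫ L.1 ◁ (sw L' T.1 (R.obj ⊗ N)).hom =
      (splitRight d' (R.obj ⊗ N)).hom ≫ (quotSplit ε' d' (L'.1 ⊗ (R.obj ⊗ N))).hom := by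
    rw [expand_sw_right ε' hLT, splitRight_quotSplit ε' d' hLM hL]
  have h5 : L.1 ◁ T.1 ◁ (sw L' R.obj N).hom ≫ (quotSplit ε' d' (R.obj ⊗ (L'.1 ⊗ N))).inv =
      (quotSplit ε' d' (L'.1 ⊗ (R.obj ⊗ N))).inv ≫ M.1 ◁ (sw L' R.obj N).hom := by
    have := quotSplit_natural ε' d' (sw L' R.obj N).hom
    rw [Iso.eq_inv_comp, reassoc_of% this, Iso.hom_inv_id, Category.comp_id]
  rw [act_quotMap, quotMap, actOn_actOn, unf_comp, unf_numMap, negIso_hom, sw_tensor]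
  simp only [Category.assoc, MonoidalCategory.whiskerLeft_comp]
  rw [← reassoc_of% h1]
  simp only [← MonoidalCategory.whiskerLeft_comp_assoc, Iso.inv_hom_id, Category.id_comp,
    MonoidalCategory.whiskerLeft_id]
  have h6 := quotSplit_actOn_lowerU ε d ε' d' R hM hk (L'.1 ⊗ N)
  have h3' := congrArg (L.1 ◁ ·) h3
  simp only [MonoidalCategory.whiskerLeft_comp] at h3'
  rw [reassoc_of% h6, reassoc_of% h3', reassoc_of% h2, reassoc_of% h4, reassoc_of% h5,
    Iso.hom_inv_id_assoc]
  rw [reassoc_of% splitRight_sw d' hL'M]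
  simp [unf]

/-- `negIso` is compatible with division by `u`. -/
lemma negIso_equivariant (hLS : IsSymm L S) (N : Cx P) :
    actOn (R.lowerU k) N ≫ (negIso ε' R N).hom = S.1 ◁ (negIso ε' R N).hom ≫
      (sw S L.1 ((R.obj ⊗ L'.1) ⊗ N)).hom ≫ L.1 ◁ actOn (actOn (R.lowerU k) L'.1) N := by
  rw [negIso_hom, actOn_actOn]
  simp only [Category.assoc, MonoidalCategory.whiskerLeft_comp]
  rw [← reassoc_of% expand_natural, ← MonoidalCategory.whiskerLeft_comp_assoc L.1, actOn_sw]
  simp only [Category.assoc, MonoidalCategory.whiskerLeft_comp]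
  rw [reassoc_of% expand_sw_right ε' hLS (R.obj ⊗ N), reassoc_of% sw_natural_right,
    reassoc_of% sw_natural_right]
  simp only [← MonoidalCategory.whiskerLeft_comp, ← MonoidalCategory.whiskerLeft_comp_assoc,
    Iso.inv_hom_id, MonoidalCategory.whiskerLeft_id, Category.id_comp]

end Neg

/-! ### Scalars of a symmetric monoidal category -/

section Functor

variable {C : Type u} [Category.{v} C] [MonoidalCategory C] {K : Type w} [Category.{w'} K]
  [MonoidalCategory K]

/-- A monoidal functor maps the two-step cancellation of `(l ⊗ m') ⊗ (m ⊗ l')` to the two-step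
cancellation of the images. -/
lemma map_contract_contract (G : K ⥤ C) [G.Monoidal] {l l' m m' : K} (e : m' ⊗ m ⟶ 𝟙_ K)
    (f : l ⊗ l' ⟶ 𝟙_ K) :
    Functor.LaxMonoidal.μ G (l ⊗ m') (m ⊗ l') ≫ G.map ((α_ l m' (m ⊗ l')).hom ≫
      l ◁ ((α_ m' m l').inv ≫ e ▷ l' ≫ (λ_ l').hom) ≫ f) =
    (Functor.OplaxMonoidal.δ G l m' ▷ _ ≫ _ ◁ Functor.OplaxMonoidal.δ G m l') ≫
      (α_ _ _ _).hom ≫ G.obj l ◁ ((α_ _ _ _).inv ≫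
        (Functor.LaxMonoidal.μ G m' m ≫ G.map e ≫ Functor.OplaxMonoidal.η G) ▷ _ ≫ (λ_ _).hom) ≫
      Functor.LaxMonoidal.μ G l l' ≫ G.map f := by
  simp only [Functor.map_comp, Functor.Monoidal.map_associator, Functor.Monoidal.map_associator_inv,
    Functor.Monoidal.map_whiskerLeft, Functor.Monoidal.map_whiskerRight,
    Functor.Monoidal.map_leftUnitor, Category.assoc, Functor.Monoidal.μ_δ_assoc,
    MonoidalCategory.whiskerLeft_comp, comp_whiskerRight, Functor.Monoidal.whiskerLeft_μ_δ_assoc]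
  rw [associator_naturality_right_assoc]

lemma whiskerRight_associator_act {A X Y Z W : C} (g : A ⟶ X ⊗ Y) (f : X ⊗ Y ⟶ Z ⊗ W) (N : C) :
    (g ▷ N ≫ (α_ X Y N).hom) ≫ (α_ X Y N).inv ≫ f ▷ N ≫ (α_ Z W N).hom =
      (g ≫ f) ▷ N ≫ (α_ Z W N).hom := by
  simp

lemma act_associator_whiskerRight {X Y Z W : C} (f : X ⊗ Y ⟶ Z ⊗ W) (g : Z ⊗ W ⟶ 𝟙_ C) (N : C) :
    ((α_ X Y N).inv ≫ f ▷ N ≫ (α_ Z W N).hom) ≫ (α_ Z W N).inv ≫ g ▷ N ≫ (λ_ N).hom =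
      (α_ X Y N).inv ≫ (f ≫ g) ▷ N ≫ (λ_ N).hom := by
  simp

lemma contract_contract_whiskerRight {X Y A A' D D' : C} (g : X ⟶ A ⊗ D') (g' : Y ⟶ D ⊗ A')
    (e : D' ⊗ D ⟶ 𝟙_ C) (f : A ⊗ A' ⟶ 𝟙_ C) (N : C) :
    (α_ X Y N).inv ≫ ((g ▷ Y ≫ (A ⊗ D') ◁ g') ≫ (α_ A D' (D ⊗ A')).hom ≫
        A ◁ ((α_ D' D A').inv ≫ e ▷ A' ≫ (λ_ A').hom) ≫ f) ▷ N ≫ (λ_ N).hom =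
      (g ▷ (Y ⊗ N) ≫ (α_ A D' (Y ⊗ N)).hom) ≫ A ◁ D' ◁ (g' ▷ N ≫ (α_ D A' N).hom) ≫
        A ◁ ((α_ D' D (A' ⊗ N)).inv ≫ e ▷ (A' ⊗ N) ≫ (λ_ (A' ⊗ N)).hom) ≫
          (α_ A A' N).inv ≫ f ▷ N ≫ (λ_ N).hom := by
  monoidal

end Functor

section Scalar

variable {B : Type u} [Category.{v} B] [Preadditive B]
  {P : ObjectProperty (CochainComplex B ℤ)} [MonoidalCategory (Cx P)]
  {K : Type w} [Category.{w'} K] [MonoidalCategory K] [SymmetricCategory K]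
  (ρ : K ⥤ Center (Cx P))

lemma isSymm_obj [ρ.Braided] (s t : K) : IsSymm (ρ.obj s) (ρ.obj t) := by
  have h := congrArg ρ.map (SymmetricCategory.symmetry s t)
  rw [Functor.map_comp, Functor.map_braiding, Functor.map_braiding] at h
  have h' : (β_ (ρ.obj s) (ρ.obj t)).hom ≫ (β_ (ρ.obj t) (ρ.obj s)).hom = 𝟙 _ := by
    rw [← cancel_epi (Functor.OplaxMonoidal.δ ρ s t), ← cancel_mono (Functor.LaxMonoidal.μ ρ s t)]
    simpa using h
  exact congrArg (fun f => f.f) h'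

lemma isSelfTrivial_obj [ρ.Braided] {s : K} (h : scMap ρ (β_ s s).hom = 𝟙 _) :
    IsSelfTrivial (ρ.obj s) := by
  have h1 : ρ.map (β_ s s).hom = 𝟙 _ := Center.ext _ _ h
  rw [Functor.map_braiding] at h1
  have h' : (β_ (ρ.obj s) (ρ.obj s)).hom = 𝟙 _ := by
    rw [← cancel_epi (Functor.OplaxMonoidal.δ ρ s s), ← cancel_mono (Functor.LaxMonoidal.μ ρ s s)]
    simpa using h1
  exact congrArg (fun f => f.f) h'

variable [ρ.Monoidal]

/-- The isomorphism `m⁻¹ ⊗ m ≅ 𝟙` in the Drinfeld center. -/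
def centerInvMul (m : InvertibleScalar K) :
    ρ.obj m.inv ⊗ ρ.obj m.obj ≅ 𝟙_ (Center (Cx P)) :=
  Functor.Monoidal.μIso ρ m.inv m.obj ≪≫ ρ.mapIso (β_ m.inv m.obj ≪≫ m.iso) ≪≫
    (Functor.Monoidal.εIso ρ).symm

/-- The isomorphism `l / m ≅ m⁻¹ ⊗ l` in the Drinfeld center. -/
def centerDiv (l m : InvertibleScalar K) : ρ.obj (l.div m) ≅ ρ.obj m.inv ⊗ ρ.obj l.obj :=
  ρ.mapIso (β_ l.obj m.inv) ≪≫ (Functor.Monoidal.μIso ρ m.inv l.obj).symm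

/-- The isomorphism `(m / l) ⊗ (l / m) ≅ 𝟙` in the Drinfeld center. -/
def centerDivMulDiv (m l : InvertibleScalar K) :
    ρ.obj (m.div l) ⊗ ρ.obj (l.div m) ≅ 𝟙_ (Center (Cx P)) :=
  Functor.Monoidal.μIso ρ (m.div l) (l.div m) ≪≫
    ρ.mapIso
      (α_ m.obj l.inv (l.obj ⊗ m.inv) ≪≫
        whiskerLeftIso m.obj ((α_ l.inv l.obj m.inv).symm ≪≫
          whiskerRightIso (β_ l.inv l.obj ≪≫ l.iso) m.inv ≪≫ λ_ m.inv) ≪≫ m.iso) ≪≫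
    (Functor.Monoidal.εIso ρ).symm

omit [SymmetricCategory K] in
lemma scMul_hom (s t : K) : (scMul ρ s t).hom = (Functor.LaxMonoidal.μ ρ s t).f :=
  Category.id_comp _

omit [SymmetricCategory K] in
lemma scMul_inv (s t : K) : (scMul ρ s t).inv = (Functor.OplaxMonoidal.δ ρ s t).f :=
  Category.comp_id _

omit [SymmetricCategory K] in
lemma scOne_inv : (scOne ρ).inv = (Functor.OplaxMonoidal.η ρ).f :=
  Category.comp_id _

lemma centerInvMul_f (m : InvertibleScalar K) :
    (centerInvMul ρ m).hom.f = (invMulIso ρ m).hom := by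
  simp only [centerInvMul, invMulIso, Iso.trans_hom, scMul_hom, Iso.symm_hom, scOne_inv]
  rfl

lemma centerInvMul_inv_f (m : InvertibleScalar K) :
    (centerInvMul ρ m).inv.f = (invMulIso ρ m).inv := by
  have h : (centerInvMul ρ m).inv.f ≫ (invMulIso ρ m).hom = 𝟙 (𝟙_ (Cx P)) := by
    rw [← centerInvMul_f]
    exact congrArg (fun f => f.f) (centerInvMul ρ m).inv_hom_id
  exact ((Iso.comp_hom_eq_id _).1 h)

lemma centerDiv_f (l m : InvertibleScalar K) : (centerDiv ρ l m).hom.f = (divIso ρ l m).hom := by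
  simp only [centerDiv, divIso, Iso.trans_hom, scMul_inv, Iso.symm_hom]
  rfl

lemma centerDivMulDiv_f (l m : InvertibleScalar K) :
    (centerDivMulDiv ρ m l).hom.f = (divMulDivIso ρ m l).hom := by
  simp only [centerDivMulDiv, divMulDivIso, Iso.trans_hom, scMul_hom, Iso.symm_hom, scOne_inv]
  rfl

end Scalar

section Cancel

variable {B : Type u} [Category.{v} B] [Preadditive B] {P : ObjectProperty (CochainComplex B ℤ)}
  [MonoidalCategory (Cx P)]
variable {L L' M M' S T : Center (Cx P)} (ε : M' ⊗ M ≅ 𝟙_ (Center (Cx P))) (d : S ≅ M' ⊗ L)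
  (ε' : L' ⊗ L ≅ 𝟙_ (Center (Cx P))) (d' : T ≅ L' ⊗ M)

/-- The map `cancelQuot` in terms of splittings with the inverse scalar on the right. -/
lemma cancelQuot_eq (h : IsSymm L M) (N : Cx P) :
    cancelQuot ε' d' ε d N = (splitRight d (T.1 ⊗ N)).hom ≫
      L.1 ◁ M'.1 ◁ (splitRight d' N).hom ≫ L.1 ◁ (contract ε (L'.1 ⊗ N)).hom ≫
        (expand ε' N).inv := by
  have h1 : (sw M' L.1 (M.1 ⊗ (L'.1 ⊗ N))).hom ≫ L.1 ◁ (contract ε (L'.1 ⊗ N)).hom =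
      M'.1 ◁ (sw L M.1 (L'.1 ⊗ N)).hom ≫ (contract ε (L.1 ⊗ (L'.1 ⊗ N))).hom := by
    have h0 := contract_sw ε L.1 (L'.1 ⊗ N)
    rw [← h0, ← MonoidalCategory.whiskerLeft_comp_assoc, h.sw_sw]
    simp
  have h2 : L.1 ◁ (sw L' M.1 N).hom ≫ (sw L M.1 (L'.1 ⊗ N)).hom ≫ M.1 ◁ (expand ε' N).inv =
      (expand ε' (M.1 ⊗ N)).inv := by
    rw [← cancel_epi (expand ε' (M.1 ⊗ N)).hom, reassoc_of% expand_sw, Iso.hom_inv_id,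
      ← MonoidalCategory.whiskerLeft_comp, Iso.hom_inv_id, MonoidalCategory.whiskerLeft_id]
  have h3 := contract_natural ε (expand ε' N).inv
  have h4 := sw_natural_right M' L.1 (split d' N).hom
  have h5 := sw_natural_right M' L.1 (sw L' M.1 N).hom
  rw [cancelQuot, ← h2, splitRight_hom, splitRight_hom]
  simp only [MonoidalCategory.whiskerLeft_comp, Category.assoc]
  rw [← reassoc_of% h4, ← reassoc_of% h5, reassoc_of% h1, h3]

end Cancel

section ScalarCancel

variable {B : Type u} [Category.{v} B] [Preadditive B]
  {P : ObjectProperty (CochainComplex B ℤ)} [MonoidalCategory (Cx P)]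
  {K : Type w} [Category.{w'} K] [MonoidalCategory K] [SymmetricCategory K]
  (ρ : K ⥤ Center (Cx P)) [ρ.Braided]

lemma centerDiv_comp_braiding (l m : InvertibleScalar K) :
    (centerDiv ρ l m).hom ≫ (β_ (ρ.obj m.inv) (ρ.obj l.obj)).hom =
      Functor.OplaxMonoidal.δ ρ l.obj m.inv := by
  have h := Functor.map_braiding ρ m.inv l.obj
  rw [centerDiv, Iso.trans_hom, Functor.mapIso_hom, ← cancel_mono (Functor.LaxMonoidal.μ ρ _ _),
    Category.assoc, Category.assoc, Iso.symm_hom, Functor.Monoidal.μIso_inv, ← h,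
    ← Functor.map_comp, SymmetricCategory.symmetry]
  simp

lemma splitRight_centerDiv (l m : InvertibleScalar K) (N : Cx P) :
    (splitRight (centerDiv ρ l m) N).hom = (Functor.OplaxMonoidal.δ ρ l.obj m.inv).f ▷ N ≫
      (α_ (ρ.obj l.obj).1 (ρ.obj m.inv).1 N).hom := by
  rw [← centerDiv_comp_braiding, splitRight_hom, split_hom, sw, actIso_hom, act]
  exact whiskerRight_associator_act (centerDiv ρ l m).hom.f _ N

lemma expand_centerInvMul_inv (l : InvertibleScalar K) (N : Cx P) :
    (expand (centerInvMul ρ l) N).inv = (α_ (ρ.obj l.obj).1 (ρ.obj l.inv).1 N).inv ≫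
      (Functor.LaxMonoidal.μ ρ l.obj l.inv ≫ ρ.map l.iso.hom ≫ Functor.OplaxMonoidal.η ρ).f ▷ N ≫
        (λ_ N).hom := by
  have h : (β_ (ρ.obj l.obj) (ρ.obj l.inv)).hom ≫ (centerInvMul ρ l).hom =
      Functor.LaxMonoidal.μ ρ l.obj l.inv ≫ ρ.map l.iso.hom ≫ Functor.OplaxMonoidal.η ρ := by
    have h := Functor.LaxBraided.braided (F := ρ) l.obj l.inv
    simp only [centerInvMul, Iso.trans_hom, Functor.Monoidal.μIso_hom, Functor.mapIso_hom,
      Functor.map_comp, Iso.symm_hom, Functor.Monoidal.εIso_inv, Category.assoc]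
    rw [← reassoc_of% h, ← Functor.map_comp_assoc, SymmetricCategory.symmetry]
    simp
  rw [← h, expand]
  change (sw (ρ.obj l.inv) (ρ.obj l.obj).1 N).inv ≫ (contract _ N).hom = _
  rw [(isSymm_obj ρ l.inv l.obj).sw_inv, contract_hom, sw, actIso_hom, act]
  exact act_associator_whiskerRight _ (centerInvMul ρ l).hom.f N

/-- The isomorphism `(m / l) ⊗ (l / m) ≅ 𝟙` cancels `m` and `l`. -/
lemma contract_centerDivMulDiv (l m : InvertibleScalar K) (N : Cx P) :
    (contract (centerDivMulDiv ρ m l) N).hom =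
      cancelQuot (centerInvMul ρ m) (centerDiv ρ l m) (centerInvMul ρ l) (centerDiv ρ m l) N := by
  rw [cancelQuot_eq _ _ _ _ (isSymm_obj ρ _ _), splitRight_centerDiv, splitRight_centerDiv,
    expand_centerInvMul_inv, contract_hom, contract_hom]
  have h : (centerDivMulDiv ρ m l).hom =
      (Functor.OplaxMonoidal.δ ρ m.obj l.inv ▷ _ ≫ _ ◁ Functor.OplaxMonoidal.δ ρ l.obj m.inv) ≫
      (α_ _ _ _).hom ≫ ρ.obj m.obj ◁ ((α_ _ _ _).inv ≫ (centerInvMul ρ l).hom ▷ _ ≫ (λ_ _).hom) ≫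
      Functor.LaxMonoidal.μ ρ m.obj m.inv ≫ ρ.map m.iso.hom ≫ Functor.OplaxMonoidal.η ρ := by
    have := map_contract_contract ρ (β_ l.inv l.obj ≪≫ l.iso).hom m.iso.hom
    have := this =≫ Functor.OplaxMonoidal.η ρ
    simpa only [centerDivMulDiv, centerInvMul, Iso.trans_hom, Functor.mapIso_hom, Iso.symm_hom,
      Functor.Monoidal.μIso_hom, Functor.Monoidal.εIso_inv, whiskerLeftIso_hom, whiskerRightIso_hom,
      Category.assoc] using this
  rw [h]
  simp only [Center.comp_f, Center.whiskerLeft_f, Center.whiskerRight_f, Center.associator_hom_f,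
    Center.associator_inv_f, Center.leftUnitor_hom_f]
  exact contract_contract_whiskerRight (X := (ρ.obj (m.div l)).1) (Y := (ρ.obj (l.div m)).1)
    (A := (ρ.obj m.obj).1) (A' := (ρ.obj m.inv).1) (D := (ρ.obj l.obj).1) (D' := (ρ.obj l.inv).1)
    (Functor.OplaxMonoidal.δ ρ m.obj l.inv).f (Functor.OplaxMonoidal.δ ρ l.obj m.inv).f
    (centerInvMul ρ l).hom.f
    (Functor.LaxMonoidal.μ ρ m.obj m.inv ≫ ρ.map m.iso.hom ≫ Functor.OplaxMonoidal.η ρ).f N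

end ScalarCancel

/-! ### The factors of the interpolation complex -/

section Diag

variable {B : Type u} [Category.{v} B] [Preadditive B] {P : ObjectProperty (CochainComplex B ℤ)}
  [MonoidalCategory (Cx P)] [DGMonoidal P]
variable {L M M' S : Center (Cx P)} {A G C F Z : Cx P}

open DGMonoidal

lemma actOn_natural_graded {X C C' : Cx P} {n : ℤ} {z : Coch C C' n} {u : X ⊗ C ⟶ C}
    {u' : X ⊗ C' ⟶ C'} (h : pre u z = post (wL X z) u') (N : Cx P) :
    pre (actOn u N) (wR N z) = post (wL X (wR N z)) (actOn u' N) := by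
  have h1 : pre (α_ X C N).inv (wR N (wL X z)) = post (wL X (wR N z)) (α_ X C' N).inv := by
    rw [eq_comm, ← pre_eq_iff, ← post_pre, ← post_assoc_middle, post_post, Iso.hom_inv_id, post_id]
  rw [actOn, actOn, ← pre_pre, ← wR_pre, h, wR_post, ← post_pre, h1, post_post]

lemma quotMap_natural_graded (ε : M' ⊗ M ≅ 𝟙_ (Center (Cx P))) (d : S ≅ M' ⊗ L) {C C' : Cx P}
    {n : ℤ} {z : Coch C C' n} {u : S.1 ⊗ C ⟶ C} {u' : S.1 ⊗ C' ⟶ C'}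
    (h : pre u z = post (wL S.1 z) u') :
    pre (quotMap ε d u) (wL M.1 z) = post (wL L.1 z) (quotMap ε d u') := by
  rw [quotMap, quotMap, ← pre_pre, ← wL_pre, h, wL_post, ← post_pre, quotSplit_natural_graded,
    post_post]

namespace ConeData

/-- If `u : S ⊗ C ⟶ C` is diagonal, then so is `u ⊗ N`. -/
lemma isDiag_actOn {φ : A ⟶ Z ⊗ F} {K : ConeData φ C} {X : Cx P} {u : X ⊗ C ⟶ C}
    {uA : X ⊗ A ⟶ A} {uZ : X ⊗ Z ⟶ Z} (hu : IsDiag (K.tensorLeft X) K u uA (actOn uZ F))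
    (N : Cx P) : IsDiag ((K.nest N).tensorLeft X) (K.nest N) (actOn u N) (actOn uA N)
      (actOn uZ (F ⊗ N)) := by
  constructor
  · change pre _ (K.nest N).fst = post (wL X (K.nest N).fst) _
    rw [nest_fst]
    exact actOn_natural_graded hu.fst N
  · change pre _ (K.nest N).snd = post (wL X (K.nest N).snd) _
    rw [nest_snd, ← post_pre, actOn_natural_graded hu.snd N, wL_post, post_post, post_post]
    congr 1
    simp [actOn]

/-- If `u : S ⊗ C ⟶ C` is diagonal, then so is the induced map `L ⊗ C ⟶ M ⊗ C`. -/
lemma isDiag_quotMap (ε : M' ⊗ M ≅ 𝟙_ (Center (Cx P))) (d : S ≅ M' ⊗ L) {φ : A ⟶ G}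
    {K : ConeData φ C} {u : S.1 ⊗ C ⟶ C} {uA : S.1 ⊗ A ⟶ A} {uG : S.1 ⊗ G ⟶ G}
    (hu : IsDiag (K.tensorLeft S.1) K u uA uG) :
    IsDiag (K.tensorLeft L.1) (K.tensorLeft M.1) (quotMap ε d u) (quotMap ε d uA)
      (quotMap ε d uG) :=
  ⟨quotMap_natural_graded ε d hu.fst, quotMap_natural_graded ε d hu.snd⟩

end ConeData

end Diag

section Factors

variable {B : Type u} [Category.{v} B] [Preadditive B]
  {P : ObjectProperty (CochainComplex B ℤ)} [MonoidalCategory (Cx P)] [DGMonoidal P]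
  {K : Type w} [Category.{w'} K] [MonoidalCategory K] [SymmetricCategory K]
  {ρ : K ⥤ Center (Cx P)} [ρ.Braided] {F C : Cx P} {l m : InvertibleScalar K}

variable (ρ l m) in
/-- The map `l ⊗ X ⟶ m ⊗ X` obtained from an endomorphism of `X` of degree `l / m`. -/
abbrev degMap {X : Cx P} (u : (ρ.obj (l.div m)).1 ⊗ X ⟶ X) :
    (ρ.obj l.obj).1 ⊗ X ⟶ (ρ.obj m.obj).1 ⊗ X :=
  quotMap (centerInvMul ρ m) (centerDiv ρ l m) u

/-- The map of which `C` is the cone, for `l / m` small, with the target `𝟙[u] ⊗ (m⁻¹ ⊗ F)` nested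
to the left. -/
abbrev posMap (R : Series (ρ.obj (l.div m))) (a : (ρ.obj l.obj).1 ⟶ F) (b : (ρ.obj m.obj).1 ⟶ F) :
    (ρ.obj (l.div m)).1 ⊗ R.obj ⟶ (R.obj ⊗ (ρ.obj m.inv).1) ⊗ F :=
  numMap (centerDiv ρ l m) R.obj ≫ (R.obj ⊗ (ρ.obj m.inv).1) ◁ a -
    (R.mulU ≫ denMap (centerInvMul ρ m) R.obj) ≫ (R.obj ⊗ (ρ.obj m.inv).1) ◁ b

/-- The map of which `C` is the shifted cone, for `l / m` small, with the target `𝟙[u] ⊗ (m⁻¹ ⊗ F)`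
nested to the left. -/
abbrev negMap (R : Series (ρ.obj (l.div m))) (a : (ρ.obj l.obj).1 ⟶ F) (b : (ρ.obj m.obj).1 ⟶ F) :
    R.obj ⟶ (R.obj ⊗ (ρ.obj m.inv).1) ⊗ F :=
  (R.divU ≫ numMap (centerDiv ρ l m) R.obj) ≫ (R.obj ⊗ (ρ.obj m.inv).1) ◁ a -
    denMap (centerInvMul ρ m) R.obj ≫ (R.obj ⊗ (ρ.obj m.inv).1) ◁ b

variable (ρ m) in
/-- The object `𝟙[u] ⊗ m⁻¹`, which commutes with `F`. -/
abbrev targetF {S : Center (Cx P)} (R : Series S) (F : Cx P) : FObj F :=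
  (R.fobj F).tensor (.ofCenter F (ρ.obj m.inv))

omit [DGMonoidal P] in
lemma targetF_commutes {s t : K} (R : Series (ρ.obj s)) (γ : (ρ.obj t).1 ⟶ F) :
    (targetF ρ m R F).Commutes γ :=
  (R.commutes (isSymm_obj ρ t s) γ).tensor (FObj.commutes_ofCenter (isSymm_obj ρ t m.inv))

section Past

variable {l' m' : InvertibleScalar K} {a : (ρ.obj l'.obj).1 ⟶ F} {b : (ρ.obj m'.obj).1 ⟶ F}
  {γ₁ : (ρ.obj l.obj).1 ⟶ F} {γ₂ : (ρ.obj m.obj).1 ⟶ F}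
  {ha : Coch ((ρ.obj l'.obj).1 ⊗ F) (F ⊗ F) (-1)} {hb : Coch ((ρ.obj m'.obj).1 ⊗ F) (F ⊗ F) (-1)}
  {h₁ : Coch ((ρ.obj l.obj).1 ⊗ F) (F ⊗ F) (-1)} {h₂ : Coch ((ρ.obj m.obj).1 ⊗ F) (F ⊗ F) (-1)}

/-- The relation `a ≃ b ∘ V` is inherited from `N` by `C ⊗ N`, where `C` is the cone of `posMap`. -/
lemma factorsThrough_past_pos (hρ : IsDGCentral ρ) (R : Series (ρ.obj (l.div m)))
    (D : ConeData (posMap R γ₁ γ₂) C)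
    (ca : IsCommHomotopy a ha) (cb : IsCommHomotopy b hb)
    (c₁ : IsCommHomotopy γ₁ h₁) (c₂ : IsCommHomotopy γ₂ h₂)
    (oa₁ : Unobstructed a ha γ₁ h₁) (ob₁ : Unobstructed b hb γ₁ h₁)
    (oa₂ : Unobstructed a ha γ₂ h₂) (ob₂ : Unobstructed b hb γ₂ h₂)
    {N : Cx P} {V : (ρ.obj l'.obj).1 ⊗ N ⟶ (ρ.obj m'.obj).1 ⊗ N} (hV : FactorsThrough a b N V) :
    FactorsThrough a b (C ⊗ N)
      ((sw (ρ.obj l'.obj) C N).hom ≫ C ◁ V ≫ (sw (ρ.obj m'.obj) C N).inv) :=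
  FactorsThrough.past_cone (A := (FObj.ofCenter F (ρ.obj (l.div m))).tensor (R.fobj F))
    (Z := targetF ρ m R F)
    D (isHom_numMap (centerDiv ρ l m) (R.fobj F))
    (R.isHom_mulU.comp (isHom_denMap (centerInvMul ρ m) (R.fobj F)))
    (hρ l'.obj) (hρ m'.obj)
    ((FObj.commutes_ofCenter (isSymm_obj ρ _ _)).tensor (R.commutes (isSymm_obj ρ _ _) a))
    ((FObj.commutes_ofCenter (isSymm_obj ρ _ _)).tensor (R.commutes (isSymm_obj ρ _ _) b))
    (targetF_commutes R a) (targetF_commutes R b) ca cb c₁ c₂ oa₁ ob₁ oa₂ ob₂ hV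

/-- The relation `a ≃ b ∘ V` is inherited from `N` by `C ⊗ N`, where `C` is the cone of `negMap`. -/
lemma factorsThrough_past_neg (hρ : IsDGCentral ρ) (R : Series (ρ.obj (l.div m)))
    (D : ConeData (negMap R γ₁ γ₂) C)
    (ca : IsCommHomotopy a ha) (cb : IsCommHomotopy b hb)
    (c₁ : IsCommHomotopy γ₁ h₁) (c₂ : IsCommHomotopy γ₂ h₂)
    (oa₁ : Unobstructed a ha γ₁ h₁) (ob₁ : Unobstructed b hb γ₁ h₁)
    (oa₂ : Unobstructed a ha γ₂ h₂) (ob₂ : Unobstructed b hb γ₂ h₂)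
    {N : Cx P} {V : (ρ.obj l'.obj).1 ⊗ N ⟶ (ρ.obj m'.obj).1 ⊗ N} (hV : FactorsThrough a b N V) :
    FactorsThrough a b (C ⊗ N)
      ((sw (ρ.obj l'.obj) C N).hom ≫ C ◁ V ≫ (sw (ρ.obj m'.obj) C N).inv) :=
  FactorsThrough.past_cone (A := R.fobj F) (Z := targetF ρ m R F)
    D (R.isHom_divU.comp (isHom_numMap (centerDiv ρ l m) (R.fobj F)))
    (isHom_denMap (centerInvMul ρ m) (R.fobj F))
    (hρ l'.obj) (hρ m'.obj) (R.commutes (isSymm_obj ρ _ _) a) (R.commutes (isSymm_obj ρ _ _) b)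
    (targetF_commutes R a) (targetF_commutes R b) ca cb c₁ c₂ oa₁ ob₁ oa₂ ob₂ hV

end Past

section Own

variable {a : (ρ.obj l.obj).1 ⟶ F} {b : (ρ.obj m.obj).1 ⟶ F}
  {ha : Coch ((ρ.obj l.obj).1 ⊗ F) (F ⊗ F) (-1)} {hb : Coch ((ρ.obj m.obj).1 ⊗ F) (F ⊗ F) (-1)}

/-- On the cone `C` of `posMap`, the action of `a` factors through that of `b` by way of the map
induced by multiplication by `u`. -/
lemma factorsThrough_pos (hl : IsSelfTrivial (ρ.obj l.obj)) (hm : IsSelfTrivial (ρ.obj m.obj))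
    (R : Series (ρ.obj (l.div m))) (D : ConeData (posMap R a b) C)
    {u : (ρ.obj (l.div m)).1 ⊗ C ⟶ C}
    (hu : ConeData.IsDiag (D.tensorLeft _) D u ((ρ.obj (l.div m)).1 ◁ R.mulU)
      (actOn (actOn R.mulU (ρ.obj m.inv).1) F))
    (ca : IsCommHomotopy a ha) (cb : IsCommHomotopy b hb)
    (oaa : ∃ k : Coch ((ρ.obj l.obj).1 ⊗ (ρ.obj l.obj).1) (F ⊗ F) (-2),
      δ (-2) (-1) k = pre ((ρ.obj l.obj).1 ◁ a) ha)
    (obb : ∃ k : Coch ((ρ.obj m.obj).1 ⊗ (ρ.obj m.obj).1) (F ⊗ F) (-2),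
      δ (-2) (-1) k = pre ((ρ.obj m.obj).1 ◁ b) hb)
    (oba : Unobstructed b hb a ha) (N : Cx P) :
    FactorsThrough a b (C ⊗ N) (degMap ρ l m (actOn u N)) := by
  have hS : ∀ N, (sw (ρ.obj (l.div m)) (ρ.obj (l.div m)).1 N).hom = 𝟙 _ :=
    sw_self_quot (centerDiv ρ l m) hl (sw_self_inv (centerInvMul ρ m) hm) (isSymm_obj ρ _ _)
  have hV := ConeData.isDiag_quotMap (centerInvMul ρ m) (centerDiv ρ l m)
    (ConeData.isDiag_actOn hu N)
  rw [← act_quotMap _ _ (actOn R.mulU _)] at hV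
  refine factorsThrough_cone (Z := targetF ρ m R F) (posIso (centerDiv ρ l m) R N)
    (isHom_quotMap _ _ (isHom_actOn R.isHom_mulU (.ofCenter F (ρ.obj m.inv)))) ?_ (D.nest N) hl
    (isSymm_obj ρ _ _) (targetF_commutes R a) (targetF_commutes R b) ca cb oaa obb oba hV ?_
  · have h1 := unf_pos_num (centerDiv ρ l m) R (isSymm_obj ρ _ _) N
    have h2 := unf_pos_den (centerInvMul ρ m) (centerDiv ρ l m) R (isSymm_obj ρ _ _) hm
      (isSymm_obj ρ _ _) (isSymm_obj ρ _ _) N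
    rw [sub_unf, h1, h2, Preadditive.comp_sub]
    simp
  · rw [act_quotMap]
    exact quotMap_equivariant _ _ hl (isSymm_obj ρ _ _)
      (posIso_equivariant _ R hS (isSymm_obj ρ _ _) N)

/-- On the cone `C` of `negMap`, the action of `a` factors through that of `b` by way of the map
induced by division by `u`. -/
lemma factorsThrough_neg (hl : IsSelfTrivial (ρ.obj l.obj)) (hm : IsSelfTrivial (ρ.obj m.obj))
    (R : Series (ρ.obj (m.div l))) (D : ConeData (negMap R b a) C)
    {u : (ρ.obj (l.div m)).1 ⊗ C ⟶ C}
    (hu : ConeData.IsDiag (D.tensorLeft _) D u (R.lowerU (centerDivMulDiv ρ l m))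
      (actOn (actOn (R.lowerU (centerDivMulDiv ρ l m)) (ρ.obj l.inv).1) F))
    (ca : IsCommHomotopy a ha) (cb : IsCommHomotopy b hb)
    (oaa : ∃ k : Coch ((ρ.obj l.obj).1 ⊗ (ρ.obj l.obj).1) (F ⊗ F) (-2),
      δ (-2) (-1) k = pre ((ρ.obj l.obj).1 ◁ a) ha)
    (obb : ∃ k : Coch ((ρ.obj m.obj).1 ⊗ (ρ.obj m.obj).1) (F ⊗ F) (-2),
      δ (-2) (-1) k = pre ((ρ.obj m.obj).1 ◁ b) hb)
    (oba : Unobstructed b hb a ha) (N : Cx P) :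
    FactorsThrough a b (C ⊗ N) (degMap ρ l m (actOn u N)) := by
  have hV := ConeData.isDiag_quotMap (centerInvMul ρ m) (centerDiv ρ l m)
    (ConeData.isDiag_actOn hu N)
  rw [← act_quotMap _ _ (actOn (R.lowerU (centerDivMulDiv ρ l m)) _)] at hV
  -- In `negMap R b a` the eigenmap `a` occurs with the sign `-1`, which is absorbed into `e`.
  let e : R.obj ⊗ N ≅ (ρ.obj l.obj).1 ⊗ ((R.obj ⊗ (ρ.obj l.inv).1) ⊗ N) :=
    ⟨-(negIso (centerInvMul ρ l) R N).hom, -(negIso (centerInvMul ρ l) R N).inv,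
      by simp, by simp⟩
  refine factorsThrough_cone (Z := targetF ρ l R F) e
    (isHom_quotMap _ _ (isHom_actOn (isHom_lowerU (centerDivMulDiv ρ l m) R)
      (.ofCenter F (ρ.obj l.inv)))) ?_ (D.nest N) hl
    (isSymm_obj ρ _ _) (targetF_commutes R a) (targetF_commutes R b) ca cb oaa obb oba hV ?_
  · have h1 := unf_neg_den (centerInvMul ρ l) R (isSymm_obj ρ _ _) N
    have h2 := unf_neg_num (centerInvMul ρ m) (centerDiv ρ l m) (centerInvMul ρ l) (centerDiv ρ m l)
      R hm hl (isSymm_obj ρ _ _) (isSymm_obj ρ _ _) (isSymm_obj ρ _ _)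
      (contract_centerDivMulDiv ρ m l) N
    rw [sub_unf, h1, h2, Preadditive.comp_sub]
    simp [e]
    abel
  · rw [act_quotMap]
    refine quotMap_equivariant _ _ hl (isSymm_obj ρ _ _) ?_
    have h := negIso_equivariant (centerInvMul ρ l) (centerDivMulDiv ρ l m) R (isSymm_obj ρ _ _) N
    simp only [e, Preadditive.comp_neg, whiskerLeft_neg', Preadditive.neg_comp]
    rw [h]

end Own

end Factors

/-! ### Periodicity maps -/

section Equivariant

variable {B : Type u} [Category.{v} B] [Preadditive B] {P : ObjectProperty (CochainComplex B ℤ)}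
  [MonoidalCategory (Cx P)]
variable {S T : Center (Cx P)} {G : Cx P}

lemma eq_id_of_whiskerRight_unit {X : Cx P} {f : X ⟶ X} (h : f ▷ 𝟙_ (Cx P) = 𝟙 _) : f = 𝟙 X := by
  rw [← cancel_epi (ρ_ X).hom, ← rightUnitor_naturality, h]
  simp

lemma isSelfTrivial_of_sw (h : ∀ N, (sw S S.1 N).hom = 𝟙 _) : IsSelfTrivial S := by
  have h1 := h (𝟙_ _)
  rw [sw, actIso_hom, act, Iso.inv_comp_eq, Category.comp_id] at h1
  have h2 : (S.2.β S.1).hom ▷ 𝟙_ _ = 𝟙 _ := (cancel_mono _).1 (h1.trans (Category.id_comp _).symm)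
  exact eq_id_of_whiskerRight_unit h2

/-- A central object with trivial self-braiding moves freely past operators of its own degree. -/
lemma IsSelfTrivial.halfBraiding_tensor (hS : IsSelfTrivial S) (X : Cx P) :
    (S.2.β (S.1 ⊗ X)).hom = S.1 ◁ (S.2.β X).hom ≫ (α_ _ _ _).inv := by
  have h : (S.2.β S.1).hom = 𝟙 _ := hS
  rw [HalfBraiding.monoidal, h]
  simp

/-- The map defining `C`, for `S` small, is compatible with multiplication by `u`. -/
lemma mulU_equivariant [DGMonoidal P] (hS : IsSelfTrivial S) (R : Series S) (p : S.1 ⟶ G)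
    (q : 𝟙_ (Cx P) ⟶ G) :
    S.1 ◁ R.mulU ≫ ((S.2.β R.obj).hom ≫ R.obj ◁ p - R.mulU ≫ (ρ_ R.obj).inv ≫ R.obj ◁ q) =
      S.1 ◁ ((S.2.β R.obj).hom ≫ R.obj ◁ p - R.mulU ≫ (ρ_ R.obj).inv ≫ R.obj ◁ q) ≫
        actOn R.mulU G := by
  have h : S.1 ◁ R.mulU ≫ (S.2.β R.obj).hom = S.1 ◁ (S.2.β R.obj).hom ≫ actOn R.mulU S.1 := by
    rw [S.2.naturality, hS.halfBraiding_tensor, actOn, Category.assoc]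
  have h' : R.mulU ≫ (ρ_ R.obj).inv = S.1 ◁ (ρ_ R.obj).inv ≫ actOn R.mulU (𝟙_ _) := by
    rw [actOn]; simp
  rw [whiskerLeft_sub', Preadditive.sub_comp, Preadditive.comp_sub]
  simp only [MonoidalCategory.whiskerLeft_comp, Category.assoc]
  rw [reassoc_of% h, actOn_natural, actOn_natural, reassoc_of% h']

/-- The map defining `C[1]`, for `T` small, is compatible with division by `u`. -/
lemma lowerU_equivariant [DGMonoidal P] (hT : IsSelfTrivial T) (k : S ⊗ T ≅ 𝟙_ (Center (Cx P)))
    (R : Series T) (p : T.1 ⟶ G) (q : 𝟙_ (Cx P) ⟶ G) :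
    R.lowerU k ≫ (R.divU ≫ (T.2.β R.obj).hom ≫ R.obj ◁ p - (ρ_ R.obj).inv ≫ R.obj ◁ q) =
      S.1 ◁ (R.divU ≫ (T.2.β R.obj).hom ≫ R.obj ◁ p - (ρ_ R.obj).inv ≫ R.obj ◁ q) ≫
        actOn (R.lowerU k) G := by
  have h1 : (T.2.β R.obj).hom ≫ unf R.divU T.1 = T.1 ◁ R.divU ≫ T.1 ◁ (T.2.β R.obj).hom := by
    rw [unf, ← T.2.naturality_assoc, hT.halfBraiding_tensor]
    simp
  have h2 := contract_natural k R.divU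
  have h3 := contract_natural k (T.2.β R.obj).hom
  have h : R.lowerU k ≫ R.divU ≫ (T.2.β R.obj).hom =
      S.1 ◁ R.divU ≫ S.1 ◁ (T.2.β R.obj).hom ≫ actOn (R.lowerU k) T.1 := by
    rw [actOn_lowerU, ← MonoidalCategory.whiskerLeft_comp_assoc S.1 (T.2.β R.obj).hom, h1,
      MonoidalCategory.whiskerLeft_comp, Category.assoc, h3, reassoc_of% h2, Series.lowerU,
      Category.assoc]
  have h' : R.lowerU k ≫ (ρ_ R.obj).inv = S.1 ◁ (ρ_ R.obj).inv ≫ actOn (R.lowerU k) (𝟙_ _) := by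
    rw [actOn]; simp
  rw [whiskerLeft_sub', Preadditive.sub_comp, Preadditive.comp_sub]
  simp only [MonoidalCategory.whiskerLeft_comp, Category.assoc]
  rw [reassoc_of% h, actOn_natural, actOn_natural, reassoc_of% h']

end Equivariant

section Transport

variable {B : Type u} [Category.{v} B] [Preadditive B] {P : ObjectProperty (CochainComplex B ℤ)}
  [MonoidalCategory (Cx P)] [DGMonoidal P]
variable {L D : Center (Cx P)} {F X Y : Cx P} {a : L.1 ⟶ F} {b : D.1 ⟶ F}

open DGMonoidal

/-- The relation `a ≃ b ∘ V` can be transported along closed invertible maps of any degree. -/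
lemma FactorsThrough.of_graded_iso {V : L.1 ⊗ Y ⟶ D.1 ⊗ Y} {V' : L.1 ⊗ X ⟶ D.1 ⊗ X}
    (hV : FactorsThrough a b Y V) {p q : ℤ} (z : Coch X Y p) (w : Coch Y X q) (hpq : p + q = 0)
    (hz : δ p (p + 1) z = 0) (hw : δ q (q + 1) w = 0) (hzw : z.comp w hpq = coch (𝟙 X))
    (h : pre V' (wL D.1 z) = post (wL L.1 z) V) : FactorsThrough a b X V' := by
  obtain ⟨H, hH⟩ := hV
  have h1 : ((post (wL L.1 z) (a ▷ Y)).comp (wL F w) hpq) = coch (a ▷ X) := by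
    have : pre (a ▷ X) (wL F z) = post (wL L.1 z) (a ▷ Y) := pre_wL_exchange a z
    rw [← this, pre_comp, ← wL_comp, hzw, wL_coch, pre_coch]
    simp
  have h2 : ((post (wL L.1 z) (V ≫ b ▷ Y)).comp (wL F w) hpq) = coch (V' ≫ b ▷ X) := by
    have : pre (b ▷ X) (wL F z) = post (wL D.1 z) (b ▷ Y) := pre_wL_exchange b z
    rw [← post_post, ← h, post_pre, ← this, pre_pre, pre_comp, ← wL_comp, hzw, wL_coch, pre_coch]
    simp
  refine ⟨q.negOnePow • ((wL L.1 z).comp H (show p + (-1) = p - 1 by ring)).comp (wL F w)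
    (by lia), ?_⟩
  rw [δ_units_smul, δ_comp _ _ _ p (q + 1) 0 (by lia) (by lia) (by lia), δ_wL, hw, map_zero,
    Cochain.comp_zero, zero_add,
    δ_comp _ _ _ (p + 1) 0 p (by lia) (by lia) (by lia), δ_wL, hz, map_zero, Cochain.zero_comp,
    smul_zero, add_zero, hH, smul_smul, Int.units_mul_self, one_smul, Cochain.comp_sub,
    Cochain.sub_comp]
  exact congrArg₂ _ h1 h2

end Transport

/-! ### The complexes `C` with their periodicity maps -/

section Shift

variable {B : Type u} [Category.{v} B] [Preadditive B] {P : ObjectProperty (CochainComplex B ℤ)}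
  [P.IsStableUnderShift ℤ] [MonoidalCategory (Cx P)] [DGMonoidal P]
variable {L D : Center (Cx P)} {F C N X : Cx P} {a : L.1 ⟶ F} {b : D.1 ⟶ F}

open DGMonoidal

/-- The endomorphism of `C[-1]` induced by an endomorphism `u₀` of `C` is a chain map. -/
lemma exists_shift_map (u₀ : X ⊗ C ⟶ C) :
    ∃ u : X ⊗ shift C (-1) ⟶ shift C (-1),
      coch u = (post (wL X (fromShift C)) u₀).comp (toShift C) (neg_add_cancel 1) ∧
      pre u (fromShift C) = post (wL X (fromShift C)) u₀ := by
  obtain ⟨u, hu⟩ := exists_eq_coch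
    ((post (wL X (fromShift C)) u₀).comp (toShift C) (neg_add_cancel 1)) (by
      rw [δ_comp _ _ _ 0 2 1 (by norm_num) (by norm_num) (by norm_num), δ_toShift, δ_post, δ_wL,
        δ_fromShift]
      simp [zero_post])
  refine ⟨u, hu, ?_⟩
  change (coch u).comp _ _ = _
  rw [hu, Cochain.comp_assoc _ _ _ (neg_add_cancel 1) (add_neg_cancel 1) (by norm_num),
    toShift_comp_fromShift]
  exact post_id _

/-- The relation `a ≃ b ∘ V` is inherited by the shift of the left tensor factor. -/
lemma FactorsThrough.shift {V : L.1 ⊗ (C ⊗ N) ⟶ D.1 ⊗ (C ⊗ N)} (hV : FactorsThrough a b (C ⊗ N) V)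
    {V' : L.1 ⊗ (shift C (-1) ⊗ N) ⟶ D.1 ⊗ (shift C (-1) ⊗ N)}
    (h : pre V' (wL D.1 (wR N (fromShift C))) = post (wL L.1 (wR N (fromShift C))) V) :
    FactorsThrough a b (shift C (-1) ⊗ N) V' := by
  refine hV.of_graded_iso (wR N (fromShift C)) (wR N (toShift C)) (neg_add_cancel 1) ?_ ?_ ?_ h
  · rw [δ_wR]
    exact (congrArg _ (δ_fromShift C)).trans (map_zero _)
  · rw [δ_wR]
    exact (congrArg _ (δ_toShift C)).trans (map_zero _)
  · rw [← wR_comp, fromShift_comp_toShift, wR_coch, id_whiskerRight]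

omit [P.IsStableUnderShift ℤ] in
/-- Moving central objects past the left factor is natural for graded maps of that factor. -/
lemma sw_conj_natural_graded (hL : IsGradedCentral L) (hD : IsGradedCentral D) {Y : Cx P} {n : ℤ}
    (z : Coch X Y n) (V : L.1 ⊗ N ⟶ D.1 ⊗ N) :
    pre ((sw L X N).hom ≫ X ◁ V ≫ (sw D X N).inv) (wL D.1 (wR N z)) =
      post (wL L.1 (wR N z)) ((sw L Y N).hom ≫ Y ◁ V ≫ (sw D Y N).inv) := by
  have h4 : pre (sw D X N).inv (wL D.1 (wR N z)) = post (wR (D.1 ⊗ N) z) (sw D Y N).inv := by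
    rw [eq_comm, ← pre_eq_iff, ← post_pre, ← sw_natural_left_graded hD, post_post, Iso.hom_inv_id,
      post_id]
  rw [← pre_pre, ← pre_pre, h4, ← post_pre, pre_wR_exchange, post_post, ← post_pre,
    ← sw_natural_left_graded hL, post_post]

end Shift

section Factors

variable {B : Type u} [Category.{v} B] [Preadditive B] [HasBinaryBiproducts B]
  {P : ObjectProperty (CochainComplex B ℤ)}
  [P.IsStableUnderShift ℤ] [IsClosedUnderCones P] [MonoidalCategory (Cx P)] [DGMonoidal P]

open DGMonoidal

omit [HasBinaryBiproducts B] [P.IsStableUnderShift ℤ] [IsClosedUnderCones P] [DGMonoidal P] in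
lemma zigzag_comp_associator_inv {A R S Y X X' F : Cx P} (v : A ⟶ R ⊗ S) (w : A ⟶ R)
    (f : S ⟶ Y ⊗ X) (g : 𝟙_ (Cx P) ⟶ Y ⊗ X') (a : X ⟶ F) (b : X' ⟶ F) :
    (v ≫ R ◁ f ≫ (α_ R Y X).inv) ≫ (R ⊗ Y) ◁ a -
        (w ≫ (ρ_ R).inv ≫ R ◁ g ≫ (α_ R Y X').inv) ≫ (R ⊗ Y) ◁ b =
      (v ≫ R ◁ (f ≫ Y ◁ a) - w ≫ (ρ_ R).inv ≫ R ◁ (g ≫ Y ◁ b)) ≫ (α_ R Y F).inv := by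
  rw [Preadditive.sub_comp]
  simp

omit [HasBinaryBiproducts B] [P.IsStableUnderShift ℤ] [IsClosedUnderCones P] [DGMonoidal P] in
lemma zigzag_comp_associator_inv' {A R S Y X X' F : Cx P} (w : R ⟶ A) (v : A ⟶ R ⊗ S)
    (f : S ⟶ Y ⊗ X) (g : 𝟙_ (Cx P) ⟶ Y ⊗ X') (a : X ⟶ F) (b : X' ⟶ F) :
    (w ≫ v ≫ R ◁ f ≫ (α_ R Y X).inv) ≫ (R ⊗ Y) ◁ a -
        ((ρ_ R).inv ≫ R ◁ g ≫ (α_ R Y X').inv) ≫ (R ⊗ Y) ◁ b =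
      (w ≫ v ≫ R ◁ (f ≫ Y ◁ a) - (ρ_ R).inv ≫ R ◁ (g ≫ Y ◁ b)) ≫ (α_ R Y F).inv := by
  rw [Preadditive.sub_comp]
  simp

namespace ConeData

variable {A G G' C X : Cx P} {φ : A ⟶ G} {φ' : A ⟶ G'}

/-- The cone structure transported along an isomorphism of `G`. -/
abbrev mapIso (K : ConeData φ C) (e : G ≅ G') (h : φ' = φ ≫ e.hom) : ConeData φ' C :=
  K.ofIso (Iso.refl A) e (by rw [h, Iso.refl_hom, Category.id_comp])

omit [HasBinaryBiproducts B] [P.IsStableUnderShift ℤ] [IsClosedUnderCones P] in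
lemma IsDiag.mapIso {K : ConeData φ C} {u : X ⊗ C ⟶ C} {uA : X ⊗ A ⟶ A} {uG : X ⊗ G ⟶ G}
    (hu : IsDiag (K.tensorLeft X) K u uA uG) (e : G ≅ G') (h : φ' = φ ≫ e.hom)
    {uG' : X ⊗ G' ⟶ G'} (hG : uG ≫ e.hom = X ◁ e.hom ≫ uG') :
    IsDiag ((K.mapIso e h).tensorLeft X) (K.mapIso e h) u uA uG' where
  fst := by
    change pre u (post K.fst (𝟙 _)) = post (wL X (post K.fst (𝟙 _))) uA
    rw [post_id]
    exact hu.fst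
  snd := by
    change pre u (post K.snd e.hom) = post (wL X (post K.snd e.hom)) uG'
    have h2 : _ = post (wL X K.snd) uG := hu.snd
    rw [← post_pre, h2, wL_post, post_post, post_post, hG]

end ConeData

variable {K : Type w} [Category.{w'} K] [MonoidalCategory K] [SymmetricCategory K]
  {ρ : K ⥤ Center (Cx P)} {F X Y : Cx P}

omit [P.IsStableUnderShift ℤ] [MonoidalCategory K] [SymmetricCategory K] in
/-- The endomorphism of a cone induced by compatible endomorphisms `f` and `g` is a chain map. -/
lemma exists_coneEnd {s : K} (φ : X ⟶ Y) (f : (ρ.obj s).1 ⊗ X ⟶ X) (g : (ρ.obj s).1 ⊗ Y ⟶ Y)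
    (h : f ≫ φ = (ρ.obj s).1 ◁ φ ≫ g) :
    ∃ u : (ρ.obj s).1 ⊗ cone φ ⟶ cone φ, coch u = coneEnd (ρ := ρ) φ f g ∧
      ConeData.IsDiag ((ConeData.ofCone φ).tensorLeft (ρ.obj s).1) (ConeData.ofCone φ) u f g := by
  obtain ⟨u, hu, hd⟩ := ((ConeData.ofCone φ).tensorLeft (ρ.obj s).1).exists_isDiag
    (ConeData.ofCone φ) f g h
  refine ⟨u, hu.trans ?_, hd⟩
  exact congrArg₂ _ rfl (post_post _ _ _).symm

variable [ρ.Braided] {l m : InvertibleScalar K}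

omit [HasBinaryBiproducts B] [P.IsStableUnderShift ℤ] [IsClosedUnderCones P] in
lemma posMap_eq (Γ : Small ρ (l.div m)) (a : (ρ.obj l.obj).1 ⟶ F) (b : (ρ.obj m.obj).1 ⟶ F) :
    posMap Γ.series a b = zigzagPos Γ a b ≫ (α_ _ _ _).inv := by
  rw [posMap, numMap, denMap, centerDiv_f, centerInvMul_inv_f]
  exact zigzag_comp_associator_inv _ _ _ _ _ _

omit [HasBinaryBiproducts B] [P.IsStableUnderShift ℤ] [IsClosedUnderCones P] in
lemma negMap_eq (Γ : Small ρ (l.div m)) (a : (ρ.obj l.obj).1 ⟶ F) (b : (ρ.obj m.obj).1 ⟶ F) :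
    negMap Γ.series a b = zigzagNeg Γ a b ≫ (α_ _ _ _).inv := by
  rw [negMap, numMap, denMap, centerDiv_f, centerInvMul_inv_f]
  exact zigzag_comp_associator_inv' _ _ _ _ _ _

/-- The cone structure of `C`, for `l / m` small. -/
def posData (Γ : Small ρ (l.div m)) (a : (ρ.obj l.obj).1 ⟶ F) (b : (ρ.obj m.obj).1 ⟶ F) :
    ConeData (posMap Γ.series a b) (cPos Γ a b).obj :=
  (ConeData.ofCone (zigzagPos Γ a b)).mapIso (α_ _ _ _).symm (posMap_eq Γ a b)

/-- The cone structure of `C[1]`, for `l / m` small. -/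
def negData (Γ : Small ρ (l.div m)) (a : (ρ.obj l.obj).1 ⟶ F) (b : (ρ.obj m.obj).1 ⟶ F) :
    ConeData (negMap Γ.series a b) (cone (zigzagNeg Γ a b)) :=
  (ConeData.ofCone (zigzagNeg Γ a b)).mapIso (α_ _ _ _).symm (negMap_eq Γ a b)

omit [HasBinaryBiproducts B] [P.IsStableUnderShift ℤ] [IsClosedUnderCones P] [DGMonoidal P] in
lemma isSelfTrivial_div (hl : IsSelfTrivial (ρ.obj l.obj)) (hm : IsSelfTrivial (ρ.obj m.obj)) :
    IsSelfTrivial (ρ.obj (l.div m)) :=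
  isSelfTrivial_of_sw (sw_self_quot (centerDiv ρ l m) hl (sw_self_inv (centerInvMul ρ m) hm)
    (isSymm_obj ρ _ _))

omit [P.IsStableUnderShift ℤ] in
/-- The periodicity map of `C` is a chain map, and diagonal with respect to the cone structure. -/
lemma exists_cPos_map (hl : IsSelfTrivial (ρ.obj l.obj)) (hm : IsSelfTrivial (ρ.obj m.obj))
    (Γ : Small ρ (l.div m)) (a : (ρ.obj l.obj).1 ⟶ F) (b : (ρ.obj m.obj).1 ⟶ F) :
    ∃ u : (ρ.obj (l.div m)).1 ⊗ (cPos Γ a b).obj ⟶ (cPos Γ a b).obj, coch u = (cPos Γ a b).map ∧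
      ConeData.IsDiag ((posData Γ a b).tensorLeft _) (posData Γ a b) u
        ((ρ.obj (l.div m)).1 ◁ Γ.series.mulU) (actOn (actOn Γ.series.mulU (ρ.obj m.inv).1) F) := by
  obtain ⟨u, hu, hd⟩ := exists_coneEnd (ρ := ρ) (s := l.div m) (zigzagPos Γ a b)
    ((ρ.obj (l.div m)).1 ◁ Γ.series.mulU) (actOn Γ.series.mulU ((ρ.obj m.inv).1 ⊗ F))
    (mulU_equivariant (isSelfTrivial_div hl hm) Γ.series (divMap ρ m a) (divSelfMap ρ b))
  refine ⟨u, hu, hd.mapIso _ (posMap_eq Γ a b) ?_⟩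
  rw [actOn_actOn]
  exact (whiskerLeft_inv_hom_assoc _ _ _).symm

omit [HasBinaryBiproducts B] [P.IsStableUnderShift ℤ] [IsClosedUnderCones P] in
lemma lowerU_eq (Γ : Small ρ (l.div m)) :
    lowerU Γ = Γ.series.lowerU (centerDivMulDiv ρ m l) := by
  rw [Series.lowerU, contract_hom, centerDivMulDiv_f]
  rfl

omit [P.IsStableUnderShift ℤ] in
/-- The periodicity map of `C[1]` is a chain map, and diagonal with respect to the cone
structure. -/
lemma exists_lower_map (hl : IsSelfTrivial (ρ.obj l.obj)) (hm : IsSelfTrivial (ρ.obj m.obj))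
    (Γ : Small ρ (l.div m)) (a : (ρ.obj l.obj).1 ⟶ F) (b : (ρ.obj m.obj).1 ⟶ F) :
    ∃ u : (ρ.obj (m.div l)).1 ⊗ cone (zigzagNeg Γ a b) ⟶ cone (zigzagNeg Γ a b),
      coch u = coneEnd (ρ := ρ) (s := m.div l) (zigzagNeg Γ a b) (lowerU Γ)
        ((α_ _ _ _).inv ≫ lowerU Γ ▷ (sc ρ m.inv ⊗ F)) ∧
      ConeData.IsDiag ((negData Γ a b).tensorLeft _) (negData Γ a b) u
        (Γ.series.lowerU (centerDivMulDiv ρ m l))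
        (actOn (actOn (Γ.series.lowerU (centerDivMulDiv ρ m l)) (ρ.obj m.inv).1) F) := by
  obtain ⟨u, hu, hd⟩ := exists_coneEnd (ρ := ρ) (s := m.div l) (zigzagNeg Γ a b)
    (Γ.series.lowerU (centerDivMulDiv ρ m l))
    (actOn (Γ.series.lowerU (centerDivMulDiv ρ m l)) ((ρ.obj m.inv).1 ⊗ F))
    (lowerU_equivariant (isSelfTrivial_div hl hm) (centerDivMulDiv ρ m l) Γ.series (divMap ρ m a)
      (divSelfMap ρ b))
  refine ⟨u, ?_, hd.mapIso _ (negMap_eq Γ a b) ?_⟩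
  · rw [hu, lowerU_eq]
    rfl
  · rw [actOn_actOn]
    exact (whiskerLeft_inv_hom_assoc _ _ _).symm

section Own

variable {a : (ρ.obj l.obj).1 ⟶ F} {b : (ρ.obj m.obj).1 ⟶ F}
  {ha : Coch ((ρ.obj l.obj).1 ⊗ F) (F ⊗ F) (-1)} {hb : Coch ((ρ.obj m.obj).1 ⊗ F) (F ⊗ F) (-1)}

omit [P.IsStableUnderShift ℤ] in
/-- On `C`, for `l / m` small, the action of `a` factors through that of `b` by way of the
periodicity map. -/
lemma exists_map_cPos (hl : IsSelfTrivial (ρ.obj l.obj)) (hm : IsSelfTrivial (ρ.obj m.obj))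
    (Γ : Small ρ (l.div m)) (ca : IsCommHomotopy a ha) (cb : IsCommHomotopy b hb)
    (oaa : ∃ k : Coch ((ρ.obj l.obj).1 ⊗ (ρ.obj l.obj).1) (F ⊗ F) (-2),
      δ (-2) (-1) k = pre ((ρ.obj l.obj).1 ◁ a) ha)
    (obb : ∃ k : Coch ((ρ.obj m.obj).1 ⊗ (ρ.obj m.obj).1) (F ⊗ F) (-2),
      δ (-2) (-1) k = pre ((ρ.obj m.obj).1 ◁ b) hb)
    (oba : Unobstructed b hb a ha) :
    ∃ u : (ρ.obj (l.div m)).1 ⊗ (cPos Γ a b).obj ⟶ (cPos Γ a b).obj, coch u = (cPos Γ a b).map ∧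
      ∀ N, FactorsThrough a b ((cPos Γ a b).obj ⊗ N) (degMap ρ l m (actOn u N)) := by
  obtain ⟨u, hu, hd⟩ := exists_cPos_map hl hm Γ a b
  exact ⟨u, hu, factorsThrough_pos hl hm Γ.series (posData Γ a b) hd ca cb oaa obb oba⟩

/-- On `C`, for `m / l` small, the action of `a` factors through that of `b` by way of the
periodicity map. -/
lemma exists_map_cNeg (hl : IsSelfTrivial (ρ.obj l.obj)) (hm : IsSelfTrivial (ρ.obj m.obj))
    (Γ : Small ρ (m.div l)) (ca : IsCommHomotopy a ha) (cb : IsCommHomotopy b hb)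
    (oaa : ∃ k : Coch ((ρ.obj l.obj).1 ⊗ (ρ.obj l.obj).1) (F ⊗ F) (-2),
      δ (-2) (-1) k = pre ((ρ.obj l.obj).1 ◁ a) ha)
    (obb : ∃ k : Coch ((ρ.obj m.obj).1 ⊗ (ρ.obj m.obj).1) (F ⊗ F) (-2),
      δ (-2) (-1) k = pre ((ρ.obj m.obj).1 ◁ b) hb)
    (oba : Unobstructed b hb a ha) :
    ∃ u : (ρ.obj (l.div m)).1 ⊗ (cNeg Γ b a).obj ⟶ (cNeg Γ b a).obj, coch u = (cNeg Γ b a).map ∧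
      ∀ N, FactorsThrough a b ((cNeg Γ b a).obj ⊗ N) (degMap ρ l m (actOn u N)) := by
  obtain ⟨u₀, hu₀, hd⟩ := exists_lower_map hm hl Γ b a
  obtain ⟨u, hu, h⟩ := exists_shift_map u₀
  refine ⟨u, hu.trans (by rw [post, hu₀]; rfl), fun N => ?_⟩
  exact (factorsThrough_neg hl hm Γ.series (negData Γ b a) hd ca cb oaa obb oba N).shift
    (quotMap_natural_graded _ _ (actOn_natural_graded h N))

end Own

section Past

variable {l' m' : InvertibleScalar K} {a : (ρ.obj l'.obj).1 ⟶ F} {b : (ρ.obj m'.obj).1 ⟶ F}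
  {γ₁ : (ρ.obj l.obj).1 ⟶ F} {γ₂ : (ρ.obj m.obj).1 ⟶ F}
  {ha : Coch ((ρ.obj l'.obj).1 ⊗ F) (F ⊗ F) (-1)} {hb : Coch ((ρ.obj m'.obj).1 ⊗ F) (F ⊗ F) (-1)}
  {h₁ : Coch ((ρ.obj l.obj).1 ⊗ F) (F ⊗ F) (-1)} {h₂ : Coch ((ρ.obj m.obj).1 ⊗ F) (F ⊗ F) (-1)}

omit [P.IsStableUnderShift ℤ] in
lemma factorsThrough_past_cPos (hρ : IsDGCentral ρ) (Γ : Small ρ (l.div m))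
    (ca : IsCommHomotopy a ha) (cb : IsCommHomotopy b hb)
    (c₁ : IsCommHomotopy γ₁ h₁) (c₂ : IsCommHomotopy γ₂ h₂)
    (oa₁ : Unobstructed a ha γ₁ h₁) (ob₁ : Unobstructed b hb γ₁ h₁)
    (oa₂ : Unobstructed a ha γ₂ h₂) (ob₂ : Unobstructed b hb γ₂ h₂)
    {N : Cx P} {V : (ρ.obj l'.obj).1 ⊗ N ⟶ (ρ.obj m'.obj).1 ⊗ N} (hV : FactorsThrough a b N V) :
    FactorsThrough a b ((cPos Γ γ₁ γ₂).obj ⊗ N) ((sw (ρ.obj l'.obj) (cPos Γ γ₁ γ₂).obj N).hom ≫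
      (cPos Γ γ₁ γ₂).obj ◁ V ≫ (sw (ρ.obj m'.obj) (cPos Γ γ₁ γ₂).obj N).inv) :=
  factorsThrough_past_pos hρ Γ.series (posData Γ γ₁ γ₂) ca cb c₁ c₂ oa₁ ob₁ oa₂ ob₂ hV

lemma factorsThrough_past_cNeg (hρ : IsDGCentral ρ) (Γ : Small ρ (l.div m))
    (ca : IsCommHomotopy a ha) (cb : IsCommHomotopy b hb)
    (c₁ : IsCommHomotopy γ₁ h₁) (c₂ : IsCommHomotopy γ₂ h₂)
    (oa₁ : Unobstructed a ha γ₁ h₁) (ob₁ : Unobstructed b hb γ₁ h₁)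
    (oa₂ : Unobstructed a ha γ₂ h₂) (ob₂ : Unobstructed b hb γ₂ h₂)
    {N : Cx P} {V : (ρ.obj l'.obj).1 ⊗ N ⟶ (ρ.obj m'.obj).1 ⊗ N} (hV : FactorsThrough a b N V) :
    FactorsThrough a b ((cNeg Γ γ₁ γ₂).obj ⊗ N) ((sw (ρ.obj l'.obj) (cNeg Γ γ₁ γ₂).obj N).hom ≫
      (cNeg Γ γ₁ γ₂).obj ◁ V ≫ (sw (ρ.obj m'.obj) (cNeg Γ γ₁ γ₂).obj N).inv) := by
  exact (factorsThrough_past_neg hρ Γ.series (negData Γ γ₁ γ₂) ca cb c₁ c₂ oa₁ ob₁ oa₂ ob₂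
    hV).shift (sw_conj_natural_graded (hρ l'.obj) (hρ m'.obj) _ V)

end Past

end Factors

/-! ### The periodicity maps are quotients of eigenmaps -/

section Quotients

variable {B : Type u} [Category.{v} B] [Preadditive B] {P : ObjectProperty (CochainComplex B ℤ)}
  [MonoidalCategory (Cx P)]
  {K : Type w} [Category.{w'} K] [MonoidalCategory K] [SymmetricCategory K]
  {ρ : K ⥤ Center (Cx P)} [ρ.Braided] {F : Cx P} {l m : InvertibleScalar K}

/-- The map `L ⊗ (C ⊗ N) ⟶ M ⊗ (C ⊗ N)` obtained from an endomorphism of `N` is the one on `N`,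
moved past `C`. -/
lemma quotMap_past {S L M M' : Center (Cx P)} (ε : M' ⊗ M ≅ 𝟙_ (Center (Cx P))) (d : S ≅ M' ⊗ L)
    {C N : Cx P} (u : S.1 ⊗ N ⟶ N) :
    quotMap ε d ((sw S C N).hom ≫ C ◁ u) =
      (sw L C N).hom ≫ C ◁ quotMap ε d u ≫ (sw M C N).inv := by
  have h := quotSplit_sw ε d C N
  have h' := sw_natural_right (T := M) C u
  rw [← Category.assoc, Iso.eq_comp_inv, quotMap, quotMap, MonoidalCategory.whiskerLeft_comp,
    MonoidalCategory.whiskerLeft_comp, ← reassoc_of% h]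
  simp only [Category.assoc]
  rw [h']

lemma split_quotMap_contract {S L M M' : Center (Cx P)} (ε : M' ⊗ M ≅ 𝟙_ (Center (Cx P)))
    (d : S ≅ M' ⊗ L) (hM : IsSelfTrivial M) {N : Cx P} (u : S.1 ⊗ N ⟶ N) :
    (split d N).hom ≫ M'.1 ◁ quotMap ε d u ≫ (contract ε N).hom = u := by
  rw [quotMap, MonoidalCategory.whiskerLeft_comp, Category.assoc, contract_natural,
    reassoc_of% split_quotSplit_contract ε d hM]

lemma degMap_past {C N : Cx P} (u : (ρ.obj (l.div m)).1 ⊗ N ⟶ N) :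
    degMap ρ l m ((sw (ρ.obj (l.div m)) C N).hom ≫ C ◁ u) =
      (sw (ρ.obj l.obj) C N).hom ≫ C ◁ degMap ρ l m u ≫ (sw (ρ.obj m.obj) C N).inv :=
  quotMap_past _ _ u

variable [DGMonoidal P]

lemma Homotopic.whiskerLeft {Y Z : Cx P} {f g : Y ⟶ Z} (h : Homotopic (coch f) (coch g))
    (X : Cx P) : Homotopic (coch (X ◁ f)) (coch (X ◁ g)) := by
  obtain ⟨H, hH⟩ := h
  exact ⟨DGMonoidal.wL X H, by
    rw [DGMonoidal.δ_wL, hH, map_sub, DGMonoidal.wL_coch, DGMonoidal.wL_coch]⟩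

omit [DGMonoidal P] in
lemma Unobstructed.self {S : Center (Cx P)} {γ : S.1 ⟶ F} {h : Coch (S.1 ⊗ F) (F ⊗ F) (-1)}
    (hS : IsSelfTrivial S)
    (hw : ∃ k : Coch (S.1 ⊗ S.1) (F ⊗ F) (-2), δ (-2) (-1) k = pre (S.1 ◁ γ) h) :
    Unobstructed γ h γ h := by
  obtain ⟨k, hk⟩ := hw
  refine ⟨k + k, ?_⟩
  have hS' : (S.2.β S.1).hom = 𝟙 _ := hS
  rw [δ_add, hk, hS', Category.id_comp]

/-- If the action of `a` on `M` factors through that of `b` by way of an endomorphism `u` of degree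
`l / m`, then `u` is the quotient of the eigenmaps: cancel the homotopy inverse of `b ⊗ M`, and then
`m⁻¹ ⊗ m`. -/
lemma eigenQuotient_homotopic [HasBinaryBiproducts B] [P.IsStableUnderShift ℤ]
    [IsClosedUnderCones P] (hm : IsSelfTrivial (ρ.obj m.obj)) {M : Cx P} {a : (ρ.obj l.obj).1 ⟶ F}
    {b : (ρ.obj m.obj).1 ⟶ F} {u : (ρ.obj (l.div m)).1 ⊗ M ⟶ M}
    (h : FactorsThrough a b M (degMap ρ l m u)) {g : F ⊗ M ⟶ (ρ.obj m.obj).1 ⊗ M}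
    (hg : IsHomotopyInverse (b ▷ M) g) :
    Homotopic (coch u) (coch (eigenQuotient (ρ := ρ) a g)) := by
  have h1 : Homotopic (coch (a ▷ M ≫ g)) (coch (degMap ρ l m u)) := by
    have h2 : Homotopic (coch (a ▷ M)) (coch (degMap ρ l m u ≫ b ▷ M)) := h
    refine (h2.post g).trans ?_
    have := hg.1.pre (degMap ρ l m u)
    simpa only [Category.assoc, Category.comp_id] using this
  have h3 : eigenQuotient (ρ := ρ) a g = (split (centerDiv ρ l m) M).hom ≫
      (ρ.obj m.inv).1 ◁ (a ▷ M ≫ g) ≫ (contract (centerInvMul ρ m) M).hom := by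
    rw [split_hom, contract_hom, centerDiv_f, centerInvMul_f]
    exact (Category.assoc _ _ _).symm
  have h4 := split_quotMap_contract (centerInvMul ρ m) (centerDiv ρ l m) hm u
  have h5 := ((h1.symm.whiskerLeft (ρ.obj m.inv).1).post (contract (centerInvMul ρ m) M).hom).pre
    (split (centerDiv ρ l m) M).hom
  rw [h4] at h5
  rw [h3]
  exact h5

end Quotients

section Periodicity

variable {B : Type u} [Category.{v} B] [Preadditive B] [HasBinaryBiproducts B]
  {P : ObjectProperty (CochainComplex B ℤ)}
  [P.IsStableUnderShift ℤ] [IsClosedUnderCones P] [MonoidalCategory (Cx P)] [DGMonoidal P]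
  {K : Type w} [Category.{w'} K] [MonoidalCategory K] [SymmetricCategory K]
  {ρ : K ⥤ Center (Cx P)} [ρ.Braided] {F : Cx P}
  {I : Type*} [LinearOrder I] {lam : I → InvertibleScalar K}
  (Γ : ∀ i j, j < i → Small ρ ((lam i).div (lam j))) {α : ∀ i, (ρ.obj (lam i).obj).1 ⟶ F}
  {h : ∀ i, Coch ((ρ.obj (lam i).obj).1 ⊗ F) (F ⊗ F) (-1)}

variable (α) in
/-- A property of `C_{j,i}` is proved separately for `j > i` and for `j < i`. -/
lemma cPair_induction {i : I} {j : {j : I // j ≠ i}}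
    {p : PeriodicComplex ρ ((lam j.1).div (lam i)) → Prop}
    (hpos : ∀ h, p (cPos (Γ j.1 i h) (α j.1) (α i)))
    (hneg : ∀ h, p (cNeg (Γ i j.1 h) (α i) (α j.1))) : p (cPair Γ α i j) := by
  by_cases h : i < j.1
  · have e : cPair Γ α i j = cPos (Γ j.1 i h) (α j.1) (α i) := dif_pos h
    rw [e]
    exact hpos h
  · have e : cPair Γ α i j =
        cNeg (Γ i j.1 (lt_of_le_of_ne (not_lt.mp h) j.2)) (α i) (α j.1) := dif_neg h
    rw [e]
    exact hneg _

variable (α) in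
lemma periodicity_cons_self (i : I) (k : {j : I // j ≠ i}) (L : List {j : I // j ≠ i})
    {u : (ρ.obj ((lam k.1).div (lam i))).1 ⊗ (cPair Γ α i k).obj ⟶ (cPair Γ α i k).obj}
    (hu : coch u = (cPair Γ α i k).map) :
    coch (actOn u (interpolation Γ α i L)) = periodicity Γ α i k (k :: L) := by
  have h : periodicity Γ α i k (k :: L) = (coch (α_ _ _ _).inv).comp
    (DGMonoidal.wR (interpolation Γ α i L) (cPair Γ α i k).map) (zero_add 0) := dif_pos rfl
  rw [h, ← hu]
  exact (pre_coch _ _).symm.trans (congrArg (pre _) (DGMonoidal.wR_coch u _).symm)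

variable (α) in
lemma periodicity_cons_of_ne (i : I) {j k : {j : I // j ≠ i}} (hk : k ≠ j)
    (L : List {j : I // j ≠ i})
    {u : (ρ.obj ((lam j.1).div (lam i))).1 ⊗ interpolation Γ α i L ⟶ interpolation Γ α i L}
    (hu : coch u = periodicity Γ α i j L) :
    coch ((sw (ρ.obj ((lam j.1).div (lam i))) (cPair Γ α i k).obj (interpolation Γ α i L)).hom ≫
      (cPair Γ α i k).obj ◁ u) = periodicity Γ α i j (k :: L) := by
  have h : periodicity Γ α i j (k :: L) = (coch ((α_ _ _ _).inv ≫
        (swap ρ ((lam j.1).div (lam i)) (cPair Γ α i k).obj).hom ▷ interpolation Γ α i L ≫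
        (α_ _ _ _).hom)).comp
        (DGMonoidal.wL (cPair Γ α i k).obj (periodicity Γ α i j L)) (zero_add 0) := dif_neg hk
  rw [h, ← hu]
  exact (pre_coch _ _).symm.trans (congrArg (pre _) (DGMonoidal.wL_coch _ u).symm)

/-- On `C_{j,i}`, the action of `α j` factors through that of `α i` by way of `u_j / u_i`. -/
lemma exists_cPair_map (hl : ∀ i, IsSelfTrivial (ρ.obj (lam i).obj))
    (hc : ∀ i, IsCommHomotopy (α i) (h i))
    (hw : ∀ i, ∃ k : Coch ((ρ.obj (lam i).obj).1 ⊗ (ρ.obj (lam i).obj).1) (F ⊗ F) (-2),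
      δ (-2) (-1) k = pre ((ρ.obj (lam i).obj).1 ◁ α i) (h i))
    (ho : ∀ i j, Unobstructed (α i) (h i) (α j) (h j)) (i : I) (j : {j : I // j ≠ i}) :
    ∃ u : (ρ.obj ((lam j.1).div (lam i))).1 ⊗ (cPair Γ α i j).obj ⟶ (cPair Γ α i j).obj,
      coch u = (cPair Γ α i j).map ∧ ∀ N, FactorsThrough (α j.1) (α i) ((cPair Γ α i j).obj ⊗ N)
        (degMap ρ (lam j.1) (lam i) (actOn u N)) := by
  refine cPair_induction (p := fun C => ∃ u : (ρ.obj ((lam j.1).div (lam i))).1 ⊗ C.obj ⟶ C.obj,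
      coch u = C.map ∧ ∀ N, FactorsThrough (α j.1) (α i) (C.obj ⊗ N)
        (degMap ρ (lam j.1) (lam i) (actOn u N))) Γ α (fun _ => ?_) (fun _ => ?_)
  · exact exists_map_cPos (hl _) (hl _) _ (hc _) (hc _) (hw _) (hw _) (ho _ _)
  · exact exists_map_cNeg (hl _) (hl _) _ (hc _) (hc _) (hw _) (hw _) (ho _ _)

/-- The relation between the actions of `α j'` and `α i'` is inherited by the tensor product with
`C_{k,i}`. -/
lemma factorsThrough_past_cPair (hρ : IsDGCentral ρ) (hc : ∀ i, IsCommHomotopy (α i) (h i))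
    (ho : ∀ i j, Unobstructed (α i) (h i) (α j) (h j)) (i : I) (k : {j : I // j ≠ i}) {i' j' : I}
    {N : Cx P} {V : (ρ.obj (lam j').obj).1 ⊗ N ⟶ (ρ.obj (lam i').obj).1 ⊗ N}
    (hV : FactorsThrough (α j') (α i') N V) :
    FactorsThrough (α j') (α i') ((cPair Γ α i k).obj ⊗ N)
      ((sw (ρ.obj (lam j').obj) (cPair Γ α i k).obj N).hom ≫
        (cPair Γ α i k).obj ◁ V ≫ (sw (ρ.obj (lam i').obj) (cPair Γ α i k).obj N).inv) := by
  refine cPair_induction (p := fun C => FactorsThrough (α j') (α i') (C.obj ⊗ N)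
      ((sw (ρ.obj (lam j').obj) C.obj N).hom ≫ C.obj ◁ V ≫
        (sw (ρ.obj (lam i').obj) C.obj N).inv)) Γ α (fun _ => ?_) (fun _ => ?_)
  · exact factorsThrough_past_cPos hρ _ (hc _) (hc _) (hc _) (hc _) (ho _ _) (ho _ _) (ho _ _)
      (ho _ _) hV
  · exact factorsThrough_past_cNeg hρ _ (hc _) (hc _) (hc _) (hc _) (ho _ _) (ho _ _) (ho _ _)
      (ho _ _) hV

/-- The periodicity map `u_j / u_i` of an interpolation complex is a chain map, and the action of
`α j` factors through that of `α i` by way of this map. -/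
lemma exists_periodicity (hρ : IsDGCentral ρ) (hl : ∀ i, IsSelfTrivial (ρ.obj (lam i).obj))
    (hc : ∀ i, IsCommHomotopy (α i) (h i))
    (hw : ∀ i, ∃ k : Coch ((ρ.obj (lam i).obj).1 ⊗ (ρ.obj (lam i).obj).1) (F ⊗ F) (-2),
      δ (-2) (-1) k = pre ((ρ.obj (lam i).obj).1 ◁ α i) (h i))
    (ho : ∀ i j, Unobstructed (α i) (h i) (α j) (h j)) (i : I) (j : {j : I // j ≠ i})
    (L : List {j : I // j ≠ i}) (hj : j ∈ L) :
    ∃ u : (ρ.obj ((lam j.1).div (lam i))).1 ⊗ interpolation Γ α i L ⟶ interpolation Γ α i L,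
      coch u = periodicity Γ α i j L ∧ FactorsThrough (α j.1) (α i) (interpolation Γ α i L)
        (degMap ρ (lam j.1) (lam i) u) := by
  induction L with
  | nil => simp at hj
  | cons k L ih =>
    by_cases hk : k = j
    · subst hk
      obtain ⟨u, hu, hu'⟩ := exists_cPair_map Γ hl hc hw ho i k
      exact ⟨actOn u _, periodicity_cons_self Γ α i k L hu, hu' _⟩
    · obtain ⟨u, hu, hu'⟩ := ih ((List.mem_cons.1 hj).resolve_left (Ne.symm hk))
      refine ⟨(sw (ρ.obj _) (cPair Γ α i k).obj (interpolation Γ α i L)).hom ≫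
        (cPair Γ α i k).obj ◁ u, periodicity_cons_of_ne Γ α i hk L hu, ?_⟩
      have h := factorsThrough_past_cPair Γ hρ hc ho i k hu'
      exact (degMap_past u).symm ▸ h

end Periodicity

/-! ### Eigenmaps that are equivalences on interpolation complexes -/

section GradedIso

variable {B : Type u} [Category.{v} B] [Preadditive B] {P : ObjectProperty (CochainComplex B ℤ)}

/-- Contractibility can be transported along closed invertible maps of any degree. -/
lemma IsContractible.of_graded_iso {X Y : Cx P} (hY : IsContractible Y) {p q : ℤ} (z : Coch X Y p)
    (w : Coch Y X q) (hpq : p + q = 0) (hz : δ p (p + 1) z = 0) (hw : δ q (q + 1) w = 0)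
    (hzw : z.comp w hpq = coch (𝟙 X)) : IsContractible X := by
  obtain ⟨H, hH⟩ := hY
  refine ⟨q.negOnePow • (z.comp H (show p + (-1) = p - 1 by ring)).comp w (by lia), ?_⟩
  rw [δ_units_smul, δ_comp _ _ _ p (q + 1) 0 (by lia) (by lia) (by lia), hw,
    Cochain.comp_zero, zero_add,
    δ_comp _ _ _ (p + 1) 0 p (by lia) (by lia) (by lia), hz, Cochain.zero_comp,
    smul_zero, add_zero, hH, smul_smul, Int.units_mul_self, one_smul, sub_zero, sub_zero]
  exact (congrArg (fun y : Coch X Y p => y.comp w hpq) (post_id z)).trans hzw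

variable [P.IsStableUnderShift ℤ] [MonoidalCategory (Cx P)] [DGMonoidal P]

open DGMonoidal

lemma IsContractible.shift {X C Y : Cx P} (h : IsContractible (X ⊗ (C ⊗ Y))) :
    IsContractible (X ⊗ (shift C (-1) ⊗ Y)) := by
  refine h.of_graded_iso (wL X (wR Y (fromShift C))) (wL X (wR Y (toShift C))) (neg_add_cancel 1)
    ?_ ?_ ?_
  · rw [δ_wL, δ_wR]
    exact (congrArg (fun y => wL X (wR Y y)) (δ_fromShift C)).trans (by simp)
  · rw [δ_wL, δ_wR]
    exact (congrArg (fun y => wL X (wR Y y)) (δ_toShift C)).trans (by simp)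
  · rw [← wL_comp, ← wR_comp, fromShift_comp_toShift, wR_coch, wL_coch, id_whiskerRight,
      MonoidalCategory.whiskerLeft_id]

variable {X Y V W Z : Cx P} {f : V ⟶ W}

omit [P.IsStableUnderShift ℤ] [DGMonoidal P] in
lemma IsHEquivAt.comp_isoHom (h : IsHEquivAt X Y f) (e : Z ≅ V) : IsHEquivAt X Y (e.hom ≫ f) :=
  h.comp_iso e.hom

variable [HasBinaryBiproducts B] [IsClosedUnderCones P]

omit [P.IsStableUnderShift ℤ] in
/-- The cone of `f` is contractible between `X` and `Y` if and only if `f` is an equivalence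
there. -/
lemma isContractible_cone_iff : IsContractible (X ⊗ (cone f ⊗ Y)) ↔ IsHEquivAt X Y f :=
  ⟨(((ConeData.ofCone f).tensorRight Y).tensorLeft X).isHEquiv,
    (((ConeData.ofCone f).tensorRight Y).tensorLeft X).isContractible⟩

end GradedIso

section Interpolation

variable {B : Type u} [Category.{v} B] [Preadditive B] [HasBinaryBiproducts B]
  {P : ObjectProperty (CochainComplex B ℤ)}
  [P.IsStableUnderShift ℤ] [IsClosedUnderCones P] [MonoidalCategory (Cx P)] [DGMonoidal P]
  {K : Type w} [Category.{w'} K] [MonoidalCategory K] [SymmetricCategory K]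
  {ρ : K ⥤ Center (Cx P)} [ρ.Braided] {F X Y : Cx P} {l m : InvertibleScalar K}

omit [P.IsStableUnderShift ℤ] in
/-- Where the cone of the numerator `a` is contractible, so is `C`, for `l / m` small. -/
lemma isContractible_cPos (Γ : Small ρ (l.div m)) {a : (ρ.obj l.obj).1 ⟶ F}
    (b : (ρ.obj m.obj).1 ⟶ F) (h : IsContractible (X ⊗ (cone a ⊗ Y))) :
    IsContractible (X ⊗ ((cPos Γ a b).obj ⊗ Y)) := by
  have h1 := (isContractible_cone_iff.1 h).whiskerLeft (ρ.obj m.inv)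
  have h2 : IsHEquivAt X Y (divMap ρ m a) := h1.comp_isoHom (divIso ρ l m)
  exact isContractible_cone_iff.2 (Γ.series.isHEquivAt_pos (divSelfMap ρ b) h2)

/-- Where the cone of the denominator `b` is contractible, so is the shifted cone `C`, for `l / m`
small. -/
lemma isContractible_cNeg (Γ : Small ρ (l.div m)) (a : (ρ.obj l.obj).1 ⟶ F)
    {b : (ρ.obj m.obj).1 ⟶ F} (h : IsContractible (X ⊗ (cone b ⊗ Y))) :
    IsContractible (X ⊗ ((cNeg Γ a b).obj ⊗ Y)) := by
  have h1 := (isContractible_cone_iff.1 h).whiskerLeft (ρ.obj m.inv)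
  have h2 : IsHEquivAt X Y (divSelfMap ρ b) := h1.comp_isoHom (invMulIso ρ m).symm
  have h3 := isContractible_cone_iff.2 (Γ.series.isHEquivAt_neg (divMap ρ m a) h2)
  exact h3.shift

variable {I : Type*} [LinearOrder I] {lam : I → InvertibleScalar K}
  (Γ : ∀ i j, j < i → Small ρ ((lam i).div (lam j))) (α : ∀ i, (ρ.obj (lam i).obj).1 ⟶ F)

lemma isContractible_cPair (i : I) (k : {j : I // j ≠ i})
    (h : IsContractible (X ⊗ (cone (α k.1) ⊗ Y))) :
    IsContractible (X ⊗ ((cPair Γ α i k).obj ⊗ Y)) := by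
  refine cPair_induction (p := fun C => IsContractible (X ⊗ (C.obj ⊗ Y))) Γ α
    (fun hk => ?_) (fun hk => ?_)
  · exact isContractible_cPos (Γ k.1 i hk) (α i) h
  · exact isContractible_cNeg (Γ i k.1 hk) (α i) h

/-- In a contractible tensor product, the cones of the eigenmaps `α j` may be replaced by the
complexes `C_{j,i}`. -/
lemma isContractible_interpolation (i : I) (L : List {j : I // j ≠ i}) (X : Cx P)
    (h : IsContractible (X ⊗ tensorList (L.map fun j => cone (α j.1)))) :
    IsContractible (X ⊗ interpolation Γ α i L) := by
  induction L generalizing X with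
  | nil => exact h
  | cons k L ih =>
    have h1 := isContractible_cPair Γ α i k
      (show IsContractible (X ⊗ (cone (α k.1) ⊗ tensorList (L.map fun j => cone (α j.1)))) from h)
    exact (ih (X ⊗ (cPair Γ α i k).obj) (h1.of_iso (α_ _ _ _).symm)).of_iso (α_ _ _ _)

/-- `α i` is an equivalence on `P_i`: its cone is tensored with the complexes `C_{j,i}`, which may
replace the other eigencones in the contractible tensor product of all of them. -/
lemma isHEquiv_whiskerRight_interpolation
    (hsat : IsSaturated (lam := fun i => (lam i).obj) ρ α) (i : I) (L : List {j : I // j ≠ i})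
    (hL : L.Nodup) (hL' : ∀ j, j ∈ L) :
    IsHEquiv (α i ▷ interpolation Γ α i L) := by
  have h : IsContractible (cone (α i) ⊗ tensorList (L.map fun j => cone (α j.1))) := by
    have h := hsat.pd1 (i :: L.map Subtype.val) ?_ ?_
    · rw [List.map_cons, List.map_map] at h
      exact h
    · refine List.nodup_cons.2 ⟨?_, hL.map Subtype.val_injective⟩
      simp
    · intro j
      by_cases hj : j = i
      · exact List.mem_cons.2 (Or.inl hj)
      · exact List.mem_cons_of_mem _ (List.mem_map.2 ⟨⟨j, hj⟩, hL' _, rfl⟩)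
  exact ((ConeData.ofCone (α i)).tensorRight _).isHEquiv
    (isContractible_interpolation Γ α i L _ h)

end Interpolation

end

end CatDiag

theorem mainTheorem4
    {B : Type*} [Category B] [Preadditive B] [HasZeroObject B] [HasBinaryBiproducts B]
    {P : ObjectProperty (CochainComplex B ℤ)} [P.IsStableUnderShift ℤ] [IsClosedUnderCones P]
    [MonoidalCategory (Cx P)] [DGMonoidal P]
    {K : Type*} [Category K] [MonoidalCategory K] [SymmetricCategory K]
    (ρ : K ⥤ Center (Cx P)) [ρ.Braided] (hρ : IsDGCentral ρ)
    {F : Cx P} {I : Type*} [Finite I] [LinearOrder I] (lam : I → InvertibleScalar K)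
    (hlam : ∀ i, scMap ρ (β_ (lam i).obj (lam i).obj).hom = 𝟙 _)
    (Γ : ∀ i j, j < i → Small ρ ((lam i).div (lam j)))
    (α : ∀ i, sc ρ (lam i).obj ⟶ F)
    (hsat : IsSaturated ρ α) (hobs : IsObstructionFree ρ α)
    (i : I) (L : List {j : I // j ≠ i}) (hL : L.Nodup) (hL' : ∀ j, j ∈ L) :
    (∃ g, IsHomotopyInverse (α i ▷ interpolation Γ α i L) g) ∧
    ∀ g, IsHomotopyInverse (α i ▷ interpolation Γ α i L) g →
      ∀ j : {j : I // j ≠ i},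
        Homotopic (periodicity Γ α i j L) (coch (eigenQuotient (α j.1) g)) := by
  refine ⟨isHEquiv_whiskerRight_interpolation Γ α hsat i L hL hL', fun g hg j => ?_⟩
  obtain ⟨h, hc, hz, hw⟩ := hobs
  have hl : ∀ i, IsSelfTrivial (ρ.obj (lam i).obj) := fun i => isSelfTrivial_obj ρ (hlam i)
  have ho : ∀ i j, Unobstructed (S := ρ.obj (lam i).obj) (S' := ρ.obj (lam j).obj)
      (α i) (h i) (α j) (h j) := by
    intro i j
    by_cases hij : i = j
    · subst hij
      exact Unobstructed.self (hl i) (hw i)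
    · exact hz i j hij
  obtain ⟨u, hu, hu'⟩ := exists_periodicity Γ hρ hl hc hw ho i j L (hL' j)
  rw [← hu]
  exact eigenQuotient_homotopic (hl i) hu' hg
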